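/- **Setting.** Let $n\ge 2$, $m\ge 1$, let $D\subset\mathbb R^n$ be a bounded open set (for example a bounded Lipschitz domain), and let $\mathbf u\in W^{1,2}(D;\mathbb R^m)$, identified with its continuous representative, be a minimiser of $\int_D(|\nabla\mathbf v|^2+2|\mathbf v|)$ among all $\mathbf v\in W^{1,2}(D;\mathbb R^m)$ with $\mathbf v-\mathbf u\in W^{1,2}_0(D;\mathbb R^m)$. Let $B_r(x)$ be the open ball, $B_1=B_1(0)$, and put $$W(\mathbf u,x^0,r)=\frac1{r^{n+2}}\int_{B_r(x^0)}(|\nabla\mathbf u|^2+2|\mathbf u|)-\frac2{r^{n+3}}\int_{\partial B_r(x^0)}|\mathbf u|^2\,d\mathcal H^{n-1},\qquad W(\mathbf u,x^0,0+)=\lim_{r\downarrow0}W(\mathbf u,x^0,r)\in[-\infty,\infty),$$ $$M(\mathbf v)=\int_{B_1}(|\nabla\mathbf v|^2+2|\mathbf v|)-2\int_{\partial B_1}|\mathbf v|^2\,d\mathcal H^{n-1},\qquad \mathbf u_r(x)=\frac{\mathbf u(x^0+rx)}{r^2},\qquad \mathbf c_r(x)=|x|^2\,\mathbf u_r\!\left(\frac{x}{|x|}\right).$$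 A *blow-up limit* of $\mathbf u$ at $x^0$ is a function $\mathbf u_0\in W^{1,2}_{\rm loc}(\mathbb R^n;\mathbb R^m)$ such that $\mathbf u_{\rho_k}\rightharpoonup\mathbf u_0$ weakly in $W^{1,2}_{\rm loc}(\mathbb R^n;\mathbb R^m)$ for some sequence $0<\rho_k\to0$; in integrals over spheres $\mathbf u_0$ stands for its continuous representative. **Theorem (energy decay and uniqueness of blow-up limits).** For every $n\ge2$ and $\kappa\in(0,1)$ there is a constant $C=C(n,\kappa)$ such that the following holds for all $m$, $D$, $\mathbf u$ as above. Let $x^0\in D\cap\partial\{|\mathbf u|>0\}$ and $0<r_0<1$ with $\overline{B_{r_0}(x^0)}\subset D$, and suppose that the epiperimetric inequality holds with $\kappa$ for each $\mathbf c_r$, $0<r\le r_0$; that is, for every $0<r\le r_0$ there is $\mathbf v\in W^{1,2}(B_1;\mathbb R^m)$ with $\mathbf v=\mathbf c_r$ on $\partial B_1$ and $$M(\mathbf v)\le(1-\kappa)M(\mathbf c_r)+\kappa\,W(\mathbf u,x^0,0+).$$ Then the limit $W(\mathbf u,x^0,0+)$ exists and is finite, $$|W(\mathbf u,x^0,r)-W(\mathbf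 u,x^0,0+)|\le|W(\mathbf u,x^0,r_0)-W(\mathbf u,x^0,0+)|\left(\frac r{r_0}\right)^{\frac{(n+2)\kappa}{1-\kappa}}\quad\text{for }r\in(0,r_0),$$ and for every blow-up limit $\mathbf u_0$ of $\mathbf u$ at $x^0$, $$\int_{\partial B_1}\left|\frac{\mathbf u(x^0+rx)}{r^2}-\mathbf u_0(x)\right|d\mathcal H^{n-1}\le C\,|W(\mathbf u,x^0,r_0)-W(\mathbf u,x^0,0+)|^{\frac12}\left(\frac r{r_0}\right)^{\frac{(n+2)\kappa}{2(1-\kappa)}}\quad\text{for }r\in\left(0,\tfrac{r_0}2\right),$$ and $\mathbf u_0$ is the unique blow-up limit of $\mathbf u$ at $x^0$: every blow-up limit of $\mathbf u$ at $x^0$ equals $\mathbf u_0$ almost everywhere. -/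

import Mathlib

open MeasureTheory Filter Topology Metric Set
open scoped ContDiff ENNReal

namespace SingularSystem

/-- Euclidean space `ℝᵏ`. -/
abbrev Eucl (k : ℕ) : Type := EuclideanSpace ℝ (Fin k)

variable {n m : ℕ}

/-- `G i` is the weak partial derivative `∂ᵢ v` on `Ω`, and `v` and all the `G i` are
square-integrable on `Ω`: `v ∈ W^{1,2}(Ω; ℝᵐ)` with weak gradient `G`. -/
structure IsWeakGrad (Ω : Set (Eucl n)) (v : Eucl n → Eucl m)
    (G : Fin n → Eucl n → Eucl m) : Prop where
  memLp : MemLp v 2 (volume.restrict Ω)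
  memLp_grad : ∀ i, MemLp (G i) 2 (volume.restrict Ω)
  integral_eq : ∀ (i : Fin n) (φ : Eucl n → ℝ), ContDiff ℝ ∞ φ → HasCompactSupport φ →
    tsupport φ ⊆ Ω →
    ∫ x in Ω, (fderiv ℝ φ x (EuclideanSpace.single i 1)) • v x = -∫ x in Ω, φ x • G i x

/-- The Sobolev space `W^{1,2}(Ω; ℝᵐ)`. -/
def MemW12 (Ω : Set (Eucl n)) (v : Eucl n → Eucl m) : Prop :=
  ∃ G : Fin n → Eucl n → Eucl m, IsWeakGrad Ω v G

open scoped Classical in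
/-- The weak gradient of `v ∈ W^{1,2}(Ω; ℝᵐ)`, unique up to null sets (`0` outside of
`W^{1,2}(Ω; ℝᵐ)`). -/
noncomputable def weakGrad (Ω : Set (Eucl n)) (v : Eucl n → Eucl m) :
    Fin n → Eucl n → Eucl m :=
  if h : MemW12 Ω v then h.choose else 0

theorem isWeakGrad_weakGrad {Ω : Set (Eucl n)} {v : Eucl n → Eucl m} (h : MemW12 Ω v) :
    IsWeakGrad Ω v (weakGrad Ω v) := by
  unfold weakGrad
  rw [dif_pos h]
  exact h.choose_spec

/-- The space `W₀^{1,2}(Ω; ℝᵐ)`, the closure of `C_c^∞(Ω; ℝᵐ)` in `W^{1,2}(Ω; ℝᵐ)`. -/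
def MemW12Zero (Ω : Set (Eucl n)) (w : Eucl n → Eucl m) : Prop :=
  MemW12 Ω w ∧ ∃ φ : ℕ → Eucl n → Eucl m,
    (∀ k, ContDiff ℝ ∞ (φ k) ∧ HasCompactSupport (φ k) ∧ tsupport (φ k) ⊆ Ω) ∧
    Tendsto (fun k => eLpNorm (fun x => φ k x - w x) 2 (volume.restrict Ω)) atTop (𝓝 0) ∧
    ∀ i, Tendsto (fun k => eLpNorm
      (fun x => fderiv ℝ (φ k) x (EuclideanSpace.single i 1) - weakGrad Ω w i x) 2
      (volume.restrict Ω)) atTop (𝓝 0)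

/-- `∫_Ω (|∇v|² + 2|v|)`, with the Euclidean (Frobenius) norm of the gradient. -/
noncomputable def energy (Ω : Set (Eucl n)) (v : Eucl n → Eucl m) : ℝ :=
  ∫ x in Ω, ((∑ i, ‖weakGrad Ω v i x‖ ^ 2) + 2 * ‖v x‖)

/-- `u` minimises the energy on `D` among all `W^{1,2}(D; ℝᵐ)` functions with the same boundary
values. -/
def IsMinimiser (D : Set (Eucl n)) (u : Eucl n → Eucl m) : Prop :=
  MemW12 D u ∧ ∀ v : Eucl n → Eucl m, MemW12 D v → MemW12Zero D (v - u) →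
    energy D u ≤ energy D v

/-- `∫_{∂B_r(x₀)} g dℋⁿ⁻¹`. The measure `volume.toSphere` is the surface measure of the unit
sphere, of total mass `n |B₁|`. -/
noncomputable def sphereIntegral (x₀ : Eucl n) (r : ℝ) (g : Eucl n → ℝ) : ℝ :=
  r ^ (n - 1) * ∫ θ : sphere (0 : Eucl n) 1, g (x₀ + r • (θ : Eucl n))
    ∂(volume : Measure (Eucl n)).toSphere

/-- `M(v) = ∫_{B₁} (|∇v|² + 2|v|) - 2 ∫_{∂B₁} |v|² dℋⁿ⁻¹`. -/
noncomputable def balancedEnergy (v : Eucl n → Eucl m) : ℝ :=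
  energy (ball 0 1) v - 2 * sphereIntegral 0 1 (fun x => ‖v x‖ ^ 2)

/-- `W(u, x₀, r) = r^{-n-2} ∫_{B_r(x₀)} (|∇u|² + 2|u|) - 2 r^{-n-3} ∫_{∂B_r(x₀)} |u|² dℋⁿ⁻¹`. -/
noncomputable def weissEnergy (u : Eucl n → Eucl m) (x₀ : Eucl n) (r : ℝ) : ℝ :=
  1 / r ^ (n + 2) * energy (ball x₀ r) u
    - 2 / r ^ (n + 3) * sphereIntegral x₀ r (fun x => ‖u x‖ ^ 2)

/-- `W(u, x₀, 0+)`, as an extended real number. -/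
noncomputable def weissLimit (u : Eucl n → Eucl m) (x₀ : Eucl n) : EReal :=
  limsup (fun r : ℝ => ((weissEnergy u x₀ r : ℝ) : EReal)) (𝓝[>] 0)

/-- `u_r(x) = u(x₀ + r x) / r²`. -/
noncomputable def rescale (u : Eucl n → Eucl m) (x₀ : Eucl n) (r : ℝ) : Eucl n → Eucl m :=
  fun x => (1 / r ^ 2) • u (x₀ + r • x)

/-- `c_r(x) = |x|² u_r(x / |x|)`. -/
noncomputable def homogExt (u : Eucl n → Eucl m) (x₀ : Eucl n) (r : ℝ) : Eucl n → Eucl m :=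
  fun x => ‖x‖ ^ 2 • rescale u x₀ r (‖x‖⁻¹ • x)

/-- `v ∈ W^{1,2}(B₁; ℝᵐ)` has the boundary values of `c` on `∂B₁`. The first conjunct fixes the
pointwise representative of `v` on the null set `∂B₁`. -/
def SameBoundaryValues (v c : Eucl n → Eucl m) : Prop :=
  (∀ x ∈ sphere (0 : Eucl n) 1, v x = c x) ∧ MemW12Zero (ball 0 1) (v - c)

/-- The epiperimetric inequality with constant `κ` and energy level `w` for the function `c`:
`M(v) ≤ (1 - κ) M(c) + κ w` for some `v ∈ W^{1,2}(B₁; ℝᵐ)` with `v = c` on `∂B₁`. -/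
def EpiperimetricIneq (κ : ℝ) (w : EReal) (c : Eucl n → Eucl m) : Prop :=
  ∃ v : Eucl n → Eucl m, MemW12 (ball 0 1) v ∧ SameBoundaryValues v c ∧
    ((balancedEnergy v : ℝ) : EReal) ≤
      (((1 - κ) * balancedEnergy c : ℝ) : EReal) + (κ : EReal) * w

/-- Weak convergence `v_k ⇀ v₀` in `W^{1,2}_loc(ℝⁿ; ℝᵐ)`; on each ball the `v_k` need to be of
class `W^{1,2}` for large `k` only. -/
def WeakConvW12Loc (v : ℕ → Eucl n → Eucl m) (v₀ : Eucl n → Eucl m) : Prop :=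
  ∀ R : ℝ, 0 < R →
    MemW12 (ball 0 R) v₀ ∧ (∀ᶠ k in atTop, MemW12 (ball 0 R) (v k)) ∧
    ∀ ψ : Eucl n → Eucl m, MemLp ψ 2 (volume.restrict (ball 0 R)) →
      Tendsto (fun k => ∫ x in ball 0 R, inner ℝ (v k x) (ψ x)) atTop
        (𝓝 (∫ x in ball 0 R, inner ℝ (v₀ x) (ψ x))) ∧
      ∀ i, Tendsto (fun k => ∫ x in ball 0 R, inner ℝ (weakGrad (ball 0 R) (v k) i x) (ψ x)) atTop
        (𝓝 (∫ x in ball 0 R, inner ℝ (weakGrad (ball 0 R) v₀ i x) (ψ x)))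

/-- `u₀` is a blow-up limit of `u` at `x₀`: the weak limit in `W^{1,2}_loc(ℝⁿ; ℝᵐ)` of the
rescalings `u(x₀ + ρ_k x) / ρ_k²` for some sequence `0 < ρ_k → 0`. -/
def IsBlowUpLimit (u : Eucl n → Eucl m) (x₀ : Eucl n) (u₀ : Eucl n → Eucl m) : Prop :=
  ∃ ρ : ℕ → ℝ, (∀ k, 0 < ρ k) ∧ Tendsto ρ atTop (𝓝 0) ∧
    WeakConvW12Loc (fun k => rescale u x₀ (ρ k)) u₀

end SingularSystem

/-! The Weiss energy W(r) = W(u, x₀, r) is locally absolutely continuous in r > 0, and for almost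
every r its derivative splits into two nonnegative parts, r W'(r) = (n+2) (M(c_r) − W(r)) + ∫_{∂B₁}
|∂_ν u_r − 2u_r|² (`ApproxData.weissEnergy_ac`; M(c_r) is computed in `balancedEnergy_homog`). By
scaling W(r) = M(u_r), so minimality gives W(r) ≤ M(v) for every v with the boundary values of c_r,
in particular for v = c_r (`ApproxData.ae_weissEnergy_le`). Hence W is nondecreasing and has a limit
w at 0+; w = −∞ is impossible, because the right side of the epiperimetric inequality would then be
−∞.

Decay. The epiperimetric competitor gives W(r) ≤ M(v) ≤ (1−κ) M(c_r) + κ w, that is M(c_r) − W(r) ≥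
κ/(1−κ) (W(r) − w). Thus e = W − w satisfies r e' ≥ α e with α = (n+2)κ/(1−κ), and Grönwall's
inequality gives the power decay (`ApproxData.weissEnergy_decay`).

Oscillation. On ∂B₁ one has r ∂_r u_r = ∂_ν u_r − 2u_r, so the second part of W' controls the motion
of u_r. For s ≤ r ≤ 2s, the Cauchy–Schwarz inequality yields ‖u_r − u_s‖² ≤ W(r) − W(s) in L²(∂B₁).
Together with the decay, a geometric series over dyadic radii shows that u_r is Cauchy in L¹(∂B₁)
with rate (r/R)^{α/2} (`ApproxData.sphereDist_le`).

Blow-up limits. The cone c_r is a fixed object to compare all u_ρ with: at distance t from the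
origin both are t² times a rescaling on ∂B₁, so the Cauchy estimate bounds c_r − u_ρ in L¹ of a
shell, and the bound survives weak limits (`ApproxData.integral_shell_homogExt_sub_le`). Letting r →
0 identifies any two blow-up limits; letting the shell shrink to ∂B₁ gives the estimate on the
sphere.

The analytic difficulty is that ∇u has no values on an individual sphere. Mollifications converge to
u uniformly and to ∇u in L², and along a subsequence the gradients converge in L² of almost every
sphere (`exists_subseq_slices`). Therefore c_r ∈ W^{1,2} and u_r − c_r ∈ W₀^{1,2} for almost every r
(`ApproxData.ae_homogExt`), which suffices because W is absolutely continuous. -/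

namespace SingularSystem

variable {n m : ℕ}

/-- The classical partial derivative `∂ᵢ φ`. -/
noncomputable def pderiv (φ : Eucl n → Eucl m) (i : Fin n) : Eucl n → Eucl m :=
  fun x => fderiv ℝ φ x (EuclideanSpace.single i 1)

/-! ### Limits of integrals of products of L² functions -/

section L2

variable {α E F : Type*} [MeasurableSpace α] {μ : Measure α}
  [NormedAddCommGroup E] [NormedSpace ℝ E] [NormedAddCommGroup F] [InnerProductSpace ℝ F]

theorem tendsto_integral_smul_of_eLpNorm {ψ : α → ℝ} (hψ : MemLp ψ 2 μ) {f : ℕ → α → E}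
    {g : α → E} (hf : ∀ k, MemLp (f k) 2 μ) (hg : MemLp g 2 μ)
    (h : Tendsto (fun k => eLpNorm (f k - g) 2 μ) atTop (𝓝 0)) :
    Tendsto (fun k => ∫ x, ψ x • f k x ∂μ) atTop (𝓝 (∫ x, ψ x • g x ∂μ)) := by
  refine tendsto_integral_of_L1' (fun x => ψ x • g x) ?_ (Eventually.of_forall fun k => ?_) ?_
  · exact (hψ.1.smul hg.1)
  · exact memLp_one_iff_integrable.1 ((hf k).smul hψ)
  · have hlim : Tendsto (fun k => eLpNorm ψ 2 μ * eLpNorm (f k - g) 2 μ) atTop (𝓝 0) := by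
      simpa using ENNReal.Tendsto.const_mul h (Or.inr hψ.2.ne)
    refine tendsto_of_tendsto_of_tendsto_of_le_of_le tendsto_const_nhds hlim
      (fun _ => zero_le) (fun k => ?_)
    have := eLpNorm_smul_le_mul_eLpNorm (p := 2) (q := 2) (r := 1)
      ((hf k).sub hg).1 hψ.1
    refine le_trans (le_of_eq ?_) this
    congr 1
    ext x
    simp [smul_sub]

theorem tendsto_integral_inner_of_eLpNorm {f f' : ℕ → α → F} {g g' : α → F}
    (hf : ∀ k, MemLp (f k) 2 μ) (hg : MemLp g 2 μ)
    (hf' : ∀ k, MemLp (f' k) 2 μ) (hg' : MemLp g' 2 μ)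
    (h : Tendsto (fun k => eLpNorm (f k - g) 2 μ) atTop (𝓝 0))
    (h' : Tendsto (fun k => eLpNorm (f' k - g') 2 μ) atTop (𝓝 0)) :
    Tendsto (fun k => ∫ x, inner ℝ (f k x) (f' k x) ∂μ) atTop
      (𝓝 (∫ x, inner ℝ (g x) (g' x) ∂μ)) := by
  have e : ∀ {a b : α → F} (ha : MemLp a 2 μ) (hb : MemLp b 2 μ),
      ∫ x, inner ℝ (a x) (b x) ∂μ = inner ℝ (ha.toLp a) (hb.toLp b) := by
    intro a b ha hb
    rw [L2.inner_def]
    refine integral_congr_ae ?_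
    filter_upwards [ha.coeFn_toLp, hb.coeFn_toLp] with x hx hx'
    rw [hx, hx']
  rw [e hg hg']
  simp_rw [fun k => e (hf k) (hf' k)]
  exact Tendsto.inner ((Lp.tendsto_Lp_iff_tendsto_eLpNorm'' f hf g hg).2 h)
    ((Lp.tendsto_Lp_iff_tendsto_eLpNorm'' f' hf' g' hg').2 h')

end L2

/-! ### Weak gradients: uniqueness, restriction, linearity, closedness -/

section WeakGrad

variable {Ω Ω' : Set (Eucl n)} {v w : Eucl n → Eucl m} {G H : Fin n → Eucl n → Eucl m}

theorem integrable_smul_of_memLp {φ : Eucl n → ℝ} (hφ : Continuous φ) (hc : HasCompactSupport φ)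
    (hv : MemLp v 2 (volume.restrict Ω)) :
    Integrable (fun x => φ x • v x) (volume.restrict Ω) :=
  (hv.locallyIntegrable one_le_two).integrable_smul_left_of_hasCompactSupport hφ hc

theorem continuous_fderiv_apply {φ : Eucl n → ℝ} (hφ : ContDiff ℝ ∞ φ) (e : Eucl n) :
    Continuous fun x => fderiv ℝ φ x e :=
  (hφ.continuous_fderiv (by simp)).clm_apply continuous_const

/-- By the fundamental lemma of the calculus of variations. Since `weakGrad` is an arbitrary choice,
this is what allows the energy to be computed with any explicit gradient, see `energy_eq`. -/
theorem IsWeakGrad.ae_eq (hΩ : IsOpen Ω) (h : IsWeakGrad Ω v G) (h' : IsWeakGrad Ω v H)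
    (i : Fin n) : G i =ᵐ[volume.restrict Ω] H i := by
  have key : ∀ᵐ x ∂(volume : Measure (Eucl n)), x ∈ Ω → (G i - H i) x = 0 := by
    refine hΩ.ae_eq_zero_of_integral_contDiff_smul_eq_zero ?_ ?_
    · exact locallyIntegrableOn_of_locallyIntegrable_restrict
        (((h.memLp_grad i).sub (h'.memLp_grad i)).locallyIntegrable one_le_two)
    · intro φ hφ hc hs
      have e1 := h.integral_eq i φ hφ hc hs
      rw [h'.integral_eq i φ hφ hc hs, neg_inj] at e1
      rw [← setIntegral_eq_integral_of_forall_compl_eq_zero (s := Ω)]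
      · simp_rw [Pi.sub_apply, smul_sub]
        rw [integral_sub (integrable_smul_of_memLp hφ.continuous hc (h.memLp_grad i))
          (integrable_smul_of_memLp hφ.continuous hc (h'.memLp_grad i)), e1, sub_self]
      · intro x hx
        rw [image_eq_zero_of_notMem_tsupport fun hx' => hx (hs hx'), zero_smul]
  rw [EventuallyEq, ae_restrict_iff' hΩ.measurableSet]
  filter_upwards [key] with x hx hxΩ
  exact sub_eq_zero.1 (hx hxΩ)

theorem IsWeakGrad.weakGrad_ae_eq (hΩ : IsOpen Ω) (h : IsWeakGrad Ω v G) (i : Fin n) :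
    weakGrad Ω v i =ᵐ[volume.restrict Ω] G i :=
  (isWeakGrad_weakGrad ⟨G, h⟩).ae_eq hΩ h i

theorem IsWeakGrad.congr (h : IsWeakGrad Ω v G) (hv : v =ᵐ[volume.restrict Ω] w)
    (hG : ∀ i, G i =ᵐ[volume.restrict Ω] H i) : IsWeakGrad Ω w H where
  memLp := h.memLp.ae_eq hv
  memLp_grad i := (h.memLp_grad i).ae_eq (hG i)
  integral_eq i φ hφ hc hs := by
    have e := h.integral_eq i φ hφ hc hs
    rw [integral_congr_ae (hv.mono fun x hx => by
      show _ = (fderiv ℝ φ x (EuclideanSpace.single i 1)) • w x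
      simp only [hx])] at e
    rw [e, integral_congr_ae ((hG i).mono fun x hx => by
      show _ = φ x • H i x
      simp only [hx])]

theorem IsWeakGrad.mono (h : IsWeakGrad Ω v G) (hsub : Ω' ⊆ Ω) : IsWeakGrad Ω' v G where
  memLp := h.memLp.mono_measure (Measure.restrict_mono hsub le_rfl)
  memLp_grad i := (h.memLp_grad i).mono_measure (Measure.restrict_mono hsub le_rfl)
  integral_eq i φ hφ hc hs := by
    have e := h.integral_eq i φ hφ hc (hs.trans hsub)
    have aux : ∀ {f : Eucl n → Eucl m}, (∀ x, x ∉ tsupport φ → f x = 0) →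
        ∫ x in Ω', f x = ∫ x in Ω, f x := fun {f} hf => by
      rw [setIntegral_eq_integral_of_forall_compl_eq_zero fun x hx => hf x fun hx' => hx (hs hx'),
        setIntegral_eq_integral_of_forall_compl_eq_zero
          fun x hx => hf x fun hx' => hx (hsub (hs hx'))]
    rw [aux, aux, e]
    · intro x hx
      rw [image_eq_zero_of_notMem_tsupport hx, zero_smul]
    · intro x hx
      rw [image_eq_zero_of_notMem_tsupport fun hx' => hx (tsupport_fderiv_subset ℝ hx'),
        zero_apply, zero_smul]

theorem IsWeakGrad.add (h : IsWeakGrad Ω v G) (h' : IsWeakGrad Ω w H) :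
    IsWeakGrad Ω (v + w) (fun i => G i + H i) where
  memLp := h.memLp.add h'.memLp
  memLp_grad i := (h.memLp_grad i).add (h'.memLp_grad i)
  integral_eq i φ hφ hc hs := by
    simp_rw [Pi.add_apply, smul_add]
    rw [integral_add, integral_add, h.integral_eq i φ hφ hc hs, h'.integral_eq i φ hφ hc hs,
      neg_add]
    · exact integrable_smul_of_memLp hφ.continuous hc (h.memLp_grad i)
    · exact integrable_smul_of_memLp hφ.continuous hc (h'.memLp_grad i)
    · exact integrable_smul_of_memLp (continuous_fderiv_apply hφ _) (hc.fderiv_apply ℝ _) h.memLp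
    · exact integrable_smul_of_memLp (continuous_fderiv_apply hφ _) (hc.fderiv_apply ℝ _) h'.memLp

theorem IsWeakGrad.smul (h : IsWeakGrad Ω v G) (c : ℝ) :
    IsWeakGrad Ω (c • v) (fun i => c • G i) where
  memLp := h.memLp.const_smul c
  memLp_grad i := (h.memLp_grad i).const_smul c
  integral_eq i φ hφ hc hs := by
    simp_rw [Pi.smul_apply, smul_comm _ c]
    rw [integral_smul, integral_smul, h.integral_eq i φ hφ hc hs, smul_neg]

theorem IsWeakGrad.sub (h : IsWeakGrad Ω v G) (h' : IsWeakGrad Ω w H) :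
    IsWeakGrad Ω (v - w) (fun i => G i - H i) := by
  have := h.add (h'.smul (-1))
  simpa [sub_eq_add_neg] using this

/-- Test functions and their derivatives lie in L², so both sides of the defining identity are
continuous under L² convergence. -/
theorem IsWeakGrad.of_tendsto {v' : ℕ → Eucl n → Eucl m} {G' : ℕ → Fin n → Eucl n → Eucl m}
    (h : ∀ k, IsWeakGrad Ω (v' k) (G' k)) (hv : MemLp v 2 (volume.restrict Ω))
    (hG : ∀ i, MemLp (G i) 2 (volume.restrict Ω))
    (hv' : Tendsto (fun k => eLpNorm (v' k - v) 2 (volume.restrict Ω)) atTop (𝓝 0))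
    (hG' : ∀ i, Tendsto (fun k => eLpNorm (G' k i - G i) 2 (volume.restrict Ω)) atTop (𝓝 0)) :
    IsWeakGrad Ω v G where
  memLp := hv
  memLp_grad := hG
  integral_eq i φ hφ hc hs := by
    have m1 : MemLp φ 2 (volume.restrict Ω) :=
      (hφ.continuous.memLp_of_hasCompactSupport hc).restrict Ω
    have m2 : MemLp (fun x => fderiv ℝ φ x (EuclideanSpace.single i 1)) 2 (volume.restrict Ω) :=
      ((continuous_fderiv_apply hφ _).memLp_of_hasCompactSupport (hc.fderiv_apply ℝ _)).restrict Ω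
    have t1 := tendsto_integral_smul_of_eLpNorm m2 (fun k => (h k).memLp) hv hv'
    have t2 := tendsto_integral_smul_of_eLpNorm m1 (fun k => (h k).memLp_grad i) (hG i) (hG' i)
    refine tendsto_nhds_unique t1 (t2.neg.congr fun k => ?_)
    exact ((h k).integral_eq i φ hφ hc hs).symm

/-- Mere differentiability is assumed, not C¹: the result is applied to products with cutoffs and to
homogeneous extensions, whose derivatives are only checked pointwise. Integration by parts needs
just the integrability of the three products. -/
theorem isWeakGrad_of_differentiable {q : Eucl n → Eucl m} (hq : Differentiable ℝ q)
    (h0 : MemLp q 2 (volume.restrict Ω)) (h1 : ∀ i, MemLp (pderiv q i) 2 (volume.restrict Ω)) :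
    IsWeakGrad Ω q (pderiv q) where
  memLp := h0
  memLp_grad := h1
  integral_eq i φ hφ hc hs := by
    have aux : ∀ {f : Eucl n → Eucl m}, (∀ x, x ∉ tsupport φ → f x = 0) →
        ∫ x in Ω, f x = ∫ x, f x := fun {f} hf =>
      setIntegral_eq_integral_of_forall_compl_eq_zero fun x hx => hf x fun hx' => hx (hs hx')
    have aux' : ∀ {f : Eucl n → Eucl m}, (∀ x, x ∉ tsupport φ → f x = 0) →
        Integrable f (volume.restrict Ω) → Integrable f volume := fun {f} hf hi => by
      refine (integrableOn_iff_integrable_of_support_subset fun x hx => ?_).1 hi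
      by_contra hxΩ
      exact hx (hf x fun hx' => hxΩ (hs hx'))
    have z1 : ∀ x, x ∉ tsupport φ →
        fderiv ℝ φ x (EuclideanSpace.single i 1) • q x = 0 := fun x hx => by
      rw [image_eq_zero_of_notMem_tsupport fun hx' => hx (tsupport_fderiv_subset ℝ hx'),
        zero_apply, zero_smul]
    have z2 : ∀ {f : Eucl n → Eucl m}, ∀ x, x ∉ tsupport φ → φ x • f x = 0 := fun x hx => by
      rw [image_eq_zero_of_notMem_tsupport hx, zero_smul]
    rw [aux z1, aux z2]
    have := integral_smul_fderiv_eq_neg_fderiv_smul_of_integrable (μ := volume) (f := φ) (g := q)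
      (v := EuclideanSpace.single i 1) ?_ ?_ ?_
      (fun x _ => hφ.differentiable (by simp) x) (fun x _ => hq x)
    · simp only [pderiv]
      rw [this, neg_neg]
    · exact aux' z1
        (integrable_smul_of_memLp (continuous_fderiv_apply hφ _) (hc.fderiv_apply ℝ _) h0)
    · exact aux' z2 (integrable_smul_of_memLp hφ.continuous hc (h1 i))
    · exact aux' z2 (integrable_smul_of_memLp hφ.continuous hc h0)

theorem energy_eq (hΩ : IsOpen Ω) (h : IsWeakGrad Ω v G) :
    energy Ω v = ∫ x in Ω, ((∑ i, ‖G i x‖ ^ 2) + 2 * ‖v x‖) := by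
  refine integral_congr_ae ?_
  have : ∀ᵐ x ∂volume.restrict Ω, ∀ i, weakGrad Ω v i x = G i x :=
    ae_all_iff.2 fun i => h.weakGrad_ae_eq hΩ i
  filter_upwards [this] with x hx
  simp only [hx]

theorem IsWeakGrad.integrable_energy (hb : volume Ω < ⊤) (h : IsWeakGrad Ω v G) :
    Integrable (fun x => (∑ i, ‖G i x‖ ^ 2) + 2 * ‖v x‖) (volume.restrict Ω) := by
  have : IsFiniteMeasure (volume.restrict Ω) := ⟨by simpa using hb⟩
  refine (integrable_finsetSum _ fun i _ => ?_).add ?_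
  · exact (memLp_two_iff_integrable_sq_norm (h.memLp_grad i).1).1 (h.memLp_grad i)
  · exact ((h.memLp.integrable one_le_two).norm).const_mul 2

end WeakGrad

/-! ### Affine changes of variables -/

section Affine

/-- The homeomorphism `y ↦ a + r y`. -/
noncomputable def affineHomeo (a : Eucl n) (r : ℝ) (hr : r ≠ 0) : Eucl n ≃ₜ Eucl n :=
  (Homeomorph.smulOfNeZero r hr).trans (Homeomorph.addLeft a)

variable {a : Eucl n} {r : ℝ} (hr : r ≠ 0)

@[simp] theorem affineHomeo_apply (y : Eucl n) : affineHomeo a r hr y = a + r • y := rfl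

@[simp] theorem affineHomeo_symm_apply (x : Eucl n) :
    (affineHomeo a r hr).symm x = r⁻¹ • (-a + x) := by
  rw [Homeomorph.symm_apply_eq, affineHomeo_apply, smul_inv_smul₀ hr, add_neg_cancel_left]

theorem affineHomeo_symm_eq :
    (affineHomeo a r hr).symm = affineHomeo (-(r⁻¹ • a)) r⁻¹ (inv_ne_zero hr) := by
  ext1 x
  rw [affineHomeo_symm_apply, affineHomeo_apply, smul_add, smul_neg]

theorem contDiff_affineHomeo : ContDiff ℝ ∞ (affineHomeo a r hr) :=
  contDiff_const.add (contDiff_id.const_smul r)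

theorem hasFDerivAt_affineHomeo (y : Eucl n) :
    HasFDerivAt (affineHomeo a r hr) (r • ContinuousLinearMap.id ℝ (Eucl n)) y :=
  ((hasFDerivAt_id y).const_smul r).const_add a

theorem fderiv_comp_affineHomeo {E : Type*} [NormedAddCommGroup E] [NormedSpace ℝ E]
    {φ : Eucl n → E} (hφ : Differentiable ℝ φ) (y e : Eucl n) :
    fderiv ℝ (φ ∘ affineHomeo a r hr) y e = r • fderiv ℝ φ (affineHomeo a r hr y) e := by
  rw [((hφ _).hasFDerivAt.comp y (hasFDerivAt_affineHomeo hr y)).fderiv]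
  simp

theorem pderiv_comp_affineHomeo {φ : Eucl n → Eucl m} (hφ : Differentiable ℝ φ) (i : Fin n) :
    pderiv (φ ∘ affineHomeo a r hr) i = r • (pderiv φ i ∘ affineHomeo a r hr) := by
  ext1 y
  exact fderiv_comp_affineHomeo hr hφ y _

theorem map_affineHomeo_restrict (Ω : Set (Eucl n)) :
    Measure.map (affineHomeo a r hr) (volume.restrict (affineHomeo a r hr ⁻¹' Ω)) =
      ENNReal.ofReal |(r ^ n)⁻¹| • volume.restrict Ω := by
  have h1 : Measure.map (affineHomeo a r hr) volume =
      ENNReal.ofReal |(r ^ n)⁻¹| • (volume : Measure (Eucl n)) := by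
    have e : (affineHomeo a r hr : Eucl n → Eucl n) = (fun x => a + x) ∘ (fun x => r • x) := rfl
    rw [e, ← Measure.map_map (by fun_prop) (by fun_prop), Measure.map_addHaar_smul _ hr,
      Measure.map_smul, map_add_left_eq_self]
    simp
  rw [← (affineHomeo a r hr).measurableEmbedding.restrict_map, h1, Measure.restrict_smul]

theorem affine_factor_ne_zero (hr : r ≠ 0) : ENNReal.ofReal |(r ^ n)⁻¹| ≠ 0 := by
  have : 0 < |(r ^ n)⁻¹| := by positivity
  exact (ENNReal.ofReal_pos.2 this).ne'

theorem setIntegral_comp_affineHomeo {E : Type*} [NormedAddCommGroup E] [NormedSpace ℝ E]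
    (Ω : Set (Eucl n)) (f : Eucl n → E) :
    ∫ y in affineHomeo a r hr ⁻¹' Ω, f (affineHomeo a r hr y) =
      |(r ^ n)⁻¹| • ∫ x in Ω, f x := by
  rw [← (affineHomeo a r hr).measurableEmbedding.integral_map, map_affineHomeo_restrict,
    integral_smul_measure, ENNReal.toReal_ofReal (abs_nonneg _)]

theorem eLpNorm_comp_affineHomeo (Ω : Set (Eucl n)) (f : Eucl n → Eucl m) :
    eLpNorm (f ∘ affineHomeo a r hr) 2 (volume.restrict (affineHomeo a r hr ⁻¹' Ω)) =
      ENNReal.ofReal |(r ^ n)⁻¹| ^ (1 / (2 : ℝ)) * eLpNorm f 2 (volume.restrict Ω) := by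
  rw [← (affineHomeo a r hr).measurableEmbedding.eLpNorm_map_measure, map_affineHomeo_restrict,
    eLpNorm_smul_measure_of_ne_zero (affine_factor_ne_zero hr)]
  simp

theorem memLp_comp_affineHomeo {Ω : Set (Eucl n)} {f : Eucl n → Eucl m}
    (hf : MemLp f 2 (volume.restrict Ω)) :
    MemLp (f ∘ affineHomeo a r hr) 2 (volume.restrict (affineHomeo a r hr ⁻¹' Ω)) := by
  rw [← (affineHomeo a r hr).measurableEmbedding.memLp_map_measure_iff, map_affineHomeo_restrict]
  exact hf.smul_measure ENNReal.ofReal_ne_top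

theorem IsWeakGrad.comp_affineHomeo {Ω : Set (Eucl n)} {v : Eucl n → Eucl m}
    {G : Fin n → Eucl n → Eucl m} (h : IsWeakGrad Ω v G) :
    IsWeakGrad (affineHomeo a r hr ⁻¹' Ω) (v ∘ affineHomeo a r hr)
      (fun i => r • (G i ∘ affineHomeo a r hr)) where
  memLp := memLp_comp_affineHomeo hr h.memLp
  memLp_grad i := (memLp_comp_affineHomeo hr (h.memLp_grad i)).const_smul r
  integral_eq i φ hφ hc hs := by
    set A := affineHomeo a r hr
    -- The identity for `v` is tested with φ ∘ A⁻¹. The chain rule puts a factor r on the derivative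
    -- of φ, which matches the factor r in the transported gradient; the Jacobian is common to both
    -- sides.
    have hψ : ContDiff ℝ ∞ (φ ∘ A.symm) := by
      simp only [A, affineHomeo_symm_eq]
      exact hφ.comp (contDiff_affineHomeo _)
    have hφe : φ = (φ ∘ A.symm) ∘ A := by ext x; simp
    have e := h.integral_eq i (φ ∘ A.symm) hψ (hc.comp_homeomorph A.symm) (by
      rw [tsupport_comp_eq_preimage]
      intro x hx
      simpa using hs hx)
    have e1 := setIntegral_comp_affineHomeo (a := a) hr Ω
      (fun x => r • (fderiv ℝ (φ ∘ A.symm) x (EuclideanSpace.single i 1)) • v x)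
    have e2 := setIntegral_comp_affineHomeo (a := a) hr Ω (fun x => r • (φ ∘ A.symm) x • G i x)
    have e3 : ∫ x in A ⁻¹' Ω, (fderiv ℝ φ x (EuclideanSpace.single i 1)) • (v ∘ A) x =
        ∫ y in A ⁻¹' Ω,
          r • (fderiv ℝ (φ ∘ A.symm) (A y) (EuclideanSpace.single i 1)) • v (A y) := by
      congr 1
      ext1 y
      conv_lhs => rw [hφe]
      rw [fderiv_comp_affineHomeo hr (hψ.differentiable (by simp)), smul_eq_mul, mul_smul]
      rfl
    have e4 : ∫ x in A ⁻¹' Ω, φ x • (r • (G i ∘ A)) x =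
        ∫ y in A ⁻¹' Ω, r • (φ ∘ A.symm) (A y) • G i (A y) := by
      congr 1
      ext1 y
      simp [smul_comm r]
    rw [e3, e4, e1, e2, integral_smul, integral_smul, e, smul_neg, smul_neg]

end Affine

/-! ### The space W₀^{1,2} -/

section W0

variable {Ω Ω' : Set (Eucl n)} {v w : Eucl n → Eucl m} {G H : Fin n → Eucl n → Eucl m}

/-- `w ∈ W₀^{1,2}(Ω; ℝᵐ)` with weak gradient `G`. -/
structure IsWeakGradZero (Ω : Set (Eucl n)) (w : Eucl n → Eucl m)
    (G : Fin n → Eucl n → Eucl m) : Prop extends IsWeakGrad Ω w G where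
  approx : ∀ ε : ℝ≥0∞, ε ≠ 0 → ∃ φ : Eucl n → Eucl m,
    (ContDiff ℝ ∞ φ ∧ HasCompactSupport φ ∧ tsupport φ ⊆ Ω) ∧
    eLpNorm (φ - w) 2 (volume.restrict Ω) ≤ ε ∧
    ∀ i, eLpNorm (pderiv φ i - G i) 2 (volume.restrict Ω) ≤ ε

theorem exists_seq_ennreal : ∃ ε : ℕ → ℝ≥0∞, (∀ k, ε k ≠ 0) ∧ Tendsto ε atTop (𝓝 0) :=
  ⟨fun k => ((k : ℝ≥0∞) )⁻¹, fun k => by simp, ENNReal.tendsto_inv_nat_nhds_zero⟩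

theorem IsWeakGradZero.exists_seq (h : IsWeakGradZero Ω w G) : ∃ φ : ℕ → Eucl n → Eucl m,
    (∀ k, ContDiff ℝ ∞ (φ k) ∧ HasCompactSupport (φ k) ∧ tsupport (φ k) ⊆ Ω) ∧
    Tendsto (fun k => eLpNorm (φ k - w) 2 (volume.restrict Ω)) atTop (𝓝 0) ∧
    ∀ i, Tendsto (fun k => eLpNorm (pderiv (φ k) i - G i) 2 (volume.restrict Ω)) atTop (𝓝 0) := by
  obtain ⟨ε, hε, hlim⟩ := exists_seq_ennreal
  choose φ h1 h2 h3 using fun k => h.approx (ε k) (hε k)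
  exact ⟨φ, h1,
    tendsto_of_tendsto_of_tendsto_of_le_of_le tendsto_const_nhds hlim (fun _ => zero_le) h2,
    fun i => tendsto_of_tendsto_of_tendsto_of_le_of_le tendsto_const_nhds hlim
      (fun _ => zero_le) fun k => h3 k i⟩

theorem MemW12Zero.isWeakGradZero (hΩ : IsOpen Ω) (h : MemW12Zero Ω w) (hG : IsWeakGrad Ω w G) :
    IsWeakGradZero Ω w G where
  toIsWeakGrad := hG
  approx ε hε := by
    obtain ⟨-, φ, h1, h2, h3⟩ := h
    have e2 := h2.eventually (Iic_mem_nhds (pos_iff_ne_zero.2 hε))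
    have e3 := eventually_all.2 fun i => (h3 i).eventually (Iic_mem_nhds (pos_iff_ne_zero.2 hε))
    obtain ⟨k, hk2, hk3⟩ := (e2.and e3).exists
    refine ⟨φ k, h1 k, hk2, fun i => le_trans (le_of_eq ?_) (hk3 i)⟩
    refine eLpNorm_congr_ae ?_
    filter_upwards [hG.weakGrad_ae_eq hΩ i] with x hx
    simp [pderiv, hx]

theorem IsWeakGradZero.memW12Zero (hΩ : IsOpen Ω) (h : IsWeakGradZero Ω w G) :
    MemW12Zero Ω w := by
  obtain ⟨φ, h1, h2, h3⟩ := h.exists_seq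
  refine ⟨⟨G, h.toIsWeakGrad⟩, φ, h1, h2, fun i => (h3 i).congr fun k => ?_⟩
  refine eLpNorm_congr_ae ?_
  filter_upwards [h.toIsWeakGrad.weakGrad_ae_eq hΩ i] with x hx
  simp [pderiv, hx]

theorem isWeakGrad_pderiv {φ : Eucl n → Eucl m} (hφ : ContDiff ℝ ∞ φ) (hc : HasCompactSupport φ) :
    IsWeakGrad Ω φ (pderiv φ) :=
  isWeakGrad_of_differentiable (hφ.differentiable (by simp))
    ((hφ.continuous.memLp_of_hasCompactSupport hc).restrict Ω) fun _ =>
    ((((hφ.continuous_fderiv (by simp)).clm_apply continuous_const).memLp_of_hasCompactSupport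
      (hc.fderiv_apply ℝ _)).restrict Ω)

theorem pderiv_add {φ ψ : Eucl n → Eucl m} (hφ : Differentiable ℝ φ) (hψ : Differentiable ℝ ψ)
    (i : Fin n) : pderiv (φ + ψ) i = pderiv φ i + pderiv ψ i := by
  ext1 x
  simp only [pderiv, fderiv_add (hφ x) (hψ x), Pi.add_apply, add_apply]

theorem pderiv_smul {φ : Eucl n → Eucl m} (hφ : Differentiable ℝ φ) (c : ℝ)
    (i : Fin n) : pderiv (c • φ) i = c • pderiv φ i := by
  ext1 x
  simp only [pderiv, fderiv_const_smul (hφ x), Pi.smul_apply, smul_apply]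

theorem pderiv_sub {φ ψ : Eucl n → Eucl m} (hφ : Differentiable ℝ φ) (hψ : Differentiable ℝ ψ)
    (i : Fin n) : pderiv (φ - ψ) i = pderiv φ i - pderiv ψ i := by
  ext1 x
  simp only [pderiv, fderiv_sub (hφ x) (hψ x), Pi.sub_apply, sub_apply]

/-- `W₀^{1,2}` is closed in `W^{1,2}`. -/
theorem isWeakGradZero_of_forall_approx (h : IsWeakGrad Ω w G)
    (H : ∀ ε : ℝ≥0∞, ε ≠ 0 → ∃ v' G', IsWeakGradZero Ω v' G' ∧
      eLpNorm (v' - w) 2 (volume.restrict Ω) ≤ ε ∧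
      ∀ i, eLpNorm (G' i - G i) 2 (volume.restrict Ω) ≤ ε) : IsWeakGradZero Ω w G where
  toIsWeakGrad := h
  approx ε hε := by
    have h2 : ε / 2 ≠ 0 := by simp [hε]
    obtain ⟨v', G', h', ha, hb⟩ := H (ε / 2) h2
    obtain ⟨φ, ⟨s1, s2, s3⟩, hc, hd⟩ := h'.approx (ε / 2) h2
    have hφ := isWeakGrad_pderiv (Ω := Ω) s1 s2
    refine ⟨φ, ⟨s1, s2, s3⟩, ?_, fun i => ?_⟩
    · rw [← sub_add_sub_cancel φ v' w]
      refine (eLpNorm_add_le (hφ.memLp.sub h'.memLp).1 (h'.memLp.sub h.memLp).1 one_le_two).trans ?_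
      exact (add_le_add hc ha).trans (ENNReal.add_halves ε).le
    · rw [← sub_add_sub_cancel _ (G' i) _]
      refine (eLpNorm_add_le ((hφ.memLp_grad i).sub (h'.memLp_grad i)).1
        ((h'.memLp_grad i).sub (h.memLp_grad i)).1 one_le_two).trans ?_
      exact (add_le_add (hd i) (hb i)).trans (ENNReal.add_halves ε).le

theorem isWeakGradZero_of_tendsto {v' : ℕ → Eucl n → Eucl m} {G' : ℕ → Fin n → Eucl n → Eucl m}
    (h : ∀ k, IsWeakGradZero Ω (v' k) (G' k)) (hw : IsWeakGrad Ω w G)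
    (hv' : Tendsto (fun k => eLpNorm (v' k - w) 2 (volume.restrict Ω)) atTop (𝓝 0))
    (hG' : ∀ i, Tendsto (fun k => eLpNorm (G' k i - G i) 2 (volume.restrict Ω)) atTop (𝓝 0)) :
    IsWeakGradZero Ω w G := by
  refine isWeakGradZero_of_forall_approx hw fun ε hε => ?_
  have e2 := hv'.eventually (Iic_mem_nhds (pos_iff_ne_zero.2 hε))
  have e3 := eventually_all.2 fun i => (hG' i).eventually (Iic_mem_nhds (pos_iff_ne_zero.2 hε))
  obtain ⟨k, hk2, hk3⟩ := (e2.and e3).exists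
  exact ⟨v' k, G' k, h k, hk2, hk3⟩

theorem IsWeakGradZero.add (h : IsWeakGradZero Ω v G) (h' : IsWeakGradZero Ω w H) :
    IsWeakGradZero Ω (v + w) (fun i => G i + H i) where
  toIsWeakGrad := h.toIsWeakGrad.add h'.toIsWeakGrad
  approx ε hε := by
    have h2 : ε / 2 ≠ 0 := by simp [hε]
    obtain ⟨φ, ⟨s1, s2, s3⟩, ha, hb⟩ := h.approx (ε / 2) h2
    obtain ⟨ψ, ⟨t1, t2, t3⟩, hc, hd⟩ := h'.approx (ε / 2) h2
    have hφ := isWeakGrad_pderiv (Ω := Ω) s1 s2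
    have hψ := isWeakGrad_pderiv (Ω := Ω) t1 t2
    refine ⟨φ + ψ, ⟨s1.add t1, s2.add t2,
      (tsupport_add φ ψ).trans (union_subset s3 t3)⟩, ?_, fun i => ?_⟩
    · rw [add_sub_add_comm]
      refine (eLpNorm_add_le (hφ.memLp.sub h.memLp).1 (hψ.memLp.sub h'.memLp).1 one_le_two).trans ?_
      exact (add_le_add ha hc).trans (ENNReal.add_halves ε).le
    · rw [pderiv_add (s1.differentiable (by simp)) (t1.differentiable (by simp)), add_sub_add_comm]
      refine (eLpNorm_add_le ((hφ.memLp_grad i).sub (h.memLp_grad i)).1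
        ((hψ.memLp_grad i).sub (h'.memLp_grad i)).1 one_le_two).trans ?_
      exact (add_le_add (hb i) (hd i)).trans (ENNReal.add_halves ε).le

theorem IsWeakGradZero.smul (h : IsWeakGradZero Ω v G) (c : ℝ) :
    IsWeakGradZero Ω (c • v) (fun i => c • G i) := by
  obtain ⟨φ, h1, h2, h3⟩ := h.exists_seq
  refine isWeakGradZero_of_tendsto (v' := fun k => c • φ k) (G' := fun k => pderiv (c • φ k))
    (fun k => ⟨isWeakGrad_pderiv ((h1 k).1.const_smul c) (h1 k).2.1.smul_left, fun ε hε =>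
      ⟨c • φ k, ⟨(h1 k).1.const_smul c, (h1 k).2.1.smul_left,
        (tsupport_smul_subset_right (fun _ => c) _).trans (h1 k).2.2⟩, by simp, by simp⟩⟩)
    (h.toIsWeakGrad.smul c) ?_ fun i => ?_
  · simp_rw [← smul_sub, eLpNorm_const_smul]
    simpa using ENNReal.Tendsto.const_mul h2 (Or.inr (by simp))
  · simp_rw [fun k => pderiv_smul ((h1 k).1.differentiable (by simp)) c i, ← smul_sub,
      eLpNorm_const_smul]
    simpa using ENNReal.Tendsto.const_mul (h3 i) (Or.inr (by simp))

theorem IsWeakGradZero.sub (h : IsWeakGradZero Ω v G) (h' : IsWeakGradZero Ω w H) :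
    IsWeakGradZero Ω (v - w) (fun i => G i - H i) := by
  have := h.add (h'.smul (-1))
  simpa [sub_eq_add_neg] using this

/-- Extension by zero: the approximating test functions and their gradients already vanish outside
Ω, so the norms on Ω' are the norms on Ω. This glues competitors on a ball into a function on the
whole domain. -/
theorem IsWeakGradZero.indicator (h : IsWeakGradZero Ω w G) (hm : MeasurableSet Ω)
    (hsub : Ω ⊆ Ω') :
    IsWeakGradZero Ω' (Ω.indicator w) (fun i => Ω.indicator (G i)) := by
  have key : ∀ {f g : Eucl n → Eucl m}, (∀ x ∉ Ω, f x = 0) →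
      eLpNorm (f - Ω.indicator g) 2 (volume.restrict Ω') =
        eLpNorm (f - g) 2 (volume.restrict Ω) := fun {f g} hf => by
    have : f - Ω.indicator g = Ω.indicator (f - g) := by
      ext1 x
      by_cases hx : x ∈ Ω
      · simp [hx]
      · simp [hx, hf x hx]
    rw [this, eLpNorm_indicator_eq_eLpNorm_restrict hm, Measure.restrict_restrict hm,
      inter_eq_left.2 hsub]
  have mem : ∀ {g : Eucl n → Eucl m}, MemLp g 2 (volume.restrict Ω) →
      MemLp (Ω.indicator g) 2 (volume.restrict Ω') := fun {g} hg => by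
    rw [memLp_indicator_iff_restrict hm, Measure.restrict_restrict hm, inter_eq_left.2 hsub]
    exact hg
  obtain ⟨φ, h1, h2, h3⟩ := h.exists_seq
  have z1 : ∀ k, ∀ x ∉ Ω, φ k x = 0 := fun k x hx =>
    image_eq_zero_of_notMem_tsupport fun hx' => hx ((h1 k).2.2 hx')
  have z2 : ∀ k i, ∀ x ∉ Ω, pderiv (φ k) i x = 0 := fun k i x hx => by
    rw [pderiv, image_eq_zero_of_notMem_tsupport
      fun hx' => hx ((h1 k).2.2 (tsupport_fderiv_subset ℝ hx')), zero_apply]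
  have l2 : Tendsto (fun k => eLpNorm (φ k - Ω.indicator w) 2 (volume.restrict Ω')) atTop (𝓝 0) :=
    h2.congr fun k => (key (z1 k)).symm
  have l3 : ∀ i, Tendsto (fun k => eLpNorm (pderiv (φ k) i - Ω.indicator (G i)) 2
      (volume.restrict Ω')) atTop (𝓝 0) :=
    fun i => (h3 i).congr fun k => (key (z2 k i)).symm
  refine isWeakGradZero_of_tendsto (v' := φ) (G' := fun k => pderiv (φ k)) (fun k =>
    ⟨isWeakGrad_pderiv (h1 k).1 (h1 k).2.1, fun ε hε =>
      ⟨φ k, ⟨(h1 k).1, (h1 k).2.1, (h1 k).2.2.trans hsub⟩, by simp, by simp⟩⟩) ?_ l2 l3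
  exact IsWeakGrad.of_tendsto (fun k => isWeakGrad_pderiv (h1 k).1 (h1 k).2.1)
    (mem h.memLp) (fun i => mem (h.memLp_grad i)) l2 l3

theorem IsWeakGradZero.comp_affineHomeo {a : Eucl n} {r : ℝ} (hr : r ≠ 0)
    (h : IsWeakGradZero Ω v G) :
    IsWeakGradZero (affineHomeo a r hr ⁻¹' Ω) (v ∘ affineHomeo a r hr)
      (fun i => r • (G i ∘ affineHomeo a r hr)) := by
  set A := affineHomeo a r hr
  obtain ⟨φ, h1, h2, h3⟩ := h.exists_seq
  have s : ∀ k, ContDiff ℝ ∞ (φ k ∘ A) ∧ HasCompactSupport (φ k ∘ A) ∧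
      tsupport (φ k ∘ A) ⊆ A ⁻¹' Ω := fun k =>
    ⟨(h1 k).1.comp (contDiff_affineHomeo hr), (h1 k).2.1.comp_homeomorph A, by
      rw [tsupport_comp_eq_preimage]
      exact preimage_mono (h1 k).2.2⟩
  have hc : ENNReal.ofReal |(r ^ n)⁻¹| ^ (1 / (2 : ℝ)) ≠ ⊤ :=
    ENNReal.rpow_ne_top_of_nonneg (by norm_num) ENNReal.ofReal_ne_top
  refine isWeakGradZero_of_tendsto (v' := fun k => φ k ∘ A) (G' := fun k => pderiv (φ k ∘ A))
    (fun k => ⟨isWeakGrad_pderiv (s k).1 (s k).2.1, fun ε hε =>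
      ⟨φ k ∘ A, s k, by simp, by simp⟩⟩)
    (h.toIsWeakGrad.comp_affineHomeo hr) ?_ fun i => ?_
  · have : ∀ k, φ k ∘ A - v ∘ A = (φ k - v) ∘ A := fun k => rfl
    simp_rw [this, A, eLpNorm_comp_affineHomeo]
    simpa using ENNReal.Tendsto.const_mul h2 (Or.inr hc)
  · have : ∀ k, pderiv (φ k ∘ A) i - r • (G i ∘ A) = r • ((pderiv (φ k) i - G i) ∘ A) := fun k => by
      rw [pderiv_comp_affineHomeo hr ((h1 k).1.differentiable (by simp)), ← smul_sub]
      rfl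
    simp_rw [this, eLpNorm_const_smul, A, eLpNorm_comp_affineHomeo]
    have := ENNReal.Tendsto.const_mul (ENNReal.Tendsto.const_mul (h3 i) (Or.inr hc))
      (Or.inr (enorm_ne_top (x := r)))
    simpa using this

end W0

/-! ### Mollification and smooth approximation -/

section Mollification

/-- A smooth bump function supported in `closedBall 0 δ`. -/
noncomputable def bump (δ : ℝ) (hδ : 0 < δ) : ContDiffBump (0 : Eucl n) :=
  ⟨δ / 2, δ, half_pos hδ, half_lt_self hδ⟩

/-- The mollification of `v` at scale `δ`. -/
noncomputable def mollify (δ : ℝ) (hδ : 0 < δ) (v : Eucl n → Eucl m) : Eucl n → Eucl m :=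
  convolution ((bump δ hδ).normed volume) v (ContinuousLinearMap.lsmul ℝ ℝ) volume

variable {δ : ℝ} {hδ : 0 < δ} {v w : Eucl n → Eucl m}

theorem mollify_apply (x : Eucl n) :
    mollify δ hδ v x = ∫ t, (bump δ hδ).normed volume t • v (x - t) := rfl

theorem locallyIntegrable_of_memLp_two (hv : MemLp v 2 volume) : LocallyIntegrable v volume :=
  hv.locallyIntegrable one_le_two

theorem contDiff_mollify (hv : LocallyIntegrable v volume) : ContDiff ℝ ∞ (mollify δ hδ v) :=
  HasCompactSupport.contDiff_convolution_left _ (ContDiffBump.hasCompactSupport_normed _)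
    (ContDiffBump.contDiff_normed _) hv

theorem integrable_mollify (hv : LocallyIntegrable v volume) (x : Eucl n) :
    Integrable (fun t => (bump δ hδ).normed volume t • v (x - t)) volume :=
  (ContDiffBump.hasCompactSupport_normed _).convolutionExists_left (ContinuousLinearMap.lsmul ℝ ℝ)
    (ContDiffBump.continuous_normed _) hv x

theorem mollify_sub (hv : LocallyIntegrable v volume) (hw : LocallyIntegrable w volume) :
    mollify δ hδ (v - w) = mollify δ hδ v - mollify δ hδ w := by
  ext1 x
  simp_rw [Pi.sub_apply, mollify_apply, Pi.sub_apply, smul_sub]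
  exact integral_sub (integrable_mollify hv x) (integrable_mollify hw x)

theorem norm_mollify_sub_le (hv : AEStronglyMeasurable v volume) {x : Eucl n} {ε : ℝ}
    (h : ∀ y, dist y x < δ → dist (v y) (v x) ≤ ε) : ‖mollify δ hδ v x - v x‖ ≤ ε := by
  rw [← dist_eq_norm]
  exact ContDiffBump.dist_normed_convolution_le hv fun y hy => h y hy

theorem tsupport_mollify_subset {K : Set (Eucl n)} (hv : tsupport v ⊆ K) :
    tsupport (mollify δ hδ v) ⊆ cthickening δ K := by
  refine closure_minimal (fun x hx => ?_) isClosed_cthickening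
  have := support_convolution_subset (L := ContinuousLinearMap.lsmul ℝ ℝ) (μ := volume) hx
  obtain ⟨a, ha, b, hb, rfl⟩ := Set.mem_add.1 this
  have ha' : ‖a‖ < δ := by
    have := (bump (n := n) δ hδ).support_normed_eq (μ := volume) ▸ ha
    simpa [bump] using this
  have hbK : b ∈ K := hv (subset_tsupport _ hb)
  refine mem_cthickening_of_dist_le (a + b) b δ K hbK ?_
  simpa using ha'.le

/-- Mollifying averages translates against a probability measure. Pointwise, the L¹ norm is at most
the L² norm for that measure; Tonelli and translation invariance do the rest. -/
theorem eLpNorm_mollify_le (hv : StronglyMeasurable v) :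
    eLpNorm (mollify δ hδ v) 2 volume ≤ eLpNorm v 2 volume := by
  set η : Eucl n → ℝ := (bump δ hδ).normed volume
  have hη : Measurable η := (ContDiffBump.continuous_normed _).measurable
  set P : Measure (Eucl n) := volume.withDensity fun t => ENNReal.ofReal (η t)
  have hP : IsProbabilityMeasure P := by
    refine ⟨?_⟩
    rw [withDensity_apply _ MeasurableSet.univ, Measure.restrict_univ,
      ← ofReal_integral_eq_lintegral_ofReal (ContDiffBump.integrable_normed _)
        (Eventually.of_forall (ContDiffBump.nonneg_normed _)), ContDiffBump.integral_normed,
      ENNReal.ofReal_one]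
  have e : ∀ x, mollify δ hδ v x = ∫ t, v (x - t) ∂P := fun x => by
    rw [mollify_apply, integral_withDensity_eq_integral_toReal_smul (by fun_prop) (by simp)]
    refine integral_congr_ae (Eventually.of_forall fun t => ?_)
    simp only
    rw [ENNReal.toReal_ofReal (ContDiffBump.nonneg_normed _ _)]
  have hmeas : Measurable fun p : Eucl n × Eucl n => ‖v (p.1 - p.2)‖ₑ ^ 2 :=
    ((hv.measurable.comp (measurable_fst.sub measurable_snd)).enorm).pow_const 2
  have key : ∀ x, ‖mollify δ hδ v x‖ₑ ^ 2 ≤ ∫⁻ t, ‖v (x - t)‖ₑ ^ 2 ∂P := fun x => by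
    have h1 : ‖mollify δ hδ v x‖ₑ ≤ eLpNorm (fun t => v (x - t)) 1 P := by
      rw [e, eLpNorm_one_eq_lintegral_enorm]
      exact enorm_integral_le_lintegral_enorm _
    have h2 : eLpNorm (fun t => v (x - t)) 1 P ≤ eLpNorm (fun t => v (x - t)) 2 P :=
      eLpNorm_le_eLpNorm_of_exponent_le one_le_two
        (hv.comp_measurable (measurable_const.sub measurable_id)).aestronglyMeasurable
    refine (pow_le_pow_left₀ zero_le (h1.trans h2) 2).trans (le_of_eq ?_)
    have := eLpNorm_nnreal_pow_eq_lintegral (μ := P) (f := fun t => v (x - t)) (p := 2) (by simp)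
    simpa using this
  have h2 : eLpNorm (mollify δ hδ v) 2 volume ^ 2 ≤ eLpNorm v 2 volume ^ 2 := by
    have e1 := eLpNorm_nnreal_pow_eq_lintegral (μ := volume) (f := mollify δ hδ v) (p := 2)
      (by simp)
    have e2 := eLpNorm_nnreal_pow_eq_lintegral (μ := volume) (f := v) (p := 2) (by simp)
    simp only [ENNReal.coe_ofNat, NNReal.coe_ofNat, ENNReal.rpow_ofNat] at e1 e2
    rw [e1, e2]
    calc ∫⁻ x, ‖mollify δ hδ v x‖ₑ ^ 2 ≤ ∫⁻ x, ∫⁻ t, ‖v (x - t)‖ₑ ^ 2 ∂P := lintegral_mono key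
      _ = ∫⁻ t, (∫⁻ x, ‖v (x - t)‖ₑ ^ 2) ∂P := lintegral_lintegral_swap hmeas.aemeasurable
      _ = ∫⁻ _, (∫⁻ x, ‖v x‖ₑ ^ 2) ∂P := by
        congr 1
        ext1 t
        exact lintegral_sub_right_eq_self (fun x => ‖v x‖ₑ ^ 2) t
      _ = ∫⁻ x, ‖v x‖ₑ ^ 2 := by simp
  exact (ENNReal.pow_le_pow_left_iff two_ne_zero).1 h2

/-- An ε/3 argument: a continuous compactly supported g close to v, contractivity for the
mollification of v − g, and uniform continuity of g. The bound holds for all small δ, so that one δ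
can serve a function and all its derivatives simultaneously. -/
theorem exists_eLpNorm_mollify_sub_le (hv : StronglyMeasurable v) (hv2 : MemLp v 2 volume)
    {ε : ℝ≥0∞} (hε : ε ≠ 0) : ∃ δ₀ > 0, ∀ δ (hδ : 0 < δ), δ < δ₀ →
      eLpNorm (mollify δ hδ v - v) 2 volume ≤ ε := by
  have h3 : ε / 3 ≠ 0 := by simp [hε]
  obtain ⟨g, hgc, hg1, hg2, hg3⟩ :=
    hv2.exists_hasCompactSupport_eLpNorm_sub_le ENNReal.ofNat_ne_top h3
  set K := cthickening 1 (tsupport g)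
  have hK : IsCompact K := hgc.cthickening
  obtain ⟨c, hc0, hc⟩ : ∃ c : ℝ, 0 < c ∧
      volume K ^ (1 / (2 : ℝ)) * ENNReal.ofReal c ≤ ε / 3 := by
    have hKt : volume K ^ (1 / (2 : ℝ)) ≠ ⊤ :=
      ENNReal.rpow_ne_top_of_nonneg (by norm_num) hK.measure_lt_top.ne
    have : Tendsto (fun c : ℝ => volume K ^ (1 / (2 : ℝ)) * ENNReal.ofReal c) (𝓝[>] 0) (𝓝 0) := by
      have := ENNReal.Tendsto.const_mul (ENNReal.tendsto_ofReal (tendsto_id.mono_left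
        (nhdsWithin_le_nhds (a := (0 : ℝ)) (s := Ioi 0)))) (Or.inr hKt)
      simpa using this
    obtain ⟨c, h1, h2⟩ := ((this.eventually (Iic_mem_nhds (pos_iff_ne_zero.2 h3))).and
      self_mem_nhdsWithin).exists
    exact ⟨c, h2, h1⟩
  obtain ⟨δ₁, hδ₁, hu⟩ := Metric.uniformContinuous_iff.1
    (hg2.uniformContinuous_of_tendsto_cocompact (x := 0) hgc.is_zero_at_infty) c hc0
  refine ⟨min δ₁ 1, lt_min hδ₁ one_pos, fun δ hδ hlt => ?_⟩
  have hvl := locallyIntegrable_of_memLp_two hv2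
  have hgl := locallyIntegrable_of_memLp_two hg3
  have a1 : eLpNorm (mollify δ hδ (v - g)) 2 volume ≤ ε / 3 :=
    (eLpNorm_mollify_le (hv.sub hg2.stronglyMeasurable)).trans hg1
  have a2 : eLpNorm (mollify δ hδ g - g) 2 volume ≤ ε / 3 := by
    have hsupp : Function.support (mollify δ hδ g - g) ⊆ K := by
      refine (Function.support_sub _ _).trans (union_subset ?_ ?_)
      · refine (subset_tsupport _).trans ((tsupport_mollify_subset subset_rfl).trans ?_)
        exact cthickening_mono (hlt.le.trans (min_le_right _ _)) _
      · exact (subset_tsupport _).trans (self_subset_cthickening _)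
    rw [← eLpNorm_restrict_eq_of_support_subset hsupp]
    refine (eLpNorm_le_of_ae_bound (C := c) (Eventually.of_forall fun x => ?_)).trans ?_
    · exact norm_mollify_sub_le hg2.aestronglyMeasurable fun y hy =>
        (hu (hy.trans (hlt.trans_le (min_le_left _ _)))).le
    · simpa using hc
  have a3 : eLpNorm (g - v) 2 volume ≤ ε / 3 := by rwa [eLpNorm_sub_comm]
  have e : mollify δ hδ v - v = mollify δ hδ (v - g) + ((mollify δ hδ g - g) + (g - v)) := by
    rw [mollify_sub hvl hgl]
    abel
  have m1 : AEStronglyMeasurable (mollify δ hδ g) volume :=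
    (contDiff_mollify hgl).continuous.aestronglyMeasurable
  have m2 : AEStronglyMeasurable (mollify δ hδ (v - g)) volume :=
    (contDiff_mollify (hvl.sub hgl)).continuous.aestronglyMeasurable
  rw [e]
  calc _ ≤ _ := eLpNorm_add_le m2 ((m1.sub hg3.1).add (hg3.1.sub hv2.1)) one_le_two
    _ ≤ ε / 3 + (ε / 3 + ε / 3) := add_le_add a1
      ((eLpNorm_add_le (m1.sub hg3.1) (hg3.1.sub hv2.1) one_le_two).trans (add_le_add a2 a3))
    _ = ε := by rw [← add_assoc, ENNReal.add_thirds]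

/-- The derivative falls on the kernel η, and y ↦ η(x − y) is an admissible test function because
its support lies in the closed δ-ball around x. The sign from the reflection cancels the sign in the
weak derivative. -/
theorem pderiv_mollify {Ω : Set (Eucl n)} {G : Fin n → Eucl n → Eucl m}
    (h : IsWeakGrad Ω v G) (hv : LocallyIntegrable v volume) {x : Eucl n}
    (hx : closedBall x δ ⊆ Ω) (i : Fin n) :
    pderiv (mollify δ hδ v) i x = mollify δ hδ (G i) x := by
  set η : Eucl n → ℝ := (bump δ hδ).normed volume with hη
  have hηs : ContDiff ℝ ∞ η := ContDiffBump.contDiff_normed _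
  have hηc : HasCompactSupport η := ContDiffBump.hasCompactSupport_normed _
  have hηt : tsupport η = closedBall 0 δ := ContDiffBump.tsupport_normed_eq _
  set ψ : Eucl n → ℝ := fun y => η (x - y) with hψ
  have hψt : tsupport ψ ⊆ closedBall x δ := by
    have : tsupport ψ = (Homeomorph.subLeft x) ⁻¹' tsupport η :=
      tsupport_comp_eq_preimage η (Homeomorph.subLeft x)
    rw [this, hηt]
    intro y hy
    simpa [dist_eq_norm, norm_sub_rev] using hy
  have hψs : ContDiff ℝ ∞ ψ := hηs.comp (contDiff_const.sub contDiff_id)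
  have hψc : HasCompactSupport ψ := hηc.comp_homeomorph (Homeomorph.subLeft x)
  have hψd : ∀ y e, fderiv ℝ ψ y e = -fderiv ℝ η (x - y) e := fun y e => by
    have h1 : HasFDerivAt (fun y => x - y) (-ContinuousLinearMap.id ℝ (Eucl n)) y :=
      (hasFDerivAt_id y).const_sub x
    have h2 := ((hηs.differentiable (by simp) (x - y)).hasFDerivAt.comp y h1).fderiv
    change fderiv ℝ ψ y = _ at h2
    rw [h2]
    simp
  have h0 : ∀ {f : Eucl n → Eucl m}, (∀ y ∉ tsupport ψ, f y = 0) →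
      ∫ y in Ω, f y = ∫ y, f y := fun hf =>
    setIntegral_eq_integral_of_forall_compl_eq_zero fun y hy =>
      hf y fun hy' => hy (hx (hψt hy'))
  have key := h.integral_eq i ψ hψs hψc (hψt.trans hx)
  rw [h0 (fun y hy => by
      rw [image_eq_zero_of_notMem_tsupport fun hy' => hy (tsupport_fderiv_subset ℝ hy'),
        zero_apply, zero_smul]),
    h0 (fun y hy => by rw [image_eq_zero_of_notMem_tsupport hy, zero_smul])] at key
  have e1 : mollify δ hδ (G i) x = ∫ y, ψ y • G i y := by
    rw [mollify_apply, ← integral_sub_left_eq_self (fun t => η t • G i (x - t)) volume x]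
    simp [hψ]
  have hd := (HasCompactSupport.hasFDerivAt_convolution_left (L := ContinuousLinearMap.lsmul ℝ ℝ)
    (μ := volume) hηc (hηs.of_le (by simp)) hv x).fderiv
  have e2 : pderiv (mollify δ hδ v) i x =
      ∫ t, fderiv ℝ η t (EuclideanSpace.single i 1) • v (x - t) := by
    have hce : ConvolutionExistsAt (fderiv ℝ η) v x
        ((ContinuousLinearMap.lsmul ℝ ℝ).precompL (Eucl n)) volume :=
      (hηc.fderiv ℝ).convolutionExists_left _ (hηs.continuous_fderiv (by simp)) hv x
    simp only [pderiv]
    change fderiv ℝ (convolution η v (ContinuousLinearMap.lsmul ℝ ℝ) volume) x _ = _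
    rw [hd]
    simp only [convolution]
    rw [ContinuousLinearMap.integral_apply hce]
    rfl
  rw [e1, e2, ← integral_sub_left_eq_self
    (fun t => fderiv ℝ η t (EuclideanSpace.single i 1) • v (x - t)) volume x]
  simp only [sub_sub_cancel]
  rw [← neg_neg (∫ y, ψ y • G i y), ← key, ← integral_neg]
  simp_rw [hψd, neg_smul, neg_neg]

/-- A differentiable `W^{1,2}` function with compact support in `Ω` is in `W₀^{1,2}(Ω)`. -/
theorem isWeakGradZero_of_hasCompactSupport {Ω : Set (Eucl n)} (hΩ : IsOpen Ω)
    {q : Eucl n → Eucl m} (hq : Differentiable ℝ q) (hc : HasCompactSupport q)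
    (hs : tsupport q ⊆ Ω) (h0 : MemLp q 2 volume) (h1 : ∀ i, MemLp (pderiv q i) 2 volume) :
    IsWeakGradZero Ω q (pderiv q) where
  toIsWeakGrad := isWeakGrad_of_differentiable hq (h0.restrict Ω) fun i => (h1 i).restrict Ω
  approx ε hε := by
    have hw : IsWeakGrad univ q (pderiv q) :=
      isWeakGrad_of_differentiable hq (h0.restrict _) fun i => (h1 i).restrict _
    obtain ⟨δ₀, hδ₀, H0⟩ := exists_eLpNorm_mollify_sub_le hq.continuous.stronglyMeasurable h0 hε
    have hm : ∀ i, StronglyMeasurable (pderiv q i) := fun i =>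
      (measurable_fderiv_apply_const ℝ q _).stronglyMeasurable
    choose δ₁ hδ₁ H1 using fun i => exists_eLpNorm_mollify_sub_le (hm i) (h1 i) hε
    obtain ⟨δ₂, hδ₂, H2⟩ := hc.isCompact.exists_cthickening_subset_open hΩ hs
    -- A single δ has to be small for the function, for each partial derivative and for the support.
    have ev : ∀ᶠ δ in 𝓝[>] (0 : ℝ), 0 < δ ∧ δ < δ₀ ∧ (∀ i, δ < δ₁ i) ∧ δ < δ₂ := by
      refine eventually_and.2 ⟨self_mem_nhdsWithin, nhdsWithin_le_nhds ?_⟩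
      exact (eventually_lt_nhds hδ₀).and
        ((eventually_all.2 fun i => eventually_lt_nhds (hδ₁ i)).and (eventually_lt_nhds hδ₂))
    obtain ⟨δ, hδ, hd0, hd1, hd2⟩ := ev.exists
    have hl := locallyIntegrable_of_memLp_two h0
    have hsub := (tsupport_mollify_subset (hδ := hδ) (v := q) subset_rfl)
    refine ⟨mollify δ hδ q, ⟨contDiff_mollify hl, ?_, ?_⟩, ?_, fun i => ?_⟩
    · exact HasCompactSupport.of_support_subset_isCompact hc.isCompact.cthickening
        ((subset_tsupport _).trans hsub)
    · exact hsub.trans ((cthickening_mono hd2.le _).trans H2)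
    · exact (eLpNorm_mono_measure _ Measure.restrict_le_self).trans (H0 δ hδ hd0)
    · have : pderiv (mollify δ hδ q) i = mollify δ hδ (pderiv q i) := by
        ext1 x
        exact pderiv_mollify hw hl (subset_univ _) i
      rw [this]
      exact (eLpNorm_mono_measure _ Measure.restrict_le_self).trans (H1 i δ hδ (hd1 i))

/-- The approximants mollify the extension of u by zero. For δ below the distance at which the
thickening of K leaves D, the jump across ∂D is not seen from K: values converge uniformly by
continuity near K, and gradients are mollifications of G. -/
theorem exists_smooth_approx {D K : Set (Eucl n)} {u : Eucl n → Eucl m}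
    {G : Fin n → Eucl n → Eucl m} (hD : IsOpen D) (hw : IsWeakGrad D u G) (hu : ContinuousOn u D)
    (hK : IsCompact K) (hKD : K ⊆ D) : ∃ U : ℕ → Eucl n → Eucl m, (∀ k, ContDiff ℝ ∞ (U k)) ∧
      TendstoUniformlyOn U u atTop K ∧
      ∀ i, Tendsto (fun k => eLpNorm (pderiv (U k) i - G i) 2 (volume.restrict K)) atTop (𝓝 0) := by
  classical
  set v := D.indicator u with hv
  have hvm : StronglyMeasurable v :=
    (hv ▸ piecewise_eq_indicator (f := u) (s := D) ▸ (hu.measurable_piecewise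
      continuousOn_const hD.measurableSet)).stronglyMeasurable
  have hv2 : MemLp v 2 volume := (memLp_indicator_iff_restrict hD.measurableSet).2 hw.memLp
  choose g hgm hgae using fun i => (hw.memLp_grad i).1
  set G' : Fin n → Eucl n → Eucl m := fun i => D.indicator (g i)
  have hG'm : ∀ i, StronglyMeasurable (G' i) := fun i => (hgm i).indicator hD.measurableSet
  have hG'ae : ∀ i, G i =ᵐ[volume.restrict D] G' i := fun i =>
    (hgae i).trans (indicator_ae_eq_restrict hD.measurableSet).symm
  have hG'2 : ∀ i, MemLp (G' i) 2 volume := fun i =>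
    (memLp_indicator_iff_restrict hD.measurableSet).2 ((hw.memLp_grad i).ae_eq (hgae i))
  have hw' : IsWeakGrad D v G' :=
    hw.congr (indicator_ae_eq_restrict hD.measurableSet).symm hG'ae
  have hl := locallyIntegrable_of_memLp_two hv2
  obtain ⟨δ₂, hδ₂, H2⟩ := hK.exists_cthickening_subset_open hD hKD
  have step : ∀ k : ℕ, ∃ U : Eucl n → Eucl m, ContDiff ℝ ∞ U ∧
      (∀ x ∈ K, dist (u x) (U x) ≤ 1 / ((k : ℝ) + 1)) ∧
      ∀ i, eLpNorm (pderiv U i - G i) 2 (volume.restrict K) ≤ ENNReal.ofReal (1 / ((k : ℝ) + 1)) := by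
    intro k
    set ε : ℝ := 1 / ((k : ℝ) + 1)
    have hε : 0 < ε := by positivity
    have hε' : ENNReal.ofReal ε ≠ 0 := (ENNReal.ofReal_pos.2 hε).ne'
    choose δ₁ hδ₁ H1 using fun i => exists_eLpNorm_mollify_sub_le (hG'm i) (hG'2 i) hε'
    have hvD : ∀ x ∈ K, ContinuousAt v x := fun x hx =>
      (hu.continuousAt (hD.mem_nhds (hKD hx))).congr
        ((hD.eventually_mem (hKD hx)).mono fun y hy => (indicator_of_mem hy u).symm)
    have huc := hK.uniformContinuousAt_of_continuousAt v hvD (Metric.dist_mem_uniformity hε)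
    obtain ⟨δ₀, hδ₀, H0⟩ := Metric.mem_uniformity_dist.1 huc
    have ev : ∀ᶠ δ in 𝓝[>] (0 : ℝ), 0 < δ ∧ δ < δ₀ ∧ (∀ i, δ < δ₁ i) ∧ δ < δ₂ := by
      refine eventually_and.2 ⟨self_mem_nhdsWithin, nhdsWithin_le_nhds ?_⟩
      exact (eventually_lt_nhds hδ₀).and
        ((eventually_all.2 fun i => eventually_lt_nhds (hδ₁ i)).and (eventually_lt_nhds hδ₂))
    obtain ⟨δ, hδ, hd0, hd1, hd2⟩ := ev.exists
    refine ⟨mollify δ hδ v, contDiff_mollify hl, fun x hx => ?_, fun i => ?_⟩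
    · have : u x = v x := (indicator_of_mem (hKD hx) u).symm
      rw [this, dist_comm, dist_eq_norm]
      refine norm_mollify_sub_le hvm.aestronglyMeasurable fun y hy => ?_
      have := H0 (a := x) (b := y) (by rw [dist_comm]; exact hy.trans hd0) hx
      rw [dist_comm]
      exact le_of_lt this
    · have e : eLpNorm (pderiv (mollify δ hδ v) i - G i) 2 (volume.restrict K) =
          eLpNorm (mollify δ hδ (G' i) - G' i) 2 (volume.restrict K) := by
        refine eLpNorm_congr_ae ?_
        filter_upwards [ae_restrict_of_ae_restrict_of_subset hKD (hG'ae i),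
          ae_restrict_mem hK.measurableSet] with x hx hxK
        have : closedBall x δ ⊆ D :=
          (closedBall_subset_cthickening hxK δ).trans ((cthickening_mono hd2.le _).trans H2)
        simp only [Pi.sub_apply, hx, pderiv_mollify hw' hl this i]
      rw [e]
      exact (eLpNorm_mono_measure _ Measure.restrict_le_self).trans (H1 i δ hδ (hd1 i))
  choose U h1 h2 h3 using step
  refine ⟨U, h1, ?_, fun i => ?_⟩
  · rw [Metric.tendstoUniformlyOn_iff]
    intro ε hε
    filter_upwards [tendsto_one_div_add_atTop_nhds_zero_nat.eventually (Iio_mem_nhds hε)]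
      with k hk x hx
    exact (h2 k x hx).trans_lt hk
  · refine tendsto_of_tendsto_of_tendsto_of_le_of_le tendsto_const_nhds ?_ (fun _ => zero_le)
      (fun k => h3 k i)
    simpa using ENNReal.tendsto_ofReal (tendsto_one_div_add_atTop_nhds_zero_nat (𝕜 := ℝ))

end Mollification

/-! ### Polar coordinates and integrals over shells -/

section Polar

/-- The surface measure of the unit sphere. -/
noncomputable abbrev sphereMeasure (n : ℕ) : Measure (sphere (0 : Eucl n) 1) :=
  (volume : Measure (Eucl n)).toSphere

/-- The measure `t^{n-1} dt` on `(a, b)`. -/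
noncomputable def radialMeasure (n : ℕ) (a b : ℝ) : Measure ℝ :=
  (volume.restrict (Ioo a b)).withDensity fun t => ENNReal.ofReal (t ^ (n - 1))

instance (n : ℕ) (a b : ℝ) : SFinite (radialMeasure n a b) := by
  unfold radialMeasure
  infer_instance

/-- The open shell `{a < |x - x₀| < b}`. -/
def shell (x₀ : Eucl n) (a b : ℝ) : Set (Eucl n) := {x | a < dist x x₀ ∧ dist x x₀ < b}

/-- Polar coordinates `(t, θ) ↦ x₀ + t θ`. -/
def polarMap (x₀ : Eucl n) : ℝ × sphere (0 : Eucl n) 1 → Eucl n :=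
  fun p => x₀ + p.1 • (p.2 : Eucl n)

theorem continuous_polarMap (x₀ : Eucl n) : Continuous (polarMap x₀) := by
  unfold polarMap
  fun_prop

theorem dist_polarMap (x₀ : Eucl n) {t : ℝ} (ht : 0 ≤ t) (θ : sphere (0 : Eucl n) 1) :
    dist (x₀ + t • (θ : Eucl n)) x₀ = t := by
  simp [dist_eq_norm, norm_smul, abs_of_nonneg ht]

theorem isOpen_shell (x₀ : Eucl n) (a b : ℝ) : IsOpen (shell x₀ a b) :=
  (isOpen_lt continuous_const (continuous_id.dist continuous_const)).inter
    (isOpen_lt (continuous_id.dist continuous_const) continuous_const)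

theorem shell_zero_ae_eq (hn : 1 ≤ n) (x₀ : Eucl n) (b : ℝ) :
    shell x₀ 0 b =ᵐ[volume] ball x₀ b := by
  have : Nonempty (Fin n) := ⟨⟨0, hn⟩⟩
  have h : ∀ᵐ x ∂(volume : Measure (Eucl n)), x ≠ x₀ := by
    rw [ae_iff]
    simp
  filter_upwards [h] with x hx
  have : 0 < dist x x₀ := dist_pos.2 hx
  apply propext
  simp only [shell]
  exact ⟨fun h => h.2, fun h => ⟨this, h⟩⟩

/-- Polar decomposition of the punctured space, whose missing point is null, followed by a
translation and a restriction to the shell. -/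
theorem measurePreserving_polarMap (hn : 1 ≤ n) (x₀ : Eucl n) {a b : ℝ} (ha : 0 ≤ a) :
    MeasurePreserving (polarMap x₀) ((radialMeasure n a b).prod (sphereMeasure n))
      (volume.restrict (shell x₀ a b)) := by
  have : Nonempty (Fin n) := ⟨⟨0, hn⟩⟩
  have hd : Module.finrank ℝ (Eucl n) = n := by simp
  set e := homeomorphUnitSphereProd (Eucl n)
  set ν : Measure ℝ := (volume.restrict (Ioi 0)).withDensity fun t => ENNReal.ofReal (t ^ (n - 1))
  have hval : MeasurePreserving (Subtype.val : Ioi (0 : ℝ) → ℝ) (Measure.volumeIoiPow (n - 1)) ν := by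
    refine ⟨measurable_subtype_coe, ?_⟩
    have me := MeasurableEmbedding.subtype_coe (measurableSet_Ioi (a := (0 : ℝ)))
    ext s hs
    rw [me.map_apply, Measure.volumeIoiPow, withDensity_apply _ (me.measurable hs),
      withDensity_apply _ hs, Measure.restrict_restrict hs]
    rw [setLIntegral_subtype measurableSet_Ioi _ fun t : ℝ => ENNReal.ofReal (t ^ (n - 1)),
      Subtype.image_preimage_coe, inter_comm]
  have h1 : MeasurePreserving (Subtype.val ∘ e.symm)
      ((sphereMeasure n).prod (Measure.volumeIoiPow (n - 1))) volume := by
    have h2 := (volume : Measure (Eucl n)).measurePreserving_homeomorphUnitSphereProd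
    rw [hd] at h2
    have h3 : MeasurePreserving (Subtype.val : ({0}ᶜ : Set (Eucl n)) → Eucl n)
        (volume.comap Subtype.val) volume := by
      refine ⟨measurable_subtype_coe, ?_⟩
      rw [map_comap_subtype_coe (measurableSet_singleton _).compl, restrict_compl_singleton]
    have h4 : MeasurePreserving e.toMeasurableEquiv (volume.comap Subtype.val)
      ((sphereMeasure n).prod (Measure.volumeIoiPow (n - 1))) := h2
    exact h3.comp (h4.symm e.toMeasurableEquiv)
  have h5 : MeasurePreserving (polarMap (0 : Eucl n)) (ν.prod (sphereMeasure n)) volume := by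
    have hB := hval.prod (MeasurePreserving.id (sphereMeasure n))
    refine ⟨(continuous_polarMap 0).measurable, ?_⟩
    rw [← hB.map_eq, Measure.map_map (continuous_polarMap 0).measurable hB.measurable]
    have h6 := (h1.comp (Measure.measurePreserving_swap (μ := Measure.volumeIoiPow (n - 1))
      (ν := sphereMeasure n))).map_eq
    rw [← h6]
    congr 1
    ext1 p
    simp [polarMap, e]
  have h7 : MeasurePreserving (polarMap x₀) (ν.prod (sphereMeasure n)) volume := by
    have := (measurePreserving_add_left (volume : Measure (Eucl n)) x₀).comp h5
    convert this using 1
    ext1 p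
    simp [polarMap]
  have h8 := h7.restrict_preimage (isOpen_shell x₀ a b).measurableSet
  convert h8 using 1
  -- The two sets agree only up to a null set: negative radii can also be mapped into the shell, but
  -- ν gives them no mass.
  have h9 : (polarMap x₀ ⁻¹' shell x₀ a b : Set (ℝ × sphere (0 : Eucl n) 1))
      =ᵐ[ν.prod (sphereMeasure n)] Ioo a b ×ˢ univ := by
    have : ∀ᵐ t ∂ν, 0 < t :=
      (withDensity_absolutelyContinuous _ _).ae_le (ae_restrict_mem measurableSet_Ioi)
    have h10 : ∀ᵐ p ∂ν.prod (sphereMeasure n), 0 < p.1 :=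
      Measure.quasiMeasurePreserving_fst.ae this
    filter_upwards [h10] with p hp
    apply propext
    change (a < dist (x₀ + p.1 • (p.2 : Eucl n)) x₀ ∧
      dist (x₀ + p.1 • (p.2 : Eucl n)) x₀ < b) ↔ p ∈ Ioo a b ×ˢ univ
    rw [dist_polarMap x₀ hp.le]
    simp
  rw [Measure.restrict_congr_set h9, ← Measure.prod_restrict, Measure.restrict_univ]
  congr 1
  rw [restrict_withDensity measurableSet_Ioo, Measure.restrict_restrict measurableSet_Ioo,
    show Ioo a b ∩ Ioi 0 = Ioo a b from
      inter_eq_left.2 fun t ht => lt_of_le_of_lt ha ht.1]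
  rfl

theorem ae_of_ae_radialMeasure {a b : ℝ} (ha : 0 ≤ a) {p : ℝ → Prop}
    (h : ∀ᵐ t ∂radialMeasure n a b, p t) : ∀ᵐ t ∂volume.restrict (Ioo a b), p t := by
  rw [radialMeasure, ae_withDensity_iff (by fun_prop)] at h
  filter_upwards [h, ae_restrict_mem measurableSet_Ioo] with t ht htm
  exact ht (ENNReal.ofReal_pos.2 (pow_pos (ha.trans_lt htm.1) _)).ne'

theorem integral_shell (hn : 1 ≤ n) {x₀ : Eucl n} {a b : ℝ} (ha : 0 ≤ a) {f : Eucl n → ℝ}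
    (hf : IntegrableOn f (shell x₀ a b)) :
    IntegrableOn (fun t => t ^ (n - 1) * ∫ θ, f (x₀ + t • (θ : Eucl n)) ∂sphereMeasure n)
      (Ioo a b) ∧
    ∫ x in shell x₀ a b, f x =
      ∫ t in Ioo a b, t ^ (n - 1) * ∫ θ, f (x₀ + t • (θ : Eucl n)) ∂sphereMeasure n := by
  have mp := measurePreserving_polarMap hn x₀ (b := b) ha
  have hf' : Integrable (f ∘ polarMap x₀) ((radialMeasure n a b).prod (sphereMeasure n)) :=
    mp.integrable_comp_of_integrable hf
  have hae : ∀ᵐ t ∂volume.restrict (Ioo a b),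
      (ENNReal.ofReal (t ^ (n - 1))).toReal • ∫ θ, f (x₀ + t • (θ : Eucl n)) ∂sphereMeasure n =
      t ^ (n - 1) * ∫ θ, f (x₀ + t • (θ : Eucl n)) ∂sphereMeasure n := by
    filter_upwards [ae_restrict_mem measurableSet_Ioo] with t ht
    rw [ENNReal.toReal_ofReal (pow_nonneg (ha.trans ht.1.le) _), smul_eq_mul]
  constructor
  · have h1 := hf'.integral_prod_left
    rw [radialMeasure, integrable_withDensity_iff_integrable_smul' (by fun_prop) (by simp)] at h1
    exact h1.congr hae
  · rw [← mp.map_eq, integral_map mp.measurable.aemeasurable (by rw [mp.map_eq]; exact hf.1)]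
    change ∫ p, (f ∘ polarMap x₀) p ∂_ = _
    rw [integral_prod _ hf', radialMeasure,
      integral_withDensity_eq_integral_toReal_smul (by fun_prop) (by simp)]
    exact integral_congr_ae hae

theorem integral_ball (hn : 1 ≤ n) {x₀ : Eucl n} {R r : ℝ} (hr : 0 < r) (hrR : r ≤ R)
    {f : Eucl n → ℝ} (hf : IntegrableOn f (ball x₀ R)) :
    ∫ x in ball x₀ r, f x =
      ∫ t in (0 : ℝ)..r, t ^ (n - 1) * ∫ θ, f (x₀ + t • (θ : Eucl n)) ∂sphereMeasure n := by
  have hsub : shell x₀ 0 r ⊆ ball x₀ R := fun x hx => lt_of_lt_of_le hx.2 hrR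
  rw [← setIntegral_congr_set (shell_zero_ae_eq hn x₀ r),
    (integral_shell hn le_rfl (hf.mono_set hsub)).2, intervalIntegral.integral_of_le hr.le,
    integral_Ioc_eq_integral_Ioo]

theorem intervalIntegrable_ball (hn : 1 ≤ n) {x₀ : Eucl n} {R : ℝ} (hR : 0 < R)
    {f : Eucl n → ℝ} (hf : IntegrableOn f (ball x₀ R)) :
    IntervalIntegrable (fun t => t ^ (n - 1) * ∫ θ, f (x₀ + t • (θ : Eucl n)) ∂sphereMeasure n)
      volume 0 R := by
  have hsub : shell x₀ 0 R ⊆ ball x₀ R := fun x hx => hx.2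
  rw [intervalIntegrable_iff_integrableOn_Ioo_of_le hR.le]
  exact (integral_shell hn le_rfl (hf.mono_set hsub)).1

/-- The radial factor is ∫₀¹ t^{n−1+k} dt. The case k = 2 produces the factor 1/(n+2) in the energy
of a 2-homogeneous function, whose density |∇c|² + 2|c| is itself 2-homogeneous. -/
theorem integral_pow_mul_cone (hn : 1 ≤ n) (k : ℕ) {h : Eucl n → ℝ} (hm : Measurable h) :
    ∫ x in ball (0 : Eucl n) 1, ‖x‖ ^ k * h (‖x‖⁻¹ • x) =
      1 / ((n : ℝ) + k) * ∫ θ, h θ ∂sphereMeasure n := by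
  have mp := measurePreserving_polarMap hn (0 : Eucl n) (b := 1) le_rfl
  have hF : Measurable fun x : Eucl n => ‖x‖ ^ k * h (‖x‖⁻¹ • x) := by fun_prop
  rw [← setIntegral_congr_set (shell_zero_ae_eq hn (0 : Eucl n) 1), ← mp.map_eq,
    integral_map mp.measurable.aemeasurable hF.aestronglyMeasurable]
  have hpos : ∀ᵐ t ∂radialMeasure n 0 1, 0 < t :=
    (withDensity_absolutelyContinuous _ _).ae_le
      ((ae_restrict_mem measurableSet_Ioo).mono fun t ht => ht.1)
  have hae : ∀ᵐ p ∂(radialMeasure n 0 1).prod (sphereMeasure n),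
      ‖polarMap 0 p‖ ^ k * h (‖polarMap 0 p‖⁻¹ • polarMap 0 p) = p.1 ^ k * h p.2 := by
    filter_upwards [Measure.quasiMeasurePreserving_fst.ae hpos] with p hp
    have : ‖polarMap 0 p‖ = p.1 := by simp [polarMap, norm_smul, abs_of_pos hp]
    rw [this]
    simp [polarMap, smul_smul, hp.ne']
  rw [integral_congr_ae hae, integral_prod_mul (fun t => t ^ k) (fun θ : sphere (0 : Eucl n) 1 => h θ)]
  congr 1
  rw [radialMeasure, integral_withDensity_eq_integral_toReal_smul (by fun_prop) (by simp)]
  have : ∀ t ∈ Ioo (0 : ℝ) 1, (ENNReal.ofReal (t ^ (n - 1))).toReal • t ^ k = t ^ (n - 1 + k) :=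
    fun t ht => by rw [ENNReal.toReal_ofReal (pow_nonneg ht.1.le _), smul_eq_mul, pow_add]
  rw [setIntegral_congr_fun measurableSet_Ioo this, ← integral_Ioc_eq_integral_Ioo,
    ← intervalIntegral.integral_of_le zero_le_one, integral_pow]
  have : (((n - 1 + k : ℕ) : ℝ) + 1) = n + k := by
    rw [← Nat.cast_add_one, ← Nat.cast_add]
    congr 1
    omega
  rw [this]
  simp

theorem radialMeasure_zero_one_le : radialMeasure n 0 1 univ ≤ 1 := by
  rw [radialMeasure, withDensity_apply _ MeasurableSet.univ, Measure.restrict_univ]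
  refine (setLIntegral_mono' (g := fun _ => 1) measurableSet_Ioo fun t ht => ?_).trans (by simp)
  rw [← ENNReal.ofReal_one]
  exact ENNReal.ofReal_le_ofReal (pow_le_one₀ ht.1.le ht.2.le)

/-- On the unit ball |x|^k ≤ 1, and t^{n−1} dt on (0,1) has mass at most 1. Hence L² convergence of
boundary data on ∂B₁ passes to their homogeneous extensions in B₁. -/
theorem eLpNorm_cone_le (hn : 1 ≤ n) (k : ℕ) {γ : Eucl n → Eucl m} (hm : StronglyMeasurable γ) :
    eLpNorm (fun x => ‖x‖ ^ k • γ (‖x‖⁻¹ • x)) 2 (volume.restrict (ball (0 : Eucl n) 1)) ≤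
      eLpNorm (fun θ : sphere (0 : Eucl n) 1 => γ θ) 2 (sphereMeasure n) := by
  have mp := measurePreserving_polarMap hn (0 : Eucl n) (b := 1) le_rfl
  have hγ : StronglyMeasurable fun x : Eucl n => γ (‖x‖⁻¹ • x) :=
    hm.comp_measurable (by fun_prop)
  have hpos : ∀ᵐ t ∂radialMeasure n 0 1, 0 < t :=
    (withDensity_absolutelyContinuous _ _).ae_le
      ((ae_restrict_mem measurableSet_Ioo).mono fun t ht => ht.1)
  calc _ ≤ eLpNorm (fun x => γ (‖x‖⁻¹ • x)) 2 (volume.restrict (ball (0 : Eucl n) 1)) := by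
        refine eLpNorm_mono_ae ?_
        filter_upwards [ae_restrict_mem measurableSet_ball] with x hx
        rw [norm_smul, norm_pow, norm_norm]
        refine mul_le_of_le_one_left (norm_nonneg _) (pow_le_one₀ (norm_nonneg _) ?_)
        simpa using (mem_ball.1 hx).le
    _ = eLpNorm (fun x => γ (‖x‖⁻¹ • x)) 2 (volume.restrict (shell (0 : Eucl n) 0 1)) := by
        rw [Measure.restrict_congr_set (shell_zero_ae_eq hn (0 : Eucl n) 1)]
    _ = eLpNorm ((fun x => γ (‖x‖⁻¹ • x)) ∘ polarMap 0) 2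
          ((radialMeasure n 0 1).prod (sphereMeasure n)) :=
        (eLpNorm_comp_measurePreserving hγ.aestronglyMeasurable mp).symm
    _ = eLpNorm ((fun θ : sphere (0 : Eucl n) 1 => γ θ) ∘ Prod.snd) 2
          ((radialMeasure n 0 1).prod (sphereMeasure n)) := by
        refine eLpNorm_congr_ae ?_
        filter_upwards [Measure.quasiMeasurePreserving_fst.ae hpos] with p hp
        have : ‖polarMap 0 p‖ = p.1 := by simp [polarMap, norm_smul, abs_of_pos hp]
        rw [Function.comp_apply, this]
        simp [polarMap, smul_smul, hp.ne']
    _ = eLpNorm (fun θ : sphere (0 : Eucl n) 1 => γ θ) 2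
          (Measure.map Prod.snd ((radialMeasure n 0 1).prod (sphereMeasure n))) :=
        (eLpNorm_map_measure (hm.comp_measurable measurable_subtype_coe).aestronglyMeasurable
          measurable_snd.aemeasurable).symm
    _ ≤ _ := by
        refine eLpNorm_mono_measure _ ?_
        rw [Measure.map_snd_prod]
        refine Measure.le_iff.2 fun s _ => ?_
        rw [Measure.smul_apply, smul_eq_mul]
        exact mul_le_of_le_one_left' radialMeasure_zero_one_le

/-- Away from the centre the weight t^{n−1} is at least a^{n−1}, so the unweighted measure dt ⊗
dℋⁿ⁻¹ is dominated by Lebesgue measure in polar coordinates. -/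
theorem exists_eLpNorm_polar_le (hn : 1 ≤ n) (x₀ : Eucl n) {a b : ℝ} (ha : 0 < a) :
    ∃ C : ℝ≥0∞, C ≠ ⊤ ∧ ∀ f : Eucl n → Eucl m,
      AEStronglyMeasurable f (volume.restrict (shell x₀ a b)) →
      AEStronglyMeasurable (f ∘ polarMap x₀)
        ((volume.restrict (Ioo a b)).prod (sphereMeasure n)) ∧
      eLpNorm (f ∘ polarMap x₀) 2 ((volume.restrict (Ioo a b)).prod (sphereMeasure n)) ≤
        C * eLpNorm f 2 (volume.restrict (shell x₀ a b)) := by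
  set c : ℝ≥0∞ := ENNReal.ofReal (a ^ (n - 1))
  have hc0 : c ≠ 0 := (ENNReal.ofReal_pos.2 (pow_pos ha _)).ne'
  have hc : c ≠ ⊤ := ENNReal.ofReal_ne_top
  have hle : volume.restrict (Ioo a b) ≤ c⁻¹ • radialMeasure n a b := by
    refine Measure.le_iff.2 fun s hs => ?_
    rw [Measure.smul_apply, radialMeasure, withDensity_apply _ hs, smul_eq_mul,
      Measure.restrict_restrict hs]
    have : c * volume (s ∩ Ioo a b) ≤
        ∫⁻ t in s ∩ Ioo a b, ENNReal.ofReal (t ^ (n - 1)) := by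
      rw [← setLIntegral_const]
      refine setLIntegral_mono' (hs.inter measurableSet_Ioo) fun t ht => ?_
      exact ENNReal.ofReal_le_ofReal (pow_le_pow_left₀ ha.le ht.2.1.le _)
    rw [Measure.restrict_apply hs]
    calc volume (s ∩ Ioo a b) = c⁻¹ * (c * volume (s ∩ Ioo a b)) := by
          rw [← mul_assoc, ENNReal.inv_mul_cancel hc0 hc, one_mul]
      _ ≤ _ := by gcongr
  have hle2 : (volume.restrict (Ioo a b)).prod (sphereMeasure n) ≤
      c⁻¹ • (radialMeasure n a b).prod (sphereMeasure n) := by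
    rw [← Measure.prod_smul_left]
    exact Measure.prod_mono hle le_rfl
  have mp := measurePreserving_polarMap hn x₀ (b := b) ha.le
  refine ⟨c⁻¹ ^ (1 / (2 : ℝ)), ENNReal.rpow_ne_top_of_nonneg (by norm_num)
    (ENNReal.inv_ne_top.2 hc0), fun f hf => ⟨?_, ?_⟩⟩
  · exact ((hf.comp_measurePreserving mp).smul_measure _).mono_measure hle2
  · refine (eLpNorm_mono_measure _ hle2).trans ?_
    rw [eLpNorm_smul_measure_of_ne_zero (ENNReal.inv_ne_zero.2 hc),
      eLpNorm_comp_measurePreserving hf mp]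
    simp

end Polar

/-! ### Criteria for L² convergence to zero -/

section L2Tools

variable {α E : Type*} [MeasurableSpace α] {μ : Measure α} [NormedAddCommGroup E]

theorem eLpNorm_two_sq (f : α → E) (μ : Measure α) :
    eLpNorm f 2 μ ^ 2 = ∫⁻ x, ‖f x‖ₑ ^ 2 ∂μ := by
  have := eLpNorm_nnreal_pow_eq_lintegral (μ := μ) (f := f) (p := 2) (by simp)
  simpa only [ENNReal.coe_ofNat, NNReal.coe_ofNat, ENNReal.rpow_ofNat] using this

theorem tendsto_zero_of_sq {ι : Type*} {l : Filter ι} {f : ι → ℝ≥0∞}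
    (h : Tendsto (fun k => f k ^ 2) l (𝓝 0)) : Tendsto f l (𝓝 0) := by
  have := (ENNReal.continuous_rpow_const (y := 1 / 2)).tendsto 0 |>.comp h
  rw [ENNReal.zero_rpow_of_pos (by norm_num)] at this
  refine this.congr fun k => ?_
  rw [Function.comp_apply, ← ENNReal.rpow_natCast, ← ENNReal.rpow_mul]
  norm_num

theorem tendsto_eLpNorm_two_of_bounded [IsFiniteMeasure μ] {f : ℕ → α → E}
    (hm : ∀ k, AEStronglyMeasurable (f k) μ) {C : ℝ} (hb : ∀ k, ∀ᵐ x ∂μ, ‖f k x‖ ≤ C)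
    (hl : ∀ᵐ x ∂μ, Tendsto (fun k => f k x) atTop (𝓝 0)) :
    Tendsto (fun k => eLpNorm (f k) 2 μ) atTop (𝓝 0) := by
  refine tendsto_zero_of_sq ?_
  simp_rw [eLpNorm_two_sq]
  have := tendsto_lintegral_of_dominated_convergence' (μ := μ)
    (F := fun k x => ‖f k x‖ₑ ^ 2) (f := fun _ => 0) (fun _ => ENNReal.ofReal C ^ 2)
    (fun k => (hm k).enorm.pow_const 2) (fun k => ?_) ?_ ?_
  · simpa using this
  · filter_upwards [hb k] with x hx
    exact pow_le_pow_left₀ zero_le (by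
      rw [← ofReal_norm]
      exact ENNReal.ofReal_le_ofReal hx) 2
  · simp [ENNReal.mul_eq_top, measure_ne_top]
  · filter_upwards [hl] with x hx
    have h1 : Tendsto (fun k => ‖f k x‖ₑ) atTop (𝓝 0) :=
      enorm_zero (E := E) ▸ (continuous_enorm.tendsto (0 : E)).comp hx
    have h2 := ((ENNReal.continuous_pow 2).tendsto 0).comp h1
    rwa [zero_pow two_ne_zero] at h2

theorem tendsto_eLpNorm_two_of_uniform [IsFiniteMeasure μ] {f : ℕ → α → E}
    (h : ∀ ε > 0, ∀ᶠ k in atTop, ∀ᵐ x ∂μ, ‖f k x‖ ≤ ε) :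
    Tendsto (fun k => eLpNorm (f k) 2 μ) atTop (𝓝 0) := by
  have hfin : μ univ ^ (1 / (2 : ℝ)) ≠ ⊤ :=
    ENNReal.rpow_ne_top_of_nonneg (by norm_num) (measure_ne_top _ _)
  have hlim : Tendsto (fun c : ℝ => μ univ ^ (1 / (2 : ℝ)) * ENNReal.ofReal c) (𝓝[>] 0) (𝓝 0) := by
    have := ENNReal.Tendsto.const_mul (ENNReal.tendsto_ofReal (tendsto_id.mono_left
      (nhdsWithin_le_nhds (a := (0 : ℝ)) (s := Ioi 0)))) (Or.inr hfin)
    simpa using this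
  rw [ENNReal.tendsto_nhds_zero]
  intro ε hε
  obtain ⟨c, h1, h2⟩ := ((hlim.eventually (Iic_mem_nhds hε)).and self_mem_nhdsWithin).exists
  filter_upwards [h c h2] with k hk
  refine (eLpNorm_le_of_ae_bound hk).trans (le_trans (le_of_eq ?_) h1)
  simp

end L2Tools

/-! ### Two-homogeneous extensions and their gradients -/

section Cone

/-- The `2`-homogeneous extension of the values of `P` on the unit sphere. -/
noncomputable def homog (P : Eucl n → Eucl m) : Eucl n → Eucl m :=
  fun x => ‖x‖ ^ 2 • P (‖x‖⁻¹ • x)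

theorem homogExt_eq (u : Eucl n → Eucl m) (x₀ : Eucl n) (r : ℝ) :
    homogExt u x₀ r = homog (rescale u x₀ r) := rfl

/-- The radial component of the gradient `g`. -/
noncomputable def radial (g : Fin n → Eucl n → Eucl m) (θ : Eucl n) : Eucl m :=
  ∑ j, θ j • g j θ

/-- The gradient on the unit sphere of the `2`-homogeneous extension of a function with values `p`
and gradient `g`. -/
noncomputable def coneGrad (p : Eucl n → Eucl m) (g : Fin n → Eucl n → Eucl m) (i : Fin n) :
    Eucl n → Eucl m :=
  fun θ => (2 * θ i) • p θ + (g i θ - θ i • radial g θ)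

theorem sum_sq_coord {θ : Eucl n} (hθ : ‖θ‖ = 1) : ∑ i, θ i ^ 2 = 1 := by
  have := EuclideanSpace.norm_sq_eq θ
  rw [hθ] at this
  simpa using this.symm

/-- Pythagoras: the tangential part of g is orthogonal to θ and has squared norm |g|² − |radial g|²,
while the radial part of the new gradient is 2p, as Euler's identity for degree 2 demands. -/
theorem sum_norm_sq_coneGrad (p : Eucl n → Eucl m) (g : Fin n → Eucl n → Eucl m) {θ : Eucl n}
    (hθ : ‖θ‖ = 1) : ∑ i, ‖coneGrad p g i θ‖ ^ 2 =
      4 * ‖p θ‖ ^ 2 + ∑ i, ‖g i θ‖ ^ 2 - ‖radial g θ‖ ^ 2 := by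
  have h1 := sum_sq_coord hθ
  set a := p θ
  set ρ := radial g θ with hρ
  have e : ∀ i, ‖coneGrad p g i θ‖ ^ 2 = 4 * ‖a‖ ^ 2 * θ i ^ 2 + ‖g i θ‖ ^ 2
      + ‖ρ‖ ^ 2 * θ i ^ 2 + 4 * inner ℝ a (θ i • g i θ) - 4 * inner ℝ a ρ * θ i ^ 2
      - 2 * inner ℝ (θ i • g i θ) ρ := fun i => by
    simp only [coneGrad]
    rw [norm_add_sq_real, norm_sub_sq_real, norm_smul, norm_smul, inner_sub_right,
      real_inner_smul_left, real_inner_smul_left, real_inner_smul_right, real_inner_smul_right,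
      real_inner_smul_right, real_inner_smul_left, mul_pow, mul_pow, Real.norm_eq_abs,
      Real.norm_eq_abs, sq_abs, sq_abs]
    ring
  simp_rw [e, Finset.sum_sub_distrib, Finset.sum_add_distrib, ← Finset.mul_sum, h1, ← inner_sum,
    ← sum_inner]
  have : ∑ i, θ i • g i θ = ρ := rfl
  rw [this, real_inner_self_eq_norm_sq]
  ring

theorem hasFDerivAt_norm {x : Eucl n} (hx : x ≠ 0) :
    HasFDerivAt (fun y : Eucl n => ‖y‖) (‖x‖⁻¹ • innerSL ℝ x) x := by
  have h0 : ‖x‖ ^ 2 ≠ 0 := by positivity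
  have h := (hasStrictFDerivAt_norm_sq x).hasFDerivAt.sqrt h0
  simp only [Real.sqrt_sq (norm_nonneg _)] at h
  refine h.congr_fderiv ?_
  ext y
  simp
  ring

theorem hasFDerivAt_homog {P : Eucl n → Eucl m} (hP : Differentiable ℝ P) {x : Eucl n}
    (hx : x ≠ 0) : ∃ L : Eucl n →L[ℝ] Eucl m, HasFDerivAt (homog P) L x ∧
      ∀ e, L e = ‖x‖ • ((2 * inner ℝ (‖x‖⁻¹ • x) e) • P (‖x‖⁻¹ • x) +
        (fderiv ℝ P (‖x‖⁻¹ • x) e - inner ℝ (‖x‖⁻¹ • x) e •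
          fderiv ℝ P (‖x‖⁻¹ • x) (‖x‖⁻¹ • x))) := by
  have hn0 : ‖x‖ ≠ 0 := norm_ne_zero_iff.2 hx
  have h1 := (hasDerivAt_inv hn0).comp_hasFDerivAt x (hasFDerivAt_norm hx)
  have h2 : HasFDerivAt (fun y : Eucl n => ‖y‖⁻¹ • y) _ x := h1.smul (hasFDerivAt_id x)
  have h3 := HasFDerivAt.comp (f := fun y : Eucl n => ‖y‖⁻¹ • y) x
    (hP (‖x‖⁻¹ • x)).hasFDerivAt h2
  have h4 := (hasStrictFDerivAt_norm_sq x).hasFDerivAt.smul h3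
  refine ⟨_, h4, fun e => ?_⟩
  simp only [Function.comp_apply, add_apply, ContinuousLinearMap.comp_apply, smul_apply,
    ContinuousLinearMap.smulRight_apply, innerSL_apply_apply, id, ContinuousLinearMap.coe_id',
    map_add, map_smul, smul_eq_mul, real_inner_smul_left]
  simp only [smul_add, smul_sub, smul_smul]
  match_scalars <;> field_simp
  rw [two_smul, two_mul]

theorem fderiv_apply_self (P : Eucl n → Eucl m) (θ : Eucl n) :
    fderiv ℝ P θ θ = radial (pderiv P) θ := by
  have h : θ = ∑ j, θ j • EuclideanSpace.single j (1 : ℝ) := by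
    ext i
    simp [Finset.sum_apply, Pi.single_apply]
  calc fderiv ℝ P θ θ = fderiv ℝ P θ (∑ j, θ j • EuclideanSpace.single j (1 : ℝ)) := by rw [← h]
    _ = radial (pderiv P) θ := by
      rw [map_sum]
      simp [radial, pderiv]

theorem opNorm_le_sum (L : Eucl n →L[ℝ] Eucl m) :
    ‖L‖ ≤ ∑ i, ‖L (EuclideanSpace.single i 1)‖ := by
  refine L.opNorm_le_bound (Finset.sum_nonneg fun _ _ => norm_nonneg _) fun x => ?_
  have h : x = ∑ j, x j • EuclideanSpace.single j (1 : ℝ) := by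
    ext i
    simp [Finset.sum_apply, Pi.single_apply]
  conv_lhs => rw [h]
  rw [map_sum, Finset.sum_mul]
  refine (norm_sum_le _ _).trans (Finset.sum_le_sum fun i _ => ?_)
  rw [map_smul, norm_smul, mul_comm]
  exact mul_le_mul_of_nonneg_left (PiLp.norm_apply_le x i) (norm_nonneg _)

theorem exists_bound_sphere {f : Eucl n → Eucl m} (hf : Continuous f) :
    ∃ C, 0 ≤ C ∧ ∀ θ : Eucl n, ‖θ‖ = 1 → ‖f θ‖ ≤ C := by
  obtain ⟨C, hC⟩ := (isCompact_sphere (0 : Eucl n) 1).exists_bound_of_continuousOn hf.continuousOn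
  exact ⟨max C 0, le_max_right _ _, fun θ hθ => (hC θ (by simpa using hθ)).trans (le_max_left _ _)⟩

theorem norm_inv_smul_self {x : Eucl n} (hx : x ≠ 0) : ‖‖x‖⁻¹ • x‖ = 1 := by
  rw [norm_smul, norm_inv, norm_norm, inv_mul_cancel₀ (norm_ne_zero_iff.2 hx)]

/-- Homogeneity of degree 2 gives |homog P(x)| ≤ C|x|². Differentiability at the vertex is needed so
that the extension is differentiable everywhere and its classical gradient is the weak one. -/
theorem hasFDerivAt_homog_zero {P : Eucl n → Eucl m} (hP : Continuous P) :
    HasFDerivAt (homog P) (0 : Eucl n →L[ℝ] Eucl m) 0 := by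
  obtain ⟨C, hC0, hC⟩ := exists_bound_sphere hP
  have hb : ∀ x, ‖homog P x‖ ≤ C * ‖x‖ ^ 2 := fun x => by
    rcases eq_or_ne x 0 with rfl | hx
    · simp [homog]
    · rw [homog, norm_smul, norm_pow, norm_norm, mul_comm]
      exact mul_le_mul_of_nonneg_right (hC _ (norm_inv_smul_self hx)) (by positivity)
  have h0 : homog P 0 = 0 := by simp [homog]
  rw [hasFDerivAt_iff_isLittleO_nhds_zero]
  simp only [zero_add, h0, sub_zero, zero_apply]
  refine (Asymptotics.IsBigO.of_bound C (Eventually.of_forall fun x => ?_)).trans_isLittleO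
    (Asymptotics.isLittleO_pow_id one_lt_two |>.comp_tendsto tendsto_norm_zero |>.trans_isBigO
      (Asymptotics.isBigO_refl _ _).norm_left)
  simpa using hb x

theorem differentiable_homog {P : Eucl n → Eucl m} (hP : Differentiable ℝ P) :
    Differentiable ℝ (homog P) := fun x => by
  rcases eq_or_ne x 0 with rfl | hx
  · exact (hasFDerivAt_homog_zero hP.continuous).differentiableAt
  · obtain ⟨L, hL, -⟩ := hasFDerivAt_homog hP hx
    exact hL.differentiableAt

theorem pderiv_homog {P : Eucl n → Eucl m} (hP : Differentiable ℝ P) (i : Fin n) (x : Eucl n) :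
    pderiv (homog P) i x = ‖x‖ • coneGrad P (pderiv P) i (‖x‖⁻¹ • x) := by
  rcases eq_or_ne x 0 with rfl | hx
  · rw [pderiv, (hasFDerivAt_homog_zero hP.continuous).fderiv]
    simp
  · obtain ⟨L, hL, he⟩ := hasFDerivAt_homog hP hx
    rw [pderiv, hL.fderiv, he, fderiv_apply_self]
    simp [coneGrad, pderiv, EuclideanSpace.inner_single_right]

end Cone

/-! ### Functions vanishing on the unit sphere belong to W₀^{1,2} -/

section CutOff

theorem exists_bound_deriv_smoothTransition :
    ∃ C, ∀ s, |deriv Real.smoothTransition s| ≤ C := by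
  have hc : Continuous (deriv Real.smoothTransition) :=
    (Real.smoothTransition.contDiff (n := 1)).continuous_deriv le_rfl
  obtain ⟨C, hC⟩ := (isCompact_Icc (a := (0 : ℝ)) (b := 1)).exists_bound_of_continuousOn
    hc.continuousOn
  refine ⟨C, fun s => ?_⟩
  have hC0 : 0 ≤ C := (norm_nonneg _).trans (hC 0 (by simp))
  rcases lt_or_ge s 0 with hs | hs
  · have : Real.smoothTransition =ᶠ[𝓝 s] fun _ => 0 :=
      (eventually_lt_nhds hs).mono fun t ht => Real.smoothTransition.zero_of_nonpos ht.le
    rw [this.deriv_eq]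
    simpa using hC0
  rcases lt_or_ge 1 s with hs' | hs'
  · have : Real.smoothTransition =ᶠ[𝓝 s] fun _ => 1 :=
      (eventually_gt_nhds hs').mono fun t ht => Real.smoothTransition.one_of_one_le ht.le
    rw [this.deriv_eq]
    simpa using hC0
  · exact hC s ⟨hs, hs'⟩

theorem deriv_smoothTransition_of_one_le {s : ℝ} (hs : 1 < s) :
    deriv Real.smoothTransition s = 0 := by
  have : Real.smoothTransition =ᶠ[𝓝 s] fun _ => 1 :=
    (eventually_gt_nhds hs).mono fun t ht => Real.smoothTransition.one_of_one_le ht.le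
  rw [this.deriv_eq]
  simp

/-- A cutoff function which vanishes near the unit sphere. -/
noncomputable def ballCutoff (j : ℕ) (x : Eucl n) : ℝ :=
  Real.smoothTransition (j * (1 - ‖x‖ ^ 2) - 1)

theorem hasFDerivAt_ballCutoff (j : ℕ) (x : Eucl n) :
    HasFDerivAt (ballCutoff j) ((deriv Real.smoothTransition (j * (1 - ‖x‖ ^ 2) - 1) *
      (-2 * j)) • innerSL ℝ x) x := by
  have h1 := ((((hasStrictFDerivAt_norm_sq x).hasFDerivAt.const_sub 1).const_mul
    (j : ℝ)).sub_const 1)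
  have h2 := (((Real.smoothTransition.contDiff (n := 1)).differentiable one_ne_zero)
    (j * (1 - ‖x‖ ^ 2) - 1)).hasDerivAt.comp_hasFDerivAt x h1
  refine h2.congr_fderiv ?_
  ext y
  simp
  ring

/-- Multiplication by the cutoff η_j gives compact support in the ball. Its gradient has size j, but
only where 1 − |x|² ≤ 2/j, and there q is of size 1/j since it is Lipschitz and vanishes on the
sphere. The gradients of η_j q are thus bounded uniformly in j and converge pointwise, and dominated
convergence applies. -/
theorem isWeakGradZero_of_eq_zero_on_sphere {q : Eucl n → Eucl m} (hq : Differentiable ℝ q)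
    {L : ℝ} (hL : ∀ x, ‖x‖ ≤ 1 → ‖fderiv ℝ q x‖ ≤ L) (h0 : ∀ x, ‖x‖ = 1 → q x = 0) :
    IsWeakGradZero (ball 0 1) q (pderiv q) := by
  obtain ⟨Cχ, hCχ⟩ := exists_bound_deriv_smoothTransition
  have hCχ0 : 0 ≤ Cχ := (abs_nonneg _).trans (hCχ 0)
  obtain ⟨C0, hC0⟩ := (isCompact_closedBall (0 : Eucl n) 1).exists_bound_of_continuousOn
    hq.continuous.continuousOn
  have hC0' : ∀ x : Eucl n, ‖x‖ ≤ 1 → ‖q x‖ ≤ C0 := fun x hx => hC0 x (by simpa using hx)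
  have hL0 : 0 ≤ L := (norm_nonneg _).trans (hL 0 (by simp))
  have hC00 : 0 ≤ C0 := (norm_nonneg _).trans (hC0' 0 (by simp))
  have hpL : ∀ i x, ‖x‖ ≤ 1 → ‖pderiv q i x‖ ≤ L := fun i x hx => by
    refine (ContinuousLinearMap.le_opNorm _ _).trans ?_
    simpa using hL x hx
  -- The mean value inequality between x and its radial projection x/|x|. The extra factor |x|
  -- covers the origin and costs nothing, as the gradient of the cutoff carries the same factor.
  have hlip : ∀ x : Eucl n, ‖x‖ ≤ 1 → ‖x‖ * ‖q x‖ ≤ L * (1 - ‖x‖) := fun x hx => by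
    rcases eq_or_ne x 0 with rfl | hx0
    · simpa using hL0
    have h1 := (convex_closedBall (0 : Eucl n) 1).norm_image_sub_le_of_norm_fderiv_le (𝕜 := ℝ)
      (f := q) (C := L) (x := ‖x‖⁻¹ • x) (y := x) (fun y _ => hq y)
      (fun y hy => hL y (by simpa using hy)) (by simpa using (norm_inv_smul_self hx0).le)
      (by simpa using hx)
    rw [h0 _ (norm_inv_smul_self hx0), sub_zero] at h1
    have h2 : ‖x - ‖x‖⁻¹ • x‖ = 1 - ‖x‖ := by
      have h3 : x - ‖x‖⁻¹ • x = (‖x‖ - 1) • (‖x‖⁻¹ • x) := by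
        rw [sub_smul, one_smul, smul_inv_smul₀ (norm_ne_zero_iff.2 hx0)]
      rw [h3, norm_smul, norm_inv_smul_self hx0, Real.norm_eq_abs, abs_of_nonpos (by linarith)]
      ring
    rw [h2] at h1
    calc ‖x‖ * ‖q x‖ ≤ 1 * ‖q x‖ := by gcongr
      _ ≤ _ := by rwa [one_mul]
  set η : ℕ → Eucl n → ℝ := fun j => ballCutoff j
  have hη01 : ∀ j x, 0 ≤ η j x ∧ η j x ≤ 1 := fun j x =>
    ⟨Real.smoothTransition.nonneg _, Real.smoothTransition.le_one _⟩
  have hηd : ∀ j, Differentiable ℝ (η j) := fun j x => (hasFDerivAt_ballCutoff j x).differentiableAt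
  set Q : ℕ → Eucl n → Eucl m := fun j x => η j x • q x
  have hQd : ∀ j, Differentiable ℝ (Q j) := fun j => (hηd j).smul hq
  have hpQ : ∀ j i x, pderiv (Q j) i x = η j x • pderiv q i x +
      (deriv Real.smoothTransition (j * (1 - ‖x‖ ^ 2) - 1) * (-2 * j) * x i) • q x := fun j i x => by
    have := ((hasFDerivAt_ballCutoff j x).smul (hq x).hasFDerivAt).fderiv
    simp only [pderiv]
    change fderiv ℝ (Q j) x = _ at this
    rw [this]
    simp [η, EuclideanSpace.inner_single_right]
  -- Where the derivative of the cutoff does not vanish, j(1 − |x|) ≤ j(1 − |x|²) ≤ 2, which absorbs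
  -- the factor j.
  have hest : ∀ (j : ℕ) i x, ‖x‖ ≤ 1 →
      ‖(deriv Real.smoothTransition (j * (1 - ‖x‖ ^ 2) - 1) * (-2 * j) * x i) • q x‖ ≤
        4 * Cχ * L := fun j i x hx => by
    rcases lt_or_ge 1 (j * (1 - ‖x‖ ^ 2) - 1) with hs | hs
    · rw [deriv_smoothTransition_of_one_le hs]
      simp only [zero_mul, zero_smul, norm_zero]
      positivity
    · have hj : (0 : ℝ) ≤ j := Nat.cast_nonneg j
      have h1 : (j : ℝ) * (1 - ‖x‖) ≤ 2 := by
        have : (j : ℝ) * (1 - ‖x‖) ≤ j * (1 - ‖x‖ ^ 2) := by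
          gcongr
          nlinarith [norm_nonneg x]
        linarith
      rw [norm_smul, norm_mul, norm_mul, norm_mul, Real.norm_eq_abs, norm_neg, RCLike.norm_ofNat,
        RCLike.norm_natCast]
      calc |deriv Real.smoothTransition (j * (1 - ‖x‖ ^ 2) - 1)| * (2 * j) * ‖x i‖ * ‖q x‖
          ≤ Cχ * (2 * j) * ‖x‖ * ‖q x‖ := by
            gcongr
            · exact hCχ _
            · exact PiLp.norm_apply_le x i
        _ = Cχ * (2 * j) * (‖x‖ * ‖q x‖) := by ring
        _ ≤ Cχ * (2 * j) * (L * (1 - ‖x‖)) := by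
            exact mul_le_mul_of_nonneg_left (hlip x hx) (by positivity)
        _ = 2 * Cχ * L * (j * (1 - ‖x‖)) := by ring
        _ ≤ 2 * Cχ * L * 2 := by gcongr
        _ = _ := by ring
  have hQb : ∀ j i x, ‖x‖ ≤ 1 → ‖pderiv (Q j) i x‖ ≤ L + 4 * Cχ * L := fun j i x hx => by
    rw [hpQ]
    refine (norm_add_le _ _).trans (add_le_add ?_ (hest j i x hx))
    rw [norm_smul, Real.norm_of_nonneg (hη01 j x).1]
    exact (mul_le_of_le_one_left (norm_nonneg _) (hη01 j x).2).trans (hpL i x hx)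
  have hsupp : ∀ j, tsupport (Q j) ⊆ {x | 1 ≤ j * (1 - ‖x‖ ^ 2)} := fun j => by
    refine closure_minimal (fun x hx => ?_)
      (isClosed_le continuous_const (by fun_prop))
    by_contra hlt
    refine hx ?_
    have : η j x = 0 := Real.smoothTransition.zero_of_nonpos (by
      have : ¬ (1 ≤ (j : ℝ) * (1 - ‖x‖ ^ 2)) := hlt
      linarith)
    simp [Q, this]
  have hball : ∀ j : ℕ, {x : Eucl n | 1 ≤ (j : ℝ) * (1 - ‖x‖ ^ 2)} ⊆ ball 0 1 := fun j x hx => by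
    have hx' : 1 ≤ (j : ℝ) * (1 - ‖x‖ ^ 2) := hx
    rw [mem_ball_zero_iff]
    by_contra hge
    have : 1 - ‖x‖ ^ 2 ≤ 0 := by nlinarith [not_lt.1 hge]
    have := mul_nonpos_of_nonneg_of_nonpos (Nat.cast_nonneg (α := ℝ) j) this
    linarith
  have hQs : ∀ j, tsupport (Q j) ⊆ ball 0 1 := fun j => (hsupp j).trans (hball j)
  have hQc : ∀ j, HasCompactSupport (Q j) := fun j =>
    HasCompactSupport.of_support_subset_isCompact (isCompact_closedBall (0 : Eucl n) 1)
      ((subset_tsupport _).trans ((hQs j).trans ball_subset_closedBall))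
  have fin : IsFiniteMeasure ((volume : Measure (Eucl n)).restrict (ball 0 1)) :=
    ⟨by simpa using measure_ball_lt_top⟩
  have hmq : ∀ i, StronglyMeasurable (pderiv q i) := fun i =>
    (measurable_fderiv_apply_const ℝ q _).stronglyMeasurable
  have hmQ : ∀ j i, StronglyMeasurable (pderiv (Q j) i) := fun j i =>
    (measurable_fderiv_apply_const ℝ (Q j) _).stronglyMeasurable
  have hQz : ∀ j, IsWeakGradZero (ball 0 1) (Q j) (pderiv (Q j)) := fun j => by
    refine isWeakGradZero_of_hasCompactSupport isOpen_ball (hQd j) (hQc j) (hQs j)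
      ((hQd j).continuous.memLp_of_hasCompactSupport (hQc j)) fun i => ?_
    have : pderiv (Q j) i = (ball 0 1).indicator (pderiv (Q j) i) := by
      refine (indicator_eq_self.2 fun x hx => hQs j ?_).symm
      exact tsupport_fderiv_subset ℝ (subset_tsupport _ fun h => hx (by simp [pderiv, h]))
    rw [this, memLp_indicator_iff_restrict measurableSet_ball]
    refine MemLp.of_bound (hmQ j i).aestronglyMeasurable (L + 4 * Cχ * L) ?_
    filter_upwards [ae_restrict_mem measurableSet_ball] with x hx
    exact hQb j i x (mem_ball_zero_iff.1 hx).le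
  have hlarge : ∀ x : Eucl n, ‖x‖ < 1 → ∀ᶠ j : ℕ in atTop, 1 < (j : ℝ) * (1 - ‖x‖ ^ 2) - 1 :=
    fun x hx => by
      have h1 : 0 < 1 - ‖x‖ ^ 2 := by nlinarith [norm_nonneg x]
      have h2 := (tendsto_natCast_atTop_atTop (R := ℝ)).atTop_mul_const h1
      filter_upwards [h2.eventually_gt_atTop 2] with j hj
      linarith
  have hw : IsWeakGrad (ball 0 1) q (pderiv q) := by
    refine isWeakGrad_of_differentiable hq ?_ fun i => ?_
    · refine MemLp.of_bound hq.continuous.aestronglyMeasurable C0 ?_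
      filter_upwards [ae_restrict_mem measurableSet_ball] with x hx
      exact hC0' x (mem_ball_zero_iff.1 hx).le
    · refine MemLp.of_bound (hmq i).aestronglyMeasurable L ?_
      filter_upwards [ae_restrict_mem measurableSet_ball] with x hx
      exact hpL i x (mem_ball_zero_iff.1 hx).le
  refine isWeakGradZero_of_tendsto hQz hw ?_ fun i => ?_
  · refine tendsto_eLpNorm_two_of_bounded (C := C0 + C0)
      (fun j => ((hQd j).continuous.sub hq.continuous).aestronglyMeasurable) (fun j => ?_) ?_
    · filter_upwards [ae_restrict_mem measurableSet_ball] with x hx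
      have hx' := hC0' x (mem_ball_zero_iff.1 hx).le
      refine (norm_sub_le _ _).trans (add_le_add ?_ hx')
      rw [norm_smul, Real.norm_of_nonneg (hη01 j x).1]
      exact (mul_le_of_le_one_left (norm_nonneg _) (hη01 j x).2).trans hx'
    · filter_upwards [ae_restrict_mem measurableSet_ball] with x hx
      refine tendsto_const_nhds.congr' ?_
      filter_upwards [hlarge x (mem_ball_zero_iff.1 hx)] with j hj
      simp [Q, η, ballCutoff, Real.smoothTransition.one_of_one_le hj.le]
  · refine tendsto_eLpNorm_two_of_bounded (C := L + 4 * Cχ * L + L)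
      (fun j => ((hmQ j i).sub (hmq i)).aestronglyMeasurable) (fun j => ?_) ?_
    · filter_upwards [ae_restrict_mem measurableSet_ball] with x hx
      have hx' := (mem_ball_zero_iff.1 hx).le
      exact (norm_sub_le _ _).trans (add_le_add (hQb j i x hx') (hpL i x hx'))
    · filter_upwards [ae_restrict_mem measurableSet_ball] with x hx
      refine tendsto_const_nhds.congr' ?_
      filter_upwards [hlarge x (mem_ball_zero_iff.1 hx)] with j hj
      simp [hpQ, η, ballCutoff, Real.smoothTransition.one_of_one_le hj.le,
        deriv_smoothTransition_of_one_le hj]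

theorem continuous_pderiv {P : Eucl n → Eucl m} (hP : ContDiff ℝ ∞ P) (i : Fin n) :
    Continuous (pderiv P i) :=
  (hP.continuous_fderiv (by simp)).clm_apply continuous_const

theorem continuous_radial {g : Fin n → Eucl n → Eucl m} (hg : ∀ i, Continuous (g i)) :
    Continuous (radial g) := by
  unfold radial
  fun_prop

theorem continuous_coneGrad {p : Eucl n → Eucl m} {g : Fin n → Eucl n → Eucl m}
    (hp : Continuous p) (hg : ∀ i, Continuous (g i)) (i : Fin n) :
    Continuous (coneGrad p g i) := by
  have := continuous_radial hg
  unfold coneGrad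
  fun_prop

theorem exists_bound_fderiv_homog {P : Eucl n → Eucl m} (hP : ContDiff ℝ ∞ P) :
    ∃ L, ∀ x, ‖x‖ ≤ 1 → ‖fderiv ℝ (homog P) x‖ ≤ L := by
  have hd : Differentiable ℝ P := hP.differentiable (by simp)
  choose C hC0 hC using fun i => exists_bound_sphere
    (continuous_coneGrad hP.continuous (continuous_pderiv hP) i)
  refine ⟨∑ i, C i, fun x hx => (opNorm_le_sum _).trans (Finset.sum_le_sum fun i _ => ?_)⟩
  change ‖pderiv (homog P) i x‖ ≤ C i
  rw [pderiv_homog hd]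
  rcases eq_or_ne x 0 with rfl | hx0
  · simpa using hC0 i
  · rw [norm_smul, norm_norm]
    exact (mul_le_of_le_one_left (norm_nonneg _) hx).trans (hC i _ (norm_inv_smul_self hx0))

/-- A smooth function differs from its `2`-homogeneous extension by a `W₀^{1,2}` function. -/
theorem isWeakGradZero_sub_homog {P : Eucl n → Eucl m} (hP : ContDiff ℝ ∞ P) :
    IsWeakGradZero (ball 0 1) (P - homog P) (fun i => pderiv P i - pderiv (homog P) i) := by
  have hd : Differentiable ℝ P := hP.differentiable (by simp)
  obtain ⟨L, hL⟩ := exists_bound_fderiv_homog hP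
  obtain ⟨L', hL'⟩ := (isCompact_closedBall (0 : Eucl n) 1).exists_bound_of_continuousOn
    (hP.continuous_fderiv (by simp)).continuousOn
  have := isWeakGradZero_of_eq_zero_on_sphere (hd.sub (differentiable_homog hd)) (L := L' + L)
    (fun x hx => ?_) (fun x hx => ?_)
  · have e : pderiv (P - homog P) = fun i => pderiv P i - pderiv (homog P) i := by
      ext1 i
      exact pderiv_sub hd (differentiable_homog hd) i
    rwa [e] at this
  · rw [fderiv_sub (hd x) (differentiable_homog hd x)]
    exact (norm_sub_le _ _).trans (add_le_add (hL' x (by simpa using hx)) (hL x hx))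
  · simp [homog, hx]

theorem isWeakGrad_ball_of_contDiff {P : Eucl n → Eucl m} (hP : ContDiff ℝ ∞ P) (a : Eucl n)
    (r : ℝ) : IsWeakGrad (ball a r) P (pderiv P) := by
  have key : ∀ {f : Eucl n → Eucl m}, Continuous f → MemLp f 2 (volume.restrict (ball a r)) :=
    fun {f} hf => by
      have fin : IsFiniteMeasure ((volume : Measure (Eucl n)).restrict (ball a r)) :=
        ⟨by simpa using measure_ball_lt_top⟩
      obtain ⟨C, hC⟩ := (isCompact_closedBall a r).exists_bound_of_continuousOn hf.continuousOn
      refine MemLp.of_bound hf.aestronglyMeasurable C ?_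
      filter_upwards [ae_restrict_mem measurableSet_ball] with x hx
      exact hC x (ball_subset_closedBall hx)
  exact isWeakGrad_of_differentiable (hP.differentiable (by simp)) (key hP.continuous)
    fun i => key (continuous_pderiv hP i)

theorem isWeakGrad_homog {P : Eucl n → Eucl m} (hP : ContDiff ℝ ∞ P) :
    IsWeakGrad (ball 0 1) (homog P) (pderiv (homog P)) := by
  have := (isWeakGrad_ball_of_contDiff hP 0 1).sub (isWeakGradZero_sub_homog hP).toIsWeakGrad
  simpa using this

end CutOff

/-! ### Rescalings and their gradients -/

section Rescale

/-- The gradient of `rescale u x₀ r` in terms of the gradient `G` of `u`. -/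
noncomputable def rescaleGrad (G : Fin n → Eucl n → Eucl m) (x₀ : Eucl n) (r : ℝ) (i : Fin n) :
    Eucl n → Eucl m :=
  fun y => r⁻¹ • G i (x₀ + r • y)

variable {x₀ : Eucl n} {r : ℝ} {u : Eucl n → Eucl m} {G : Fin n → Eucl n → Eucl m}

theorem rescale_eq_comp (hr : r ≠ 0) :
    rescale u x₀ r = (1 / r ^ 2) • (u ∘ affineHomeo x₀ r hr) := rfl

theorem rescaleGrad_eq_comp (hr : r ≠ 0) (i : Fin n) :
    rescaleGrad G x₀ r i = r⁻¹ • (G i ∘ affineHomeo x₀ r hr) := rfl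

theorem pderiv_rescale (hr : r ≠ 0) (hu : Differentiable ℝ u) :
    pderiv (rescale u x₀ r) = rescaleGrad (pderiv u) x₀ r := by
  ext1 i
  rw [rescale_eq_comp hr, pderiv_smul
    (hu.comp ((contDiff_affineHomeo hr).differentiable (by simp))),
    pderiv_comp_affineHomeo hr hu, rescaleGrad_eq_comp hr, smul_smul]
  congr 1
  field_simp

theorem preimage_affineHomeo_ball (hr : 0 < r) :
    affineHomeo x₀ r hr.ne' ⁻¹' ball x₀ r = ball 0 1 := by
  ext y
  simp [dist_eq_norm, norm_smul, abs_of_pos hr, hr]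

theorem IsWeakGrad.rescale (hr : 0 < r) (h : IsWeakGrad (ball x₀ r) u G) :
    IsWeakGrad (ball 0 1) (rescale u x₀ r) (rescaleGrad G x₀ r) := by
  have h1 := (h.comp_affineHomeo (a := x₀) hr.ne').smul (1 / r ^ 2)
  rw [preimage_affineHomeo_ball hr] at h1
  have e : rescaleGrad G x₀ r =
      fun i => (1 / r ^ 2) • r • (G i ∘ affineHomeo x₀ r hr.ne') := by
    ext1 i
    rw [rescaleGrad_eq_comp hr.ne', smul_smul]
    congr 1
    field_simp
  rw [e]
  exact h1

theorem contDiff_rescale (hu : ContDiff ℝ ∞ u) : ContDiff ℝ ∞ (rescale u x₀ r) :=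
  (hu.comp (contDiff_const.add (contDiff_id.const_smul r))).const_smul (1 / r ^ 2)

theorem stronglyMeasurable_rescale (hu : StronglyMeasurable u) :
    StronglyMeasurable (rescale u x₀ r) :=
  (hu.comp_measurable (show Measurable fun y : Eucl n => x₀ + r • y by fun_prop)).const_smul (1 / r ^ 2)

theorem stronglyMeasurable_rescaleGrad (hG : ∀ i, StronglyMeasurable (G i)) (i : Fin n) :
    StronglyMeasurable (rescaleGrad G x₀ r i) :=
  ((hG i).comp_measurable (show Measurable fun y : Eucl n => x₀ + r • y by fun_prop)).const_smul r⁻¹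

end Rescale

/-! ### L² bounds for the gradient of a cone -/

section Cone

variable {p : Eucl n → Eucl m} {g : Fin n → Eucl n → Eucl m}

theorem coneGrad_sub (p p' : Eucl n → Eucl m) (g g' : Fin n → Eucl n → Eucl m) (i : Fin n) :
    coneGrad p g i - coneGrad p' g' i = coneGrad (p - p') (g - g') i := by
  ext1 θ
  simp only [coneGrad, radial, Pi.sub_apply, smul_sub, Finset.sum_sub_distrib]
  abel

theorem norm_radial_le (g : Fin n → Eucl n → Eucl m) {θ : Eucl n} (hθ : ‖θ‖ = 1) :
    ‖radial g θ‖ ≤ ∑ j, ‖g j θ‖ := by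
  refine (norm_sum_le _ _).trans (Finset.sum_le_sum fun j _ => ?_)
  rw [norm_smul]
  exact mul_le_of_le_one_left (norm_nonneg _) (hθ ▸ PiLp.norm_apply_le θ j)

theorem norm_coneGrad_le (p : Eucl n → Eucl m) (g : Fin n → Eucl n → Eucl m) (i : Fin n)
    {θ : Eucl n} (hθ : ‖θ‖ = 1) :
    ‖coneGrad p g i θ‖ ≤ 2 * ‖p θ‖ + (‖g i θ‖ + ∑ j, ‖g j θ‖) := by
  have hθi : ‖θ i‖ ≤ 1 := hθ ▸ PiLp.norm_apply_le θ i
  refine (norm_add_le _ _).trans (add_le_add ?_ ((norm_sub_le _ _).trans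
    (add_le_add le_rfl ?_)))
  · rw [norm_smul, norm_mul, RCLike.norm_ofNat]
    exact mul_le_mul_of_nonneg_right (by linarith) (norm_nonneg _)
  · rw [norm_smul]
    exact (mul_le_of_le_one_left (norm_nonneg _) hθi).trans (norm_radial_le g hθ)

theorem eLpNorm_coneGrad_le (hp : StronglyMeasurable p) (hg : ∀ i, StronglyMeasurable (g i))
    (i : Fin n) :
    eLpNorm (fun θ : sphere (0 : Eucl n) 1 => coneGrad p g i θ) 2 (sphereMeasure n) ≤
      2 * eLpNorm (fun θ : sphere (0 : Eucl n) 1 => p θ) 2 (sphereMeasure n) +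
      (eLpNorm (fun θ : sphere (0 : Eucl n) 1 => g i θ) 2 (sphereMeasure n) +
        ∑ j, eLpNorm (fun θ : sphere (0 : Eucl n) 1 => g j θ) 2 (sphereMeasure n)) := by
  have mg : ∀ j, AEStronglyMeasurable (fun θ : sphere (0 : Eucl n) 1 => ‖g j θ‖)
      (sphereMeasure n) := fun j =>
    ((hg j).comp_measurable measurable_subtype_coe).norm.aestronglyMeasurable
  have mp : AEStronglyMeasurable (fun θ : sphere (0 : Eucl n) 1 => ‖p θ‖) (sphereMeasure n) :=
    (hp.comp_measurable measurable_subtype_coe).norm.aestronglyMeasurable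
  have ms : AEStronglyMeasurable (∑ j, fun θ : sphere (0 : Eucl n) 1 => ‖g j θ‖)
      (sphereMeasure n) := Finset.aestronglyMeasurable_sum _ fun j _ => mg j
  calc _ ≤ eLpNorm ((2 : ℝ) • (fun θ : sphere (0 : Eucl n) 1 => ‖p θ‖) +
        ((fun θ : sphere (0 : Eucl n) 1 => ‖g i θ‖) +
          ∑ j, fun θ : sphere (0 : Eucl n) 1 => ‖g j θ‖)) 2 (sphereMeasure n) := by
        refine eLpNorm_mono_real fun θ => ?_
        have := norm_coneGrad_le p g i (norm_eq_of_mem_sphere θ)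
        simpa [Finset.sum_apply] using this
    _ ≤ _ := by
        refine (eLpNorm_add_le (mp.const_smul _) ((mg i).add ms) one_le_two).trans
          (add_le_add ?_ ((eLpNorm_add_le (mg i) ms one_le_two).trans (add_le_add ?_ ?_)))
        · rw [eLpNorm_const_smul, eLpNorm_norm, Real.enorm_eq_ofReal (by norm_num),
            ENNReal.ofReal_ofNat]
        · rw [eLpNorm_norm]
        · exact (eLpNorm_sum_le (fun j _ => mg j) one_le_two).trans
            (Finset.sum_le_sum fun j _ => (eLpNorm_norm _).le)

theorem stronglyMeasurable_radial (hg : ∀ i, StronglyMeasurable (g i)) :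
    StronglyMeasurable (radial g) := by
  have : ∀ j, StronglyMeasurable fun θ : Eucl n => θ j • g j θ := fun j =>
    (show Measurable fun θ : Eucl n => θ j by fun_prop).stronglyMeasurable.smul (hg j)
  exact Finset.stronglyMeasurable_fun_sum _ fun j _ => this j

theorem stronglyMeasurable_coneGrad (hp : StronglyMeasurable p)
    (hg : ∀ i, StronglyMeasurable (g i)) (i : Fin n) : StronglyMeasurable (coneGrad p g i) := by
  have h2 : StronglyMeasurable fun θ : Eucl n => 2 * θ i :=
    (show Measurable fun θ : Eucl n => 2 * θ i by fun_prop).stronglyMeasurable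
  have h1 : StronglyMeasurable fun θ : Eucl n => θ i :=
    (show Measurable fun θ : Eucl n => θ i by fun_prop).stronglyMeasurable
  exact (h2.smul hp).add ((hg i).sub (h1.smul (stronglyMeasurable_radial hg)))

end Cone

/-! ### Smooth approximation on almost every sphere -/

/-- Smooth approximation of a continuous `W^{1,2}` function on a ball. -/
structure ApproxData (x₀ : Eucl n) (R : ℝ) (u : Eucl n → Eucl m) (G : Fin n → Eucl n → Eucl m)
    (U : ℕ → Eucl n → Eucl m) : Prop where
  pos : 0 < R
  meas : StronglyMeasurable u
  meas_grad : ∀ i, StronglyMeasurable (G i)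
  cont : ContinuousOn u (closedBall x₀ R)
  weak : IsWeakGrad (ball x₀ R) u G
  smooth : ∀ k, ContDiff ℝ ∞ (U k)
  unif : TendstoUniformlyOn U u atTop (closedBall x₀ R)
  lim : ∀ i, Tendsto (fun k => eLpNorm (pderiv (U k) i - G i) 2 (volume.restrict (ball x₀ R)))
    atTop (𝓝 0)

/-- Along a subsequence the squared L² norms on the ball are at most 2^{−j}, hence summable. By
Tonelli the squared slice norms are summable for almost every radius, so they tend to 0. The
exceptional null set of radii is common to all indices i. -/
theorem exists_subseq_slices (hn : 1 ≤ n) {ι : Type*} [Fintype ι] (x₀ : Eucl n) (R : ℝ)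
    {f : ℕ → ι → Eucl n → Eucl m} (hf : ∀ k i, StronglyMeasurable (f k i))
    (hlim : ∀ i, Tendsto (fun k => eLpNorm (f k i) 2 (volume.restrict (ball x₀ R))) atTop (𝓝 0)) :
    ∃ φ : ℕ → ℕ, StrictMono φ ∧ ∀ᵐ t ∂volume.restrict (Ioo 0 R), ∀ i,
      Tendsto (fun j => eLpNorm (fun θ : sphere (0 : Eucl n) 1 => f (φ j) i (x₀ + t • (θ : Eucl n)))
        2 (sphereMeasure n)) atTop (𝓝 0) := by
  have hb : ∀ i, ∀ j : ℕ, ∀ᶠ k in atTop,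
      eLpNorm (f k i) 2 (volume.restrict (ball x₀ R)) ^ 2 ≤ (1 / 2 : ℝ≥0∞) ^ j := fun i j => by
    have h1 := ((ENNReal.continuous_pow 2).tendsto 0).comp (hlim i)
    rw [zero_pow two_ne_zero] at h1
    exact h1.eventually (Iic_mem_nhds (ENNReal.pow_pos (by simp) j))
  obtain ⟨φ, hφ, hφb⟩ := extraction_forall_of_eventually
    (P := fun j k => ∀ i, eLpNorm (f k i) 2 (volume.restrict (ball x₀ R)) ^ 2 ≤
      (1 / 2 : ℝ≥0∞) ^ j) fun j => eventually_all.2 fun i => hb i j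
  refine ⟨φ, hφ, ?_⟩
  rw [ae_all_iff]
  intro i
  have mp := measurePreserving_polarMap hn x₀ (b := R) le_rfl
  have hm : ∀ j, Measurable fun p => ‖f (φ j) i (polarMap x₀ p)‖ₑ ^ 2 := fun j =>
    (((hf (φ j) i).comp_measurable mp.measurable).enorm).pow_const 2
  have key : ∀ j, ∫⁻ t, ∫⁻ θ, ‖f (φ j) i (polarMap x₀ (t, θ))‖ₑ ^ 2 ∂sphereMeasure n
      ∂radialMeasure n 0 R ≤ (1 / 2 : ℝ≥0∞) ^ j := fun j => by
    rw [← lintegral_prod _ (hm j).aemeasurable]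
    refine le_trans (le_of_eq ?_) (hφb j i)
    rw [← Measure.restrict_congr_set (shell_zero_ae_eq hn x₀ R),
      ← eLpNorm_comp_measurePreserving (hf (φ j) i).aestronglyMeasurable mp, eLpNorm_two_sq]
    rfl
  have hsum : ∫⁻ t, ∑' j, ∫⁻ θ, ‖f (φ j) i (polarMap x₀ (t, θ))‖ₑ ^ 2 ∂sphereMeasure n
      ∂radialMeasure n 0 R ≠ ⊤ := by
    rw [lintegral_tsum fun j => (hm j).lintegral_prod_right'.aemeasurable]
    refine ne_top_of_le_ne_top ?_ (ENNReal.tsum_le_tsum key)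
    rw [ENNReal.tsum_geometric]
    simp
  have hae := ae_lt_top' (AEMeasurable.tsum fun j =>
    (hm j).lintegral_prod_right'.aemeasurable) hsum
  filter_upwards [ae_of_ae_radialMeasure le_rfl hae] with t ht
  refine tendsto_zero_of_sq ?_
  simp_rw [eLpNorm_two_sq]
  exact ENNReal.tendsto_atTop_zero_of_tsum_ne_top ht.ne

namespace ApproxData

variable {x₀ : Eucl n} {R r : ℝ} {u : Eucl n → Eucl m} {G : Fin n → Eucl n → Eucl m}
  {U : ℕ → Eucl n → Eucl m}

theorem unif_rescale (h : ApproxData x₀ R u G U) (hr : 0 < r) (hrR : r ≤ R) {ε : ℝ} (hε : 0 < ε) :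
    ∀ᶠ k in atTop, ∀ y : Eucl n, ‖y‖ ≤ 1 → ‖(rescale (U k) x₀ r - rescale u x₀ r) y‖ ≤ ε := by
  have h1 := Metric.tendstoUniformlyOn_iff.1 h.unif (r ^ 2 * ε) (by positivity)
  filter_upwards [h1] with k hk y hy
  have hmem : x₀ + r • y ∈ closedBall x₀ R := by
    rw [mem_closedBall, dist_eq_norm, add_sub_cancel_left, norm_smul, Real.norm_of_nonneg hr.le]
    calc r * ‖y‖ ≤ r * 1 := by gcongr
      _ ≤ R := by linarith
  have h2 := (hk _ hmem).le
  rw [dist_comm, dist_eq_norm] at h2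
  simp only [rescale, Pi.sub_apply, ← smul_sub]
  rw [norm_smul, Real.norm_of_nonneg (by positivity), one_div, inv_mul_le_iff₀ (by positivity)]
  exact h2

theorem tendsto_sphere_rescale (h : ApproxData x₀ R u G U) (hr : 0 < r) (hrR : r ≤ R) :
    Tendsto (fun k => eLpNorm (fun θ : sphere (0 : Eucl n) 1 =>
      (rescale (U k) x₀ r - rescale u x₀ r) θ) 2 (sphereMeasure n)) atTop (𝓝 0) := by
  refine tendsto_eLpNorm_two_of_uniform fun ε hε => ?_
  filter_upwards [h.unif_rescale hr hrR hε] with k hk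
  exact Eventually.of_forall fun θ => hk θ (norm_eq_of_mem_sphere θ).le

theorem tendsto_ball_rescale (h : ApproxData x₀ R u G U) (hr : 0 < r) (hrR : r ≤ R) :
    Tendsto (fun k => eLpNorm (rescale (U k) x₀ r - rescale u x₀ r) 2
      (volume.restrict (ball (0 : Eucl n) 1))) atTop (𝓝 0) := by
  have fin : IsFiniteMeasure ((volume : Measure (Eucl n)).restrict (ball 0 1)) :=
    ⟨by simpa using measure_ball_lt_top⟩
  refine tendsto_eLpNorm_two_of_uniform fun ε hε => ?_
  filter_upwards [h.unif_rescale hr hrR hε] with k hk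
  filter_upwards [ae_restrict_mem measurableSet_ball] with x hx
  exact hk x (mem_ball_zero_iff.1 hx).le

theorem tendsto_ball_rescaleGrad (h : ApproxData x₀ R u G U) (hr : 0 < r) (hrR : r ≤ R)
    (i : Fin n) :
    Tendsto (fun k => eLpNorm (rescaleGrad (pderiv (U k)) x₀ r i - rescaleGrad G x₀ r i) 2
      (volume.restrict (ball (0 : Eucl n) 1))) atTop (𝓝 0) := by
  have h1 : Tendsto (fun k => eLpNorm (pderiv (U k) i - G i) 2 (volume.restrict (ball x₀ r)))
      atTop (𝓝 0) :=
    tendsto_of_tendsto_of_tendsto_of_le_of_le tendsto_const_nhds (h.lim i) (fun _ => zero_le)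
      fun k => eLpNorm_mono_measure _ (Measure.restrict_mono (ball_subset_ball hrR) le_rfl)
  have hc : ENNReal.ofReal |(r ^ n)⁻¹| ^ (1 / (2 : ℝ)) ≠ ⊤ :=
    ENNReal.rpow_ne_top_of_nonneg (by norm_num) ENNReal.ofReal_ne_top
  have e : ∀ k, rescaleGrad (pderiv (U k)) x₀ r i - rescaleGrad G x₀ r i =
      r⁻¹ • ((pderiv (U k) i - G i) ∘ affineHomeo x₀ r hr.ne') := fun k => by
    rw [rescaleGrad_eq_comp hr.ne', rescaleGrad_eq_comp hr.ne', ← smul_sub]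
    rfl
  simp_rw [e, eLpNorm_const_smul, ← preimage_affineHomeo_ball (x₀ := x₀) hr,
    eLpNorm_comp_affineHomeo]
  have := ENNReal.Tendsto.const_mul (ENNReal.Tendsto.const_mul h1 (Or.inr hc))
    (Or.inr (enorm_ne_top (x := r⁻¹)))
  simpa using this

theorem memLp_sphere_rescale (h : ApproxData x₀ R u G U) (hr : 0 < r) (hrR : r ≤ R) :
    MemLp (fun θ : sphere (0 : Eucl n) 1 => rescale u x₀ r θ) 2 (sphereMeasure n) := by
  obtain ⟨C, hC⟩ := (isCompact_closedBall x₀ R).exists_bound_of_continuousOn h.cont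
  refine MemLp.of_bound ((stronglyMeasurable_rescale h.meas).comp_measurable
    measurable_subtype_coe).aestronglyMeasurable (‖1 / r ^ 2‖ * C)
    (Eventually.of_forall fun θ => ?_)
  rw [rescale, norm_smul]
  refine mul_le_mul_of_nonneg_left (hC _ ?_) (norm_nonneg _)
  rw [mem_closedBall, dist_polarMap x₀ hr.le]
  exact hrR

/-- For almost every radius, the gradient is square integrable on the sphere, and the homogeneous
extension of the boundary values has the expected weak gradient. -/
theorem ae_homogExt (hn : 1 ≤ n) (h : ApproxData x₀ R u G U) :
    ∀ᵐ r ∂volume.restrict (Ioo 0 R),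
      (∀ i, MemLp (fun θ : sphere (0 : Eucl n) 1 => rescaleGrad G x₀ r i θ) 2 (sphereMeasure n)) ∧
      IsWeakGrad (ball 0 1) (homogExt u x₀ r) (fun i x => ‖x‖ •
        coneGrad (rescale u x₀ r) (rescaleGrad G x₀ r) i (‖x‖⁻¹ • x)) ∧
      ∃ Z, IsWeakGradZero (ball 0 1) (rescale u x₀ r - homogExt u x₀ r) Z := by
  obtain ⟨φ, hφ, hae⟩ := exists_subseq_slices hn x₀ R
    (f := fun k i => pderiv (U k) i - G i) (fun k i =>
      (continuous_pderiv (h.smooth k) i).stronglyMeasurable.sub (h.meas_grad i)) h.lim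
  filter_upwards [hae, ae_restrict_mem measurableSet_Ioo] with r hr hrm
  have hr0 := hrm.1
  have hrR := hrm.2.le
  set p := rescale u x₀ r
  set g := rescaleGrad G x₀ r
  set P : ℕ → Eucl n → Eucl m := fun k => rescale (U (φ k)) x₀ r
  have hPs : ∀ k, ContDiff ℝ ∞ (P k) := fun k => contDiff_rescale (h.smooth _)
  have hPd : ∀ k, Differentiable ℝ (P k) := fun k => (hPs k).differentiable (by simp)
  have hpm : StronglyMeasurable p := stronglyMeasurable_rescale h.meas
  have hgm : ∀ i, StronglyMeasurable (g i) := stronglyMeasurable_rescaleGrad h.meas_grad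
  have hgP : ∀ k, pderiv (P k) = rescaleGrad (pderiv (U (φ k))) x₀ r := fun k =>
    pderiv_rescale hr0.ne' ((h.smooth _).differentiable (by simp))
  have hgPm : ∀ k i, StronglyMeasurable (pderiv (P k) i) := fun k i =>
    (continuous_pderiv (hPs k) i).stronglyMeasurable
  have t0 : Tendsto (fun k => eLpNorm (fun θ : sphere (0 : Eucl n) 1 => (P k - p) θ) 2
      (sphereMeasure n)) atTop (𝓝 0) :=
    (h.tendsto_sphere_rescale hr0 hrR).comp hφ.tendsto_atTop
  have t1 : ∀ i, Tendsto (fun k => eLpNorm (fun θ : sphere (0 : Eucl n) 1 =>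
      (pderiv (P k) - g) i θ) 2 (sphereMeasure n)) atTop (𝓝 0) := fun i => by
    have e : ∀ k, (fun θ : sphere (0 : Eucl n) 1 => (pderiv (P k) - g) i θ) =
        r⁻¹ • fun θ : sphere (0 : Eucl n) 1 =>
          (pderiv (U (φ k)) i - G i) (x₀ + r • (θ : Eucl n)) := fun k => by
      rw [hgP]
      ext1 θ
      simp [g, rescaleGrad, smul_sub]
    simp_rw [e, eLpNorm_const_smul]
    simpa using ENNReal.Tendsto.const_mul (hr i) (Or.inr (enorm_ne_top (x := r⁻¹)))
  have mP : ∀ k i, MemLp (fun θ : sphere (0 : Eucl n) 1 => pderiv (P k) i θ) 2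
      (sphereMeasure n) := fun k i => by
    obtain ⟨C, -, hC⟩ := exists_bound_sphere (continuous_pderiv (hPs k) i)
    exact MemLp.of_bound ((hgPm k i).comp_measurable measurable_subtype_coe).aestronglyMeasurable
      C (Eventually.of_forall fun θ => hC θ (norm_eq_of_mem_sphere θ))
  -- A slice of G is a bounded slice of the smooth gradient minus a difference whose L² norm is
  -- finite for some k.
  have mg : ∀ i, MemLp (fun θ : sphere (0 : Eucl n) 1 => g i θ) 2 (sphereMeasure n) := fun i => by
    obtain ⟨k, hk⟩ := ((t1 i).eventually (Iio_mem_nhds ENNReal.zero_lt_top)).exists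
    have : MemLp (fun θ : sphere (0 : Eucl n) 1 => (pderiv (P k) - g) i θ) 2 (sphereMeasure n) :=
      ⟨(((hgPm k i).sub (hgm i)).comp_measurable measurable_subtype_coe).aestronglyMeasurable, hk⟩
    have e : (fun θ : sphere (0 : Eucl n) 1 => g i θ) =
        (fun θ : sphere (0 : Eucl n) 1 => pderiv (P k) i θ) -
          fun θ : sphere (0 : Eucl n) 1 => (pderiv (P k) - g) i θ := by
      ext1 θ
      simp
    rw [e]
    exact (mP k i).sub this
  have mp : MemLp (fun θ : sphere (0 : Eucl n) 1 => p θ) 2 (sphereMeasure n) :=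
    h.memLp_sphere_rescale hr0 hrR
  have tc : ∀ i, Tendsto (fun k => eLpNorm (fun θ : sphere (0 : Eucl n) 1 =>
      coneGrad (P k - p) (pderiv (P k) - g) i θ) 2 (sphereMeasure n)) atTop (𝓝 0) := fun i => by
    refine tendsto_of_tendsto_of_tendsto_of_le_of_le tendsto_const_nhds ?_ (fun _ => zero_le)
      fun k => eLpNorm_coneGrad_le ((hPs k).continuous.stronglyMeasurable.sub hpm)
        (fun j => (hgPm k j).sub (hgm j)) i
    have := (ENNReal.Tendsto.const_mul t0 (Or.inr (ENNReal.ofNat_ne_top (n := 2)))).add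
      ((t1 i).add (tendsto_finsetSum Finset.univ fun j _ => t1 j))
    simpa using this
  have hcm : ∀ i, StronglyMeasurable (coneGrad p g i) := stronglyMeasurable_coneGrad hpm hgm
  have l0 : Tendsto (fun k => eLpNorm (homog (P k) - homog p) 2
      (volume.restrict (ball (0 : Eucl n) 1))) atTop (𝓝 0) := by
    refine tendsto_of_tendsto_of_tendsto_of_le_of_le tendsto_const_nhds t0 (fun _ => zero_le)
      fun k => ?_
    refine le_trans (le_of_eq ?_)
      (eLpNorm_cone_le hn 2 ((hPs k).continuous.stronglyMeasurable.sub hpm))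
    congr 1
    ext1 x
    simp [homog, smul_sub]
  have l1 : ∀ i, Tendsto (fun k => eLpNorm (pderiv (homog (P k)) i -
      fun x => ‖x‖ • coneGrad p g i (‖x‖⁻¹ • x)) 2
      (volume.restrict (ball (0 : Eucl n) 1))) atTop (𝓝 0) := fun i => by
    refine tendsto_of_tendsto_of_tendsto_of_le_of_le tendsto_const_nhds (tc i) (fun _ => zero_le)
      fun k => ?_
    refine le_trans (le_of_eq ?_) (eLpNorm_cone_le hn 1 (stronglyMeasurable_coneGrad
      ((hPs k).continuous.stronglyMeasurable.sub hpm) (fun j => (hgPm k j).sub (hgm j)) i))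
    congr 1
    ext1 x
    rw [Pi.sub_apply, pderiv_homog (hPd k), ← coneGrad_sub]
    simp [smul_sub]
  have wc : IsWeakGrad (ball 0 1) (homog p) (fun i x => ‖x‖ • coneGrad p g i (‖x‖⁻¹ • x)) := by
    refine IsWeakGrad.of_tendsto (fun k => isWeakGrad_homog (hPs k)) ?_ (fun i => ?_) l0 l1
    · refine ⟨?_, (eLpNorm_cone_le hn 2 hpm).trans_lt mp.2⟩
      exact ((continuous_norm.pow 2).stronglyMeasurable.smul
        (hpm.comp_measurable (by fun_prop))).aestronglyMeasurable
    · refine ⟨?_, ?_⟩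
      · exact (continuous_norm.stronglyMeasurable.smul
          ((hcm i).comp_measurable (by fun_prop))).aestronglyMeasurable
      · have h1 := eLpNorm_cone_le hn 1 (hcm i)
        simp only [pow_one] at h1
        refine (h1.trans (eLpNorm_coneGrad_le hpm hgm i)).trans_lt ?_
        simp only [ENNReal.add_lt_top, ENNReal.sum_lt_top]
        exact ⟨ENNReal.mul_lt_top (by simp) mp.2, (mg i).2, fun j _ => (mg j).2⟩
  -- Each smooth rescaling differs from its cone by a W₀^{1,2} function. The rescalings converge in
  -- W^{1,2}(B₁) by the choice of U, the cones by convergence of the slices, and W₀^{1,2} is closed.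
  refine ⟨mg, wc, _, isWeakGradZero_of_tendsto (fun k => isWeakGradZero_sub_homog (hPs k))
    (((h.weak.mono (ball_subset_ball hrR)).rescale hr0).sub wc) ?_ fun i => ?_⟩
  · refine tendsto_of_tendsto_of_tendsto_of_le_of_le tendsto_const_nhds
      (by simpa using ((h.tendsto_ball_rescale hr0 hrR).comp hφ.tendsto_atTop).add l0)
      (fun _ => zero_le) fun k => ?_
    rw [homogExt_eq, sub_sub_sub_comm]
    exact eLpNorm_sub_le (((hPs k).continuous.stronglyMeasurable.sub hpm)).aestronglyMeasurable
      ((isWeakGrad_homog (hPs k)).sub wc).memLp.1 one_le_two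
  · refine tendsto_of_tendsto_of_tendsto_of_le_of_le tendsto_const_nhds
      (by simpa using ((h.tendsto_ball_rescaleGrad hr0 hrR i).comp hφ.tendsto_atTop).add (l1 i))
      (fun _ => zero_le) fun k => ?_
    rw [sub_sub_sub_comm, hgP]
    refine eLpNorm_sub_le ?_ (((isWeakGrad_homog (hPs k)).sub wc).memLp_grad i).1 one_le_two
    rw [← hgP]
    exact ((hgPm k i).sub (hgm i)).aestronglyMeasurable

end ApproxData

/-! ### The balanced energy of a cone -/

section Energy

/-- `∫_{∂B₁} |u_r|²`. -/
noncomputable def sphereSq (u : Eucl n → Eucl m) (x₀ : Eucl n) (r : ℝ) : ℝ :=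
  ∫ θ : sphere (0 : Eucl n) 1, ‖rescale u x₀ r θ‖ ^ 2 ∂sphereMeasure n

/-- `∂_ν u_r - 2 u_r`. -/
noncomputable def radialDefect (u : Eucl n → Eucl m) (G : Fin n → Eucl n → Eucl m) (x₀ : Eucl n)
    (r : ℝ) (θ : Eucl n) : Eucl m :=
  radial (rescaleGrad G x₀ r) θ - (2 : ℝ) • rescale u x₀ r θ

/-- `∫_{∂B₁} |∂_ν u_r - 2 u_r|²`. -/
noncomputable def defectSq (u : Eucl n → Eucl m) (G : Fin n → Eucl n → Eucl m) (x₀ : Eucl n)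
    (r : ℝ) : ℝ :=
  ∫ θ : sphere (0 : Eucl n) 1, ‖radialDefect u G x₀ r θ‖ ^ 2 ∂sphereMeasure n

/-- `∫_{∂B₁} (|∇u|² + 2|u|)(x₀ + r θ)`. -/
noncomputable def sphereEnergy (u : Eucl n → Eucl m) (G : Fin n → Eucl n → Eucl m) (x₀ : Eucl n)
    (r : ℝ) : ℝ :=
  ∫ θ : sphere (0 : Eucl n) 1, ((∑ i, ‖G i (x₀ + r • (θ : Eucl n))‖ ^ 2) +
    2 * ‖u (x₀ + r • (θ : Eucl n))‖) ∂sphereMeasure n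

theorem sphereIntegral_zero_one (g : Eucl n → ℝ) :
    sphereIntegral 0 1 g = ∫ θ : sphere (0 : Eucl n) 1, g θ ∂sphereMeasure n := by
  simp [sphereIntegral]

theorem memLp_inner_integrable {α : Type*} [MeasurableSpace α] {μ : Measure α} {f g : α → Eucl m}
    (hf : MemLp f 2 μ) (hg : MemLp g 2 μ) : Integrable (fun x => inner ℝ (f x) (g x)) μ := by
  refine (MemLp.integrable_mul hf.norm hg.norm).mono' (hf.1.inner hg.1)
    (Eventually.of_forall fun x => ?_)
  exact norm_inner_le_norm (f x) (g x)

theorem integrable_norm_sq_of_memLp {α : Type*} [MeasurableSpace α] {μ : Measure α}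
    {f : α → Eucl m} (hf : MemLp f 2 μ) : Integrable (fun x => ‖f x‖ ^ 2) μ :=
  (memLp_two_iff_integrable_sq_norm hf.1).1 hf

theorem memLp_sphere_radial {g : Fin n → Eucl n → Eucl m} (hgm : ∀ i, StronglyMeasurable (g i))
    (hg : ∀ i, MemLp (fun θ : sphere (0 : Eucl n) 1 => g i θ) 2 (sphereMeasure n)) :
    MemLp (fun θ : sphere (0 : Eucl n) 1 => radial g θ) 2 (sphereMeasure n) := by
  have : MemLp (fun θ : sphere (0 : Eucl n) 1 => ∑ j, ‖g j θ‖) 2 (sphereMeasure n) :=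
    memLp_finsetSum _ fun j _ => (hg j).norm
  refine this.mono' ((stronglyMeasurable_radial hgm).comp_measurable
    measurable_subtype_coe).aestronglyMeasurable (Eventually.of_forall fun θ => ?_)
  exact norm_radial_le g (norm_eq_of_mem_sphere θ)

/-- The bulk energy is 1/(n+2) times an integral over ∂B₁. With Z = ∂_ν p − 2p the term 4|p|² − |∂_ν
p|² of the cone gradient becomes −4 p·Z − |Z|²: the first half is matched by the derivative of the
boundary term of W, the second is the defect. -/
theorem balancedEnergy_homog (hn : 1 ≤ n) {p : Eucl n → Eucl m} {g : Fin n → Eucl n → Eucl m}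
    (hpm : StronglyMeasurable p) (hgm : ∀ i, StronglyMeasurable (g i))
    (hp : MemLp (fun θ : sphere (0 : Eucl n) 1 => p θ) 2 (sphereMeasure n))
    (hg : ∀ i, MemLp (fun θ : sphere (0 : Eucl n) 1 => g i θ) 2 (sphereMeasure n))
    (hw : IsWeakGrad (ball 0 1) (homog p) (fun i x => ‖x‖ • coneGrad p g i (‖x‖⁻¹ • x))) :
    ((n : ℝ) + 2) * balancedEnergy (homog p) =
      ∫ θ : sphere (0 : Eucl n) 1, ((∑ i, ‖g i θ‖ ^ 2) + 2 * ‖p θ‖) ∂sphereMeasure n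
      - 2 * ((n : ℝ) + 2) * ∫ θ : sphere (0 : Eucl n) 1, ‖p θ‖ ^ 2 ∂sphereMeasure n
      - 4 * ∫ θ : sphere (0 : Eucl n) 1, inner ℝ (p θ) (radial g θ - (2 : ℝ) • p θ) ∂sphereMeasure n
      - ∫ θ : sphere (0 : Eucl n) 1, ‖radial g θ - (2 : ℝ) • p θ‖ ^ 2 ∂sphereMeasure n := by
  have hn2 : (n : ℝ) + 2 ≠ 0 := by positivity
  have hρ := memLp_sphere_radial hgm hg
  have hZ : MemLp (fun θ : sphere (0 : Eucl n) 1 => radial g θ - (2 : ℝ) • p θ) 2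
      (sphereMeasure n) := hρ.sub (hp.const_smul (2 : ℝ))
  have hcm := stronglyMeasurable_coneGrad hpm hgm
  have e1 : energy (ball 0 1) (homog p) = 1 / ((n : ℝ) + (2 : ℕ)) *
      ∫ θ : sphere (0 : Eucl n) 1, ((∑ i, ‖coneGrad p g i θ‖ ^ 2) + 2 * ‖p θ‖)
        ∂sphereMeasure n := by
    rw [energy_eq isOpen_ball hw, ← integral_pow_mul_cone hn 2
      (h := fun θ => (∑ i, ‖coneGrad p g i θ‖ ^ 2) + 2 * ‖p θ‖)]
    · congr 1
      ext1 x
      simp only [homog, norm_smul, norm_norm, norm_pow, mul_pow, ← Finset.mul_sum]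
      ring
    · exact (Finset.measurable_sum _ fun i _ => ((hcm i).measurable.norm.pow_const 2)).add
        (hpm.measurable.norm.const_mul 2)
  have e2 : sphereIntegral 0 1 (fun x => ‖homog p x‖ ^ 2) =
      ∫ θ : sphere (0 : Eucl n) 1, ‖p θ‖ ^ 2 ∂sphereMeasure n := by
    rw [sphereIntegral_zero_one]
    congr 1
    ext1 θ
    simp [homog]
  have i1 : Integrable (fun θ : sphere (0 : Eucl n) 1 => (∑ i, ‖g i θ‖ ^ 2) + 2 * ‖p θ‖)
      (sphereMeasure n) :=
    (integrable_finsetSum _ fun i _ => integrable_norm_sq_of_memLp (hg i)).add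
      ((hp.integrable one_le_two).norm.const_mul 2)
  have i2 : Integrable (fun θ : sphere (0 : Eucl n) 1 =>
      4 * inner ℝ (p θ) (radial g θ - (2 : ℝ) • p θ)) (sphereMeasure n) :=
    (memLp_inner_integrable hp hZ).const_mul 4
  have i3 : Integrable (fun θ : sphere (0 : Eucl n) 1 => ‖radial g θ - (2 : ℝ) • p θ‖ ^ 2)
      (sphereMeasure n) := integrable_norm_sq_of_memLp hZ
  have e3 : ∫ θ : sphere (0 : Eucl n) 1, ((∑ i, ‖coneGrad p g i θ‖ ^ 2) + 2 * ‖p θ‖)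
        ∂sphereMeasure n =
      ∫ θ : sphere (0 : Eucl n) 1, ((∑ i, ‖g i θ‖ ^ 2) + 2 * ‖p θ‖) ∂sphereMeasure n
      - 4 * ∫ θ : sphere (0 : Eucl n) 1, inner ℝ (p θ) (radial g θ - (2 : ℝ) • p θ) ∂sphereMeasure n
      - ∫ θ : sphere (0 : Eucl n) 1, ‖radial g θ - (2 : ℝ) • p θ‖ ^ 2 ∂sphereMeasure n := by
    rw [← integral_const_mul, ← integral_sub i1 i2]
    refine Eq.trans ?_ (integral_sub (i1.sub i2) i3)
    congr 1
    ext1 θ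
    rw [sum_norm_sq_coneGrad p g (norm_eq_of_mem_sphere θ)]
    rw [norm_sub_sq_real, inner_sub_right, real_inner_smul_right, real_inner_smul_right,
      real_inner_self_eq_norm_sq, norm_smul, mul_pow, real_inner_comm, RCLike.norm_ofNat]
    ring
  rw [balancedEnergy, e1, e2, e3, Nat.cast_ofNat]
  field_simp
  ring

end Energy

/-! ### The derivative of the rescalings in the radius -/

section RadialDerivative

/-- The derivative of `r ↦ u_r(θ)`. -/
noncomputable def radialDeriv (u : Eucl n → Eucl m) (G : Fin n → Eucl n → Eucl m) (x₀ : Eucl n)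
    (p : ℝ × sphere (0 : Eucl n) 1) : Eucl m :=
  p.1⁻¹ • radialDefect u G x₀ p.1 p.2

/-- `(r, θ) ↦ u_r(θ)`. -/
noncomputable def polarRescale (u : Eucl n → Eucl m) (x₀ : Eucl n)
    (p : ℝ × sphere (0 : Eucl n) 1) : Eucl m :=
  rescale u x₀ p.1 p.2

theorem fderiv_apply_eq_sum (P : Eucl n → Eucl m) (y θ : Eucl n) :
    fderiv ℝ P y θ = ∑ j, θ j • pderiv P j y := by
  have h : θ = ∑ j, θ j • EuclideanSpace.single j (1 : ℝ) := by
    ext i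
    simp [Finset.sum_apply, Pi.single_apply]
  calc fderiv ℝ P y θ = fderiv ℝ P y (∑ j, θ j • EuclideanSpace.single j (1 : ℝ)) := by rw [← h]
    _ = _ := by
      rw [map_sum]
      simp [pderiv]

/-- Differentiating t⁻² P(x₀ + tθ) gives t⁻¹(∂_ν u_t − 2u_t) with u_t the rescaling of P: the defect
in the monotonicity formula is exactly the speed of the rescalings. -/
theorem hasDerivAt_polarRescale {P : Eucl n → Eucl m} (hP : Differentiable ℝ P) (x₀ : Eucl n)
    (θ : sphere (0 : Eucl n) 1) {t : ℝ} (ht : t ≠ 0) :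
    HasDerivAt (fun t => polarRescale P x₀ (t, θ)) (radialDeriv P (pderiv P) x₀ (t, θ)) t := by
  have h1 : HasDerivAt (fun t : ℝ => x₀ + t • (θ : Eucl n)) (θ : Eucl n) t := by
    simpa using ((hasDerivAt_id t).smul_const (θ : Eucl n)).const_add x₀
  have h2 := (hP (x₀ + t • (θ : Eucl n))).hasFDerivAt.comp_hasDerivAt t h1
  have h3 : HasDerivAt (fun t : ℝ => 1 / t ^ 2) (-2 / t ^ 3) t := by
    have := ((hasDerivAt_id t).pow 2).inv (pow_ne_zero 2 ht)
    simp only [one_div]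
    refine HasDerivAt.congr_deriv this ?_
    simp only [id]
    field_simp
    norm_num
    ring
  have h4 := h3.smul h2
  refine HasDerivAt.congr_deriv h4 ?_
  simp only [radialDeriv, radialDefect, radial, rescaleGrad, rescale, fderiv_apply_eq_sum,
    Function.comp_apply, smul_sub, Finset.smul_sum, smul_smul]
  rw [sub_eq_add_neg, add_comm, ← neg_smul, add_comm]
  congr 1
  · refine Finset.sum_congr rfl fun j _ => ?_
    congr 1
    field_simp
  · congr 1
    field_simp

theorem continuousOn_polarRescale {P : Eucl n → Eucl m} (hP : Continuous P) (x₀ : Eucl n)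
    (θ : sphere (0 : Eucl n) 1) {a b : ℝ} (ha : 0 < a) :
    ContinuousOn (fun t => polarRescale P x₀ (t, θ)) (Icc a b) := by
  have h1 : ContinuousOn (fun t : ℝ => 1 / t ^ 2) (Icc a b) :=
    continuousOn_const.div (by fun_prop) fun t ht => pow_ne_zero 2 (ha.trans_le ht.1).ne'
  exact h1.smul (hP.comp
    (by fun_prop : Continuous fun t : ℝ => x₀ + t • (θ : Eucl n))).continuousOn

theorem continuousOn_radialDeriv {P : Eucl n → Eucl m} (hP : ContDiff ℝ ∞ P) (x₀ : Eucl n)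
    (θ : sphere (0 : Eucl n) 1) {a b : ℝ} (ha : 0 < a) :
    ContinuousOn (fun t => radialDeriv P (pderiv P) x₀ (t, θ)) (Icc a b) := by
  have hinv : ContinuousOn (fun t : ℝ => t⁻¹) (Icc a b) :=
    continuousOn_id.inv₀ fun t ht => (ha.trans_le ht.1).ne'
  have hp := continuous_pderiv hP
  have hg : ∀ j, ContinuousOn (fun t : ℝ => (θ : Eucl n) j • t⁻¹ •
      pderiv P j (x₀ + t • (θ : Eucl n))) (Icc a b) := fun j => by
    have h1 : Continuous fun t : ℝ => pderiv P j (x₀ + t • (θ : Eucl n)) :=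
      (hp j).comp (by fun_prop)
    exact (hinv.smul h1.continuousOn).const_smul ((θ : Eucl n) j)
  unfold radialDeriv radialDefect radial rescaleGrad
  refine hinv.smul (ContinuousOn.sub ?_ ((continuousOn_polarRescale hP.continuous x₀ θ
    ha).const_smul (2 : ℝ)))
  exact continuousOn_finsetSum _ fun j _ => hg j

theorem stronglyMeasurable_polarRescale {u : Eucl n → Eucl m} (hu : StronglyMeasurable u)
    (x₀ : Eucl n) : StronglyMeasurable (polarRescale u x₀) := by
  have h1 : StronglyMeasurable fun p : ℝ × sphere (0 : Eucl n) 1 => 1 / p.1 ^ 2 :=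
    (show Measurable fun p : ℝ × sphere (0 : Eucl n) 1 => 1 / p.1 ^ 2 by
      fun_prop).stronglyMeasurable
  exact h1.smul (hu.comp_measurable (continuous_polarMap x₀).measurable)

theorem stronglyMeasurable_radialDeriv {u : Eucl n → Eucl m} {G : Fin n → Eucl n → Eucl m}
    (hu : StronglyMeasurable u) (hG : ∀ i, StronglyMeasurable (G i)) (x₀ : Eucl n) :
    StronglyMeasurable (radialDeriv u G x₀) := by
  have h1 : StronglyMeasurable fun p : ℝ × sphere (0 : Eucl n) 1 => p.1⁻¹ :=
    (show Measurable fun p : ℝ × sphere (0 : Eucl n) 1 => p.1⁻¹ by fun_prop).stronglyMeasurable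
  have h2 : ∀ j, StronglyMeasurable fun p : ℝ × sphere (0 : Eucl n) 1 => (p.2 : Eucl n) j :=
    fun j => (show Measurable fun p : ℝ × sphere (0 : Eucl n) 1 => (p.2 : Eucl n) j by
      fun_prop).stronglyMeasurable
  refine h1.smul (StronglyMeasurable.sub ?_
    ((stronglyMeasurable_polarRescale hu x₀).const_smul (2 : ℝ)))
  exact Finset.stronglyMeasurable_fun_sum _ fun j _ =>
    (h2 j).smul (h1.smul ((hG j).comp_measurable (continuous_polarMap x₀).measurable))

theorem norm_radialDeriv_le (u : Eucl n → Eucl m) (G : Fin n → Eucl n → Eucl m) (x₀ : Eucl n)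
    {a : ℝ} (ha : 0 < a) {p : ℝ × sphere (0 : Eucl n) 1} (hp : a ≤ p.1) :
    ‖radialDeriv u G x₀ p‖ ≤
      a⁻¹ * (a⁻¹ * (∑ j, ‖(G j ∘ polarMap x₀) p‖) + 2 * ‖polarRescale u x₀ p‖) := by
  have h1 : ‖p.1⁻¹‖ ≤ a⁻¹ := by
    rw [norm_inv, Real.norm_of_nonneg (ha.le.trans hp)]
    exact inv_anti₀ ha hp
  rw [radialDeriv, norm_smul]
  refine mul_le_mul h1 ((norm_sub_le _ _).trans (add_le_add ?_ ?_)) (norm_nonneg _) (by positivity)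
  · refine (norm_radial_le _ (norm_eq_of_mem_sphere p.2)).trans ?_
    rw [Finset.mul_sum]
    refine Finset.sum_le_sum fun j _ => ?_
    rw [rescaleGrad, norm_smul]
    exact mul_le_mul_of_nonneg_right h1 (norm_nonneg _)
  · rw [norm_smul, RCLike.norm_ofNat]
    rfl

/-- The measure `dt ⊗ dℋⁿ⁻¹` on `(a, b) × ∂B₁`. -/
noncomputable abbrev cylinderMeasure (n : ℕ) (a b : ℝ) : Measure (ℝ × sphere (0 : Eucl n) 1) :=
  (volume.restrict (Ioo a b)).prod (sphereMeasure n)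

theorem ae_cylinderMeasure_mem (n : ℕ) (a b : ℝ) : ∀ᵐ p ∂cylinderMeasure n a b, p.1 ∈ Ioo a b :=
  Measure.quasiMeasurePreserving_fst.ae (ae_restrict_mem measurableSet_Ioo)

theorem eLpNorm_radialDeriv_le {u : Eucl n → Eucl m} {G : Fin n → Eucl n → Eucl m}
    (hu : StronglyMeasurable u) (hG : ∀ i, StronglyMeasurable (G i)) (x₀ : Eucl n) {a b : ℝ}
    (ha : 0 < a) :
    eLpNorm (radialDeriv u G x₀) 2 (cylinderMeasure n a b) ≤
      ‖a⁻¹‖ₑ * (‖a⁻¹‖ₑ * (∑ j, eLpNorm (G j ∘ polarMap x₀) 2 (cylinderMeasure n a b)) +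
        2 * eLpNorm (polarRescale u x₀) 2 (cylinderMeasure n a b)) := by
  set μ := cylinderMeasure n a b
  have mg : ∀ j, AEStronglyMeasurable (fun p => ‖(G j ∘ polarMap x₀) p‖) μ := fun j =>
    ((hG j).comp_measurable (continuous_polarMap x₀).measurable).norm.aestronglyMeasurable
  have mp : AEStronglyMeasurable (fun p => ‖polarRescale u x₀ p‖) μ :=
    (stronglyMeasurable_polarRescale hu x₀).norm.aestronglyMeasurable
  have ms : AEStronglyMeasurable (∑ j, fun p => ‖(G j ∘ polarMap x₀) p‖) μ :=
    Finset.aestronglyMeasurable_sum _ fun j _ => mg j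
  calc _ ≤ eLpNorm (a⁻¹ • (a⁻¹ • (∑ j, fun p => ‖(G j ∘ polarMap x₀) p‖) +
        (2 : ℝ) • fun p => ‖polarRescale u x₀ p‖)) 2 μ := by
        refine eLpNorm_mono_ae_real ?_
        filter_upwards [ae_cylinderMeasure_mem n a b] with p hp
        have := norm_radialDeriv_le u G x₀ ha hp.1.le
        simpa [Finset.sum_apply] using this
    _ ≤ _ := by
        rw [eLpNorm_const_smul]
        refine mul_le_mul_right ((eLpNorm_add_le (ms.const_smul _) (mp.const_smul _)
          one_le_two).trans (add_le_add ?_ ?_)) _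
        · rw [eLpNorm_const_smul]
          exact mul_le_mul_right ((eLpNorm_sum_le (fun j _ => mg j) one_le_two).trans
            (Finset.sum_le_sum fun j _ => (eLpNorm_norm _).le)) _
        · rw [eLpNorm_const_smul, eLpNorm_norm, Real.enorm_eq_ofReal (by norm_num),
            ENNReal.ofReal_ofNat]

theorem radialDeriv_sub (u v : Eucl n → Eucl m) (G H : Fin n → Eucl n → Eucl m) (x₀ : Eucl n) :
    radialDeriv u G x₀ - radialDeriv v H x₀ = radialDeriv (u - v) (G - H) x₀ := by
  ext1 p
  simp only [radialDeriv, radialDefect, radial, rescaleGrad, rescale, Pi.sub_apply, smul_sub,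
    Finset.sum_sub_distrib]
  abel

theorem polarRescale_sub (u v : Eucl n → Eucl m) (x₀ : Eucl n) :
    polarRescale u x₀ - polarRescale v x₀ = polarRescale (u - v) x₀ := by
  ext1 p
  simp [polarRescale, rescale, smul_sub]

end RadialDerivative

/-! ### Radial increments: smooth case and passage to the limit -/

/-- With a constant approximating sequence, integrability statements proved for u apply to every
smooth approximant as well. -/
theorem approxData_of_contDiff {P : Eucl n → Eucl m} (hP : ContDiff ℝ ∞ P) (x₀ : Eucl n) {R : ℝ}
    (hR : 0 < R) : ApproxData x₀ R P (pderiv P) fun _ => P where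
  pos := hR
  meas := hP.continuous.stronglyMeasurable
  meas_grad i := (continuous_pderiv hP i).stronglyMeasurable
  cont := hP.continuous.continuousOn
  weak := isWeakGrad_ball_of_contDiff hP x₀ R
  smooth _ := hP
  unif := Metric.tendstoUniformlyOn_iff.2 fun ε hε => by simp [hε]
  lim i := by simp

theorem sphereSq_sub_of_contDiff {P : Eucl n → Eucl m} (hP : ContDiff ℝ ∞ P) (x₀ : Eucl n)
    {a b : ℝ} (ha : 0 < a) (hab : a ≤ b) (θ : sphere (0 : Eucl n) 1) :
    ‖rescale P x₀ b θ‖ ^ 2 - ‖rescale P x₀ a θ‖ ^ 2 =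
      ∫ t in Ioo a b, 2 * inner ℝ (polarRescale P x₀ (t, θ)) (radialDeriv P (pderiv P) x₀ (t, θ)) := by
  have hd := hP.differentiable (by simp)
  have hc := (continuousOn_polarRescale hP.continuous x₀ θ ha (b := b))
  have hc' := (continuousOn_radialDeriv hP x₀ θ ha (b := b))
  rw [← integral_Ioc_eq_integral_Ioo, ← intervalIntegral.integral_of_le hab]
  refine (intervalIntegral.integral_eq_sub_of_hasDerivAt_of_le hab (hc.norm.pow 2)
    (fun t ht => (hasDerivAt_polarRescale hd x₀ θ (ha.trans ht.1).ne').norm_sq)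
    (ContinuousOn.intervalIntegrable ?_)).symm
  rw [uIcc_of_le hab]
  exact (hc.inner hc').const_mul 2

/-- The Cauchy–Schwarz inequality in t for the vector-valued increment v, obtained by integrating
the inner product of v with the radial derivative. -/
theorem norm_rescale_sub_sq_le {P : Eucl n → Eucl m} (hP : ContDiff ℝ ∞ P) (x₀ : Eucl n)
    {a b : ℝ} (ha : 0 < a) (hab : a ≤ b) (θ : sphere (0 : Eucl n) 1) :
    ‖rescale P x₀ b θ - rescale P x₀ a θ‖ ^ 2 ≤
      (b - a) * ∫ t in Ioo a b, ‖radialDeriv P (pderiv P) x₀ (t, θ)‖ ^ 2 := by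
  have hd := hP.differentiable (by simp)
  have hc := (continuousOn_polarRescale hP.continuous x₀ θ ha (b := b))
  have hc' := (continuousOn_radialDeriv hP x₀ θ ha (b := b))
  rcases hab.eq_or_lt with rfl | hlt
  · simp
  rw [← integral_Ioc_eq_integral_Ioo, ← intervalIntegral.integral_of_le hab]
  set v := rescale P x₀ b θ - rescale P x₀ a θ with hv
  have hi : IntervalIntegrable (fun t => ‖radialDeriv P (pderiv P) x₀ (t, θ)‖ ^ 2) volume a b :=
    ContinuousOn.intervalIntegrable (by rw [uIcc_of_le hab]; exact hc'.norm.pow 2)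
  have hi' : IntervalIntegrable (fun t => inner ℝ v (radialDeriv P (pderiv P) x₀ (t, θ)))
      volume a b :=
    ContinuousOn.intervalIntegrable (by rw [uIcc_of_le hab]; exact continuousOn_const.inner hc')
  have h1 : ∫ t in a..b, inner ℝ v (radialDeriv P (pderiv P) x₀ (t, θ)) = ‖v‖ ^ 2 := by
    rw [intervalIntegral.integral_eq_sub_of_hasDerivAt_of_le hab (continuousOn_const.inner hc)
      (fun t ht => ?_) hi']
    · rw [← inner_sub_right]
      exact real_inner_self_eq_norm_sq v
    · refine ((hasDerivAt_const t v).inner ℝ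
        (hasDerivAt_polarRescale hd x₀ θ (ha.trans ht.1).ne')).congr_deriv ?_
      simp
  have hba : 0 < b - a := sub_pos.2 hlt
  -- The weight in Young's inequality is chosen so that the constant term integrates to |v|²/2,
  -- which is absorbed by the left side.
  have h2 : ‖v‖ ^ 2 ≤ ∫ t in a..b, (‖v‖ ^ 2 / (2 * (b - a)) +
      (b - a) / 2 * ‖radialDeriv P (pderiv P) x₀ (t, θ)‖ ^ 2) := by
    refine h1.symm.le.trans (intervalIntegral.integral_mono_on hab hi'
      (intervalIntegrable_const.add (hi.const_mul _)) fun t _ => ?_)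
    refine (real_inner_le_norm _ _).trans ?_
    rw [div_add' _ _ _ (by positivity), le_div_iff₀ (by positivity)]
    nlinarith [sq_nonneg (‖v‖ - (b - a) * ‖radialDeriv P (pderiv P) x₀ (t, θ)‖)]
  rw [intervalIntegral.integral_add intervalIntegrable_const (hi.const_mul _),
    intervalIntegral.integral_const, intervalIntegral.integral_const_mul, smul_eq_mul] at h2
  have h3 : (b - a) * (‖v‖ ^ 2 / (2 * (b - a))) = ‖v‖ ^ 2 / 2 := by
    field_simp
  linarith

namespace ApproxData

variable {x₀ : Eucl n} {R r a b : ℝ} {u : Eucl n → Eucl m} {G : Fin n → Eucl n → Eucl m}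
  {U : ℕ → Eucl n → Eucl m}

theorem mem_closedBall_polar (hr : 0 ≤ r) (hrR : r ≤ R) (θ : sphere (0 : Eucl n) 1) :
    x₀ + r • (θ : Eucl n) ∈ closedBall x₀ R := by
  rwa [mem_closedBall, dist_polarMap x₀ hr]

theorem tendsto_polarRescale (h : ApproxData x₀ R u G U) (ha : 0 < a) (hb : b ≤ R) :
    Tendsto (fun k => eLpNorm (polarRescale (U k) x₀ - polarRescale u x₀) 2
      (cylinderMeasure n a b)) atTop (𝓝 0) := by
  refine tendsto_eLpNorm_two_of_uniform fun ε hε => ?_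
  filter_upwards [Metric.tendstoUniformlyOn_iff.1 h.unif (a ^ 2 * ε) (by positivity)] with k hk
  filter_upwards [ae_cylinderMeasure_mem n a b] with p hp
  have hp0 := ha.trans hp.1
  have h2 := (hk _ (mem_closedBall_polar hp0.le (hp.2.le.trans hb) p.2)).le
  rw [dist_comm, dist_eq_norm] at h2
  simp only [polarRescale, rescale, Pi.sub_apply, ← smul_sub]
  rw [norm_smul, Real.norm_of_nonneg (by positivity), one_div, inv_mul_le_iff₀ (by positivity)]
  refine h2.trans (mul_le_mul_of_nonneg_right ?_ hε.le)
  exact pow_le_pow_left₀ ha.le hp.1.le 2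

theorem memLp_polarRescale (h : ApproxData x₀ R u G U) (ha : 0 < a) (hb : b ≤ R) :
    MemLp (polarRescale u x₀) 2 (cylinderMeasure n a b) := by
  obtain ⟨C, hC⟩ := (isCompact_closedBall x₀ R).exists_bound_of_continuousOn h.cont
  refine MemLp.of_bound (stronglyMeasurable_polarRescale h.meas x₀).aestronglyMeasurable
    (1 / a ^ 2 * C) ?_
  filter_upwards [ae_cylinderMeasure_mem n a b] with p hp
  have hp0 := ha.trans hp.1
  rw [polarRescale, rescale, norm_smul, Real.norm_of_nonneg (by positivity)]
  refine mul_le_mul ?_ (hC _ (mem_closedBall_polar hp0.le (hp.2.le.trans hb) p.2))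
    (norm_nonneg _) (by positivity)
  exact one_div_le_one_div_of_le (by positivity) (pow_le_pow_left₀ ha.le hp.1.le 2)

theorem shell_subset_ball (hb : b ≤ R) : shell x₀ a b ⊆ ball x₀ R :=
  fun _ hx => hx.2.trans_le hb

theorem memLp_radialDeriv (hn : 1 ≤ n) (h : ApproxData x₀ R u G U) (ha : 0 < a) (hb : b ≤ R) :
    MemLp (radialDeriv u G x₀) 2 (cylinderMeasure n a b) := by
  refine ⟨(stronglyMeasurable_radialDeriv h.meas h.meas_grad x₀).aestronglyMeasurable, ?_⟩
  obtain ⟨C, hC, hCf⟩ := exists_eLpNorm_polar_le (m := m) hn x₀ (b := b) ha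
  refine (eLpNorm_radialDeriv_le h.meas h.meas_grad x₀ ha).trans_lt ?_
  refine ENNReal.mul_lt_top enorm_lt_top (ENNReal.add_lt_top.2
    ⟨ENNReal.mul_lt_top enorm_lt_top (ENNReal.sum_lt_top.2 fun j _ => ?_),
      ENNReal.mul_lt_top (by simp) (h.memLp_polarRescale ha hb).2⟩)
  refine (hCf (G j) (h.meas_grad j).aestronglyMeasurable).2.trans_lt
    (ENNReal.mul_lt_top hC.lt_top ?_)
  exact ((h.weak.memLp_grad j).mono_measure
    (Measure.restrict_mono (shell_subset_ball hb) le_rfl)).2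

theorem tendsto_radialDeriv (hn : 1 ≤ n) (h : ApproxData x₀ R u G U) (ha : 0 < a) (hb : b ≤ R) :
    Tendsto (fun k => eLpNorm (radialDeriv (U k) (pderiv (U k)) x₀ - radialDeriv u G x₀) 2
      (cylinderMeasure n a b)) atTop (𝓝 0) := by
  obtain ⟨C, hC, hCf⟩ := exists_eLpNorm_polar_le (m := m) hn x₀ (b := b) ha
  have hm : ∀ k j, StronglyMeasurable ((pderiv (U k) - G) j) := fun k j =>
    (continuous_pderiv (h.smooth k) j).stronglyMeasurable.sub (h.meas_grad j)
  have t1 : ∀ j, Tendsto (fun k => eLpNorm ((pderiv (U k) - G) j ∘ polarMap x₀) 2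
      (cylinderMeasure n a b)) atTop (𝓝 0) := fun j => by
    have l1 : Tendsto (fun k => C * eLpNorm (pderiv (U k) j - G j) 2
        (volume.restrict (ball x₀ R))) atTop (𝓝 0) := by
      simpa using ENNReal.Tendsto.const_mul (h.lim j) (Or.inr hC)
    refine tendsto_of_tendsto_of_tendsto_of_le_of_le tendsto_const_nhds l1 (fun _ => zero_le)
      fun k => (hCf _ (hm k j).aestronglyMeasurable).2.trans (mul_le_mul_right ?_ _)
    exact eLpNorm_mono_measure _ (Measure.restrict_mono (shell_subset_ball hb) le_rfl)
  have t2 := h.tendsto_polarRescale ha hb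
  have hf : ∀ c : ℝ, Or ((0 : ℝ≥0∞) ≠ 0) (‖c‖ₑ ≠ ⊤) := fun c => Or.inr enorm_ne_top
  have l2 := ENNReal.Tendsto.const_mul ((ENNReal.Tendsto.const_mul
    (tendsto_finsetSum Finset.univ fun j _ => t1 j) (by simp : _ ∨ ‖a⁻¹‖ₑ ≠ ⊤)).add
      (ENNReal.Tendsto.const_mul t2 (by simp : _ ∨ (2 : ℝ≥0∞) ≠ ⊤))) (by simp : _ ∨ ‖a⁻¹‖ₑ ≠ ⊤)
  simp only [Finset.sum_const_zero, mul_zero, add_zero] at l2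
  refine tendsto_of_tendsto_of_tendsto_of_le_of_le tendsto_const_nhds l2 (fun _ => zero_le)
    fun k => ?_
  simp only [radialDeriv_sub, polarRescale_sub]
  exact eLpNorm_radialDeriv_le ((h.smooth k).continuous.stronglyMeasurable.sub h.meas) (hm k) x₀ ha

theorem tendsto_sphereSq (h : ApproxData x₀ R u G U) (hr : 0 < r) (hrR : r ≤ R) :
    Tendsto (fun k => sphereSq (U k) x₀ r) atTop (𝓝 (sphereSq u x₀ r)) := by
  have hk : ∀ k, MemLp (fun θ : sphere (0 : Eucl n) 1 => rescale (U k) x₀ r θ) 2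
      (sphereMeasure n) := fun k =>
    (approxData_of_contDiff (h.smooth k) x₀ h.pos).memLp_sphere_rescale hr hrR
  have := tendsto_integral_inner_of_eLpNorm hk (h.memLp_sphere_rescale hr hrR) hk
    (h.memLp_sphere_rescale hr hrR) (h.tendsto_sphere_rescale hr hrR)
    (h.tendsto_sphere_rescale hr hrR)
  simp only [real_inner_self_eq_norm_sq] at this
  exact this

theorem integrable_inner_radialDeriv (hn : 1 ≤ n) (h : ApproxData x₀ R u G U) (ha : 0 < a)
    (hb : b ≤ R) : Integrable (fun p => 2 * inner ℝ (polarRescale u x₀ p) (radialDeriv u G x₀ p))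
      (cylinderMeasure n a b) :=
  (memLp_inner_integrable (h.memLp_polarRescale ha hb) (h.memLp_radialDeriv hn ha hb)).const_mul 2

/-- On each ray this is the fundamental theorem of calculus for smooth functions, followed by
Fubini. Both sides pass to the limit: spheres by uniform convergence, the cylinder by L² convergence
of values and radial derivatives. No individual slice of ∇u is involved. -/
theorem sphereSq_sub (hn : 1 ≤ n) (h : ApproxData x₀ R u G U) (ha : 0 < a) (hab : a ≤ b)
    (hb : b ≤ R) : sphereSq u x₀ b - sphereSq u x₀ a =
      ∫ p, 2 * inner ℝ (polarRescale u x₀ p) (radialDeriv u G x₀ p) ∂cylinderMeasure n a b := by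
  have hk : ∀ k, ApproxData x₀ R (U k) (pderiv (U k)) fun _ => U k := fun k =>
    approxData_of_contDiff (h.smooth k) x₀ h.pos
  have hb0 : 0 < b := ha.trans_le hab
  have haR : a ≤ R := hab.trans hb
  have l1 := (h.tendsto_sphereSq hb0 hb).sub (h.tendsto_sphereSq ha haR)
  have l2 := (tendsto_integral_inner_of_eLpNorm (fun k => (hk k).memLp_polarRescale ha hb)
    (h.memLp_polarRescale ha hb) (fun k => (hk k).memLp_radialDeriv hn ha hb)
    (h.memLp_radialDeriv hn ha hb) (h.tendsto_polarRescale ha hb)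
    (h.tendsto_radialDeriv hn ha hb)).const_mul 2
  rw [integral_const_mul]
  refine tendsto_nhds_unique l1 (l2.congr fun k => ?_)
  rw [← integral_const_mul, integral_prod_symm _ ((hk k).integrable_inner_radialDeriv hn ha hb),
    sphereSq, sphereSq, ← integral_sub
      (integrable_norm_sq_of_memLp ((hk k).memLp_sphere_rescale hb0 hb))
      (integrable_norm_sq_of_memLp ((hk k).memLp_sphere_rescale ha haR))]
  refine integral_congr_ae (Eventually.of_forall fun θ => ?_)
  exact (sphereSq_sub_of_contDiff (h.smooth k) x₀ ha hab θ).symm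

/-- The raywise Cauchy–Schwarz bound integrated over the sphere for smooth approximants, then the
limit in L². -/
theorem integral_norm_rescale_sub_sq_le (hn : 1 ≤ n) (h : ApproxData x₀ R u G U) (ha : 0 < a)
    (hab : a ≤ b) (hb : b ≤ R) :
    ∫ θ : sphere (0 : Eucl n) 1, ‖rescale u x₀ b θ - rescale u x₀ a θ‖ ^ 2 ∂sphereMeasure n ≤
      (b - a) * ∫ p, ‖radialDeriv u G x₀ p‖ ^ 2 ∂cylinderMeasure n a b := by
  have hk : ∀ k, ApproxData x₀ R (U k) (pderiv (U k)) fun _ => U k := fun k =>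
    approxData_of_contDiff (h.smooth k) x₀ h.pos
  have hb0 : 0 < b := ha.trans_le hab
  have haR : a ≤ R := hab.trans hb
  have m1 := (h.memLp_sphere_rescale hb0 hb).sub (h.memLp_sphere_rescale ha haR)
  have m1k := fun k => ((hk k).memLp_sphere_rescale hb0 hb).sub
    ((hk k).memLp_sphere_rescale ha haR)
  have t1 : Tendsto (fun k => eLpNorm
      (((fun θ : sphere (0 : Eucl n) 1 => rescale (U k) x₀ b θ) -
        fun θ : sphere (0 : Eucl n) 1 => rescale (U k) x₀ a θ) -
      ((fun θ : sphere (0 : Eucl n) 1 => rescale u x₀ b θ) -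
        fun θ : sphere (0 : Eucl n) 1 => rescale u x₀ a θ)) 2 (sphereMeasure n)) atTop (𝓝 0) := by
    refine tendsto_of_tendsto_of_tendsto_of_le_of_le tendsto_const_nhds
      (by simpa using (h.tendsto_sphere_rescale hb0 hb).add (h.tendsto_sphere_rescale ha haR))
      (fun _ => zero_le) fun k => ?_
    rw [sub_sub_sub_comm]
    exact eLpNorm_sub_le (((hk k).memLp_sphere_rescale hb0 hb).sub
      (h.memLp_sphere_rescale hb0 hb)).1 (((hk k).memLp_sphere_rescale ha haR).sub
      (h.memLp_sphere_rescale ha haR)).1 one_le_two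
  have l1 := tendsto_integral_inner_of_eLpNorm m1k m1 m1k m1 t1 t1
  have l2 := (tendsto_integral_inner_of_eLpNorm (fun k => (hk k).memLp_radialDeriv hn ha hb)
    (h.memLp_radialDeriv hn ha hb) (fun k => (hk k).memLp_radialDeriv hn ha hb)
    (h.memLp_radialDeriv hn ha hb) (h.tendsto_radialDeriv hn ha hb)
    (h.tendsto_radialDeriv hn ha hb)).const_mul (b - a)
  simp only [real_inner_self_eq_norm_sq] at l1 l2
  refine le_of_tendsto_of_tendsto' l1 l2 fun k => ?_
  have hi := integrable_norm_sq_of_memLp ((hk k).memLp_radialDeriv hn ha hb)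
  rw [integral_prod_symm _ hi, ← integral_const_mul]
  exact integral_mono (integrable_norm_sq_of_memLp (m1k k)) (hi.integral_prod_right.const_mul _) fun θ =>
    norm_rescale_sub_sq_le (h.smooth k) x₀ ha hab θ

end ApproxData

/-! ### Absolute continuity of functions built from primitives -/

section AbsolutelyContinuous

theorem absolutelyContinuousOnInterval_congr {f g : ℝ → ℝ} {a b : ℝ}
    (hf : AbsolutelyContinuousOnInterval f a b) (h : EqOn f g (uIcc a b)) :
    AbsolutelyContinuousOnInterval g a b := by
  rw [absolutelyContinuousOnInterval_iff] at hf ⊢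
  intro ε hε
  obtain ⟨δ, hδ, H⟩ := hf ε hε
  refine ⟨δ, hδ, fun E hE hlt => ?_⟩
  have := H E hE hlt
  rwa [Finset.sum_congr rfl fun i hi => by rw [h (hE.1 i hi).1, h (hE.1 i hi).2]] at this

/-- The abstract shape of the Weiss energy: a power of r times a primitive, minus a primitive.
Primitives of integrable functions are absolutely continuous and, by Lebesgue differentiation, have
the integrand as derivative almost everywhere. -/
theorem ac_and_hasDerivAt_of_primitives {q h η W : ℝ → ℝ} {N : ℕ} {R : ℝ}
    (hq : IntervalIntegrable q volume 0 R)
    (hh : ∀ a b, 0 < a → a ≤ b → b ≤ R → IntervalIntegrable h volume a b ∧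
      η b - η a = ∫ t in a..b, h t)
    (hW : ∀ r, 0 < r → r ≤ R → W r = 1 / r ^ N * (∫ t in (0 : ℝ)..r, q t) - 2 * η r)
    {a b : ℝ} (ha : 0 < a) (hab : a ≤ b) (hb : b ≤ R) :
    AbsolutelyContinuousOnInterval W a b ∧ ∀ᵐ r, r ∈ Ioo a b →
      HasDerivAt W (-N / r ^ (N + 1) * (∫ t in (0 : ℝ)..r, q t) + 1 / r ^ N * q r - 2 * h r) r := by
  -- The boundary term is a primitive only away from 0, so it is anchored at `a` instead of 0.
  set W' : ℝ → ℝ := fun r =>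
    1 / r ^ N * (∫ t in (0 : ℝ)..r, q t) - (2 * η a + 2 * ∫ t in a..r, h t) with hW'
  have hR : 0 ≤ R := (ha.le.trans hab).trans hb
  have heq : ∀ r ∈ Icc a b, W' r = W r := fun r hr => by
    rw [hW r (ha.trans_le hr.1) (hr.2.trans hb), hW']
    simp only
    rw [← (hh a r ha hr.1 (hr.2.trans hb)).2]
    ring
  obtain ⟨hi, -⟩ := hh a b ha hab hb
  have hsub : uIcc a b ⊆ uIcc 0 R := by
    rw [uIcc_of_le hab, uIcc_of_le hR]
    exact Icc_subset_Icc ha.le hb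
  have c1 : AbsolutelyContinuousOnInterval (fun r : ℝ => 1 / r ^ N) a b := by
    refine ContDiffOn.absolutelyContinuousOnInterval
      (contDiffOn_const.div (contDiff_id.pow N).contDiffOn fun r hr => ?_)
    rw [uIcc_of_le hab] at hr
    exact pow_ne_zero N (ha.trans_le hr.1).ne'
  have c2 : AbsolutelyContinuousOnInterval (fun r => ∫ t in (0 : ℝ)..r, q t) a b :=
    (hq.absolutelyContinuousOnInterval_intervalIntegral (by simp)).mono hsub
  have c3 : AbsolutelyContinuousOnInterval (fun r => ∫ t in a..r, h t) a b :=
    hi.absolutelyContinuousOnInterval_intervalIntegral (by simp)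
  have c4 : AbsolutelyContinuousOnInterval (fun _ : ℝ => 2 * η a) a b :=
    contDiffOn_const.absolutelyContinuousOnInterval
  refine ⟨absolutelyContinuousOnInterval_congr ((c1.mul c2).sub (c4.add (c3.const_mul 2)))
    (by rw [uIcc_of_le hab]; exact heq), ?_⟩
  filter_upwards [hq.ae_hasDerivAt_integral, hi.ae_hasDerivAt_integral] with r h1 h2 hr
  have hr' : r ∈ uIcc a b := by
    rw [uIcc_of_le hab]
    exact Ioo_subset_Icc_self hr
  have hr0 : r ≠ 0 := (ha.trans hr.1).ne'
  have d1 := h1 (hsub hr') 0 (by simp)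
  have d2 := h2 hr' a (by simp)
  have d3 : HasDerivAt (fun r : ℝ => 1 / r ^ N) (-N / r ^ (N + 1)) r := by
    have := (hasDerivAt_pow N r).inv (pow_ne_zero N hr0)
    simp only [one_div]
    refine HasDerivAt.congr_deriv this ?_
    rcases N with _ | N
    · simp
    · simp only [Nat.add_sub_cancel]
      field_simp
      ring
  have d4 := (d3.mul d1).sub ((d2.const_mul 2).const_add (2 * η a))
  refine (d4.congr_of_eventuallyEq ?_).congr_deriv rfl
  filter_upwards [Ioo_mem_nhds hr.1 hr.2] with s hs
  exact (heq s (Ioo_subset_Icc_self hs)).symm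

end AbsolutelyContinuous

/-! ### The derivative of the Weiss energy -/

/-- The derivative of `r ↦ ∫_{∂B₁} |u_r|²`. -/
noncomputable def radialFlux (u : Eucl n → Eucl m) (G : Fin n → Eucl n → Eucl m) (x₀ : Eucl n)
    (r : ℝ) : ℝ :=
  ∫ θ : sphere (0 : Eucl n) 1,
    2 * inner ℝ (polarRescale u x₀ (r, θ)) (radialDeriv u G x₀ (r, θ)) ∂sphereMeasure n

theorem radialFlux_eq (u : Eucl n → Eucl m) (G : Fin n → Eucl n → Eucl m) (x₀ : Eucl n) (r : ℝ) :
    radialFlux u G x₀ r = 2 * r⁻¹ * ∫ θ : sphere (0 : Eucl n) 1,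
      inner ℝ (rescale u x₀ r θ) (radialDefect u G x₀ r θ) ∂sphereMeasure n := by
  rw [radialFlux, ← integral_const_mul]
  congr 1
  ext1 θ
  simp only [polarRescale, radialDeriv, real_inner_smul_right]
  ring

theorem integral_norm_radialDeriv_sq (u : Eucl n → Eucl m) (G : Fin n → Eucl n → Eucl m)
    (x₀ : Eucl n) (r : ℝ) :
    ∫ θ : sphere (0 : Eucl n) 1, ‖radialDeriv u G x₀ (r, θ)‖ ^ 2 ∂sphereMeasure n =
      r⁻¹ ^ 2 * defectSq u G x₀ r := by
  rw [defectSq, ← integral_const_mul]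
  congr 1
  ext1 θ
  rw [radialDeriv, norm_smul, mul_pow, norm_inv, inv_pow, inv_pow, Real.norm_eq_abs, sq_abs]

theorem defectSq_nonneg (u : Eucl n → Eucl m) (G : Fin n → Eucl n → Eucl m) (x₀ : Eucl n)
    (r : ℝ) : 0 ≤ defectSq u G x₀ r :=
  integral_nonneg fun _ => by positivity

theorem two_div_mul_sphereIntegral (hn : 1 ≤ n) (u : Eucl n → Eucl m) (x₀ : Eucl n) {r : ℝ}
    (hr : 0 < r) :
    2 / r ^ (n + 3) * sphereIntegral x₀ r (fun x => ‖u x‖ ^ 2) = 2 * sphereSq u x₀ r := by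
  have e : ∀ θ : sphere (0 : Eucl n) 1, ‖u (x₀ + r • (θ : Eucl n))‖ ^ 2 =
      r ^ 4 * ‖rescale u x₀ r θ‖ ^ 2 := fun θ => by
    rw [rescale, norm_smul, Real.norm_of_nonneg (by positivity)]
    field_simp
  rw [sphereIntegral, sphereSq]
  simp only [e, integral_const_mul]
  have h3 : r ^ (n + 3) = r ^ (n - 1) * r ^ 4 := by
    rw [← pow_add]
    congr 1
    omega
  rw [h3]
  field_simp

namespace ApproxData

variable {x₀ : Eucl n} {R r a b : ℝ} {u : Eucl n → Eucl m} {G : Fin n → Eucl n → Eucl m}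
  {U : ℕ → Eucl n → Eucl m}

theorem sphereSq_sub_eq (hn : 1 ≤ n) (h : ApproxData x₀ R u G U) (ha : 0 < a) (hab : a ≤ b)
    (hb : b ≤ R) : IntervalIntegrable (radialFlux u G x₀) volume a b ∧
      sphereSq u x₀ b - sphereSq u x₀ a = ∫ t in a..b, radialFlux u G x₀ t := by
  have hi := h.integrable_inner_radialDeriv hn ha hb
  refine ⟨?_, ?_⟩
  · rw [intervalIntegrable_iff_integrableOn_Ioo_of_le hab]
    exact hi.integral_prod_left
  · rw [h.sphereSq_sub hn ha hab hb, intervalIntegral.integral_of_le hab,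
      integral_Ioc_eq_integral_Ioo, integral_prod _ hi]
    rfl

theorem intervalIntegrable_defectSq (hn : 1 ≤ n) (h : ApproxData x₀ R u G U) (ha : 0 < a)
    (hab : a ≤ b) (hb : b ≤ R) :
    IntervalIntegrable (fun t => t⁻¹ ^ 2 * defectSq u G x₀ t) volume a b := by
  have hi := (integrable_norm_sq_of_memLp (h.memLp_radialDeriv hn ha hb)).integral_prod_left
  simp only [integral_norm_radialDeriv_sq] at hi
  rwa [intervalIntegrable_iff_integrableOn_Ioo_of_le hab]

theorem intervalIntegrable_defectSq_div (hn : 1 ≤ n) (h : ApproxData x₀ R u G U) (ha : 0 < a)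
    (hab : a ≤ b) (hb : b ≤ R) :
    IntervalIntegrable (fun t => t⁻¹ * defectSq u G x₀ t) volume a b := by
  refine ((h.intervalIntegrable_defectSq hn ha hab hb).mul_continuousOn
    (continuousOn_id' _)).congr fun t ht => ?_
  rw [uIoc_of_le hab] at ht
  have : t ≠ 0 := (ha.trans ht.1).ne'
  field_simp

/-- Over a dyadic range of radii, the oscillation of the rescalings is controlled by the defect. -/
theorem integral_norm_rescale_sub_sq_le_defect (hn : 1 ≤ n) (h : ApproxData x₀ R u G U)
    (ha : 0 < a) (hab : a ≤ b) (hb : b ≤ R) (hba : b ≤ 2 * a) :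
    ∫ θ : sphere (0 : Eucl n) 1, ‖rescale u x₀ b θ - rescale u x₀ a θ‖ ^ 2 ∂sphereMeasure n ≤
      ∫ t in a..b, t⁻¹ * defectSq u G x₀ t := by
  refine (h.integral_norm_rescale_sub_sq_le hn ha hab hb).trans ?_
  rw [integral_prod _ (integrable_norm_sq_of_memLp (h.memLp_radialDeriv hn ha hb))]
  simp only [integral_norm_radialDeriv_sq]
  rw [← integral_Ioc_eq_integral_Ioo, ← intervalIntegral.integral_of_le hab,
    ← intervalIntegral.integral_const_mul]
  refine intervalIntegral.integral_mono_on hab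
    ((h.intervalIntegrable_defectSq hn ha hab hb).const_mul _)
    (h.intervalIntegrable_defectSq_div hn ha hab hb) fun t ht => ?_
  have ht0 : 0 < t := ha.trans_le ht.1
  rw [← mul_assoc]
  refine mul_le_mul_of_nonneg_right ?_ (defectSq_nonneg u G x₀ t)
  -- The factor b − a from Cauchy–Schwarz is at most a ≤ t because b ≤ 2a; it turns t⁻² into t⁻¹.
  rw [inv_pow, ← div_eq_mul_inv, div_le_iff₀ (by positivity)]
  have : t⁻¹ * t ^ 2 = t := by field_simp
  linarith [ht.1]

theorem weissEnergy_eq (hn : 1 ≤ n) (h : ApproxData x₀ R u G U) (hr : 0 < r) (hrR : r ≤ R) :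
    weissEnergy u x₀ r =
      1 / r ^ (n + 2) * (∫ t in (0 : ℝ)..r, t ^ (n - 1) * sphereEnergy u G x₀ t) -
        2 * sphereSq u x₀ r := by
  have hf := h.weak.integrable_energy measure_ball_lt_top
  rw [weissEnergy, energy_eq isOpen_ball (h.weak.mono (ball_subset_ball hrR)),
    integral_ball hn hr hrR hf]
  rw [two_div_mul_sphereIntegral hn u x₀ hr]
  rfl

theorem sphereEnergy_eq (hr : 0 < r) :
    ∫ θ : sphere (0 : Eucl n) 1, ((∑ i, ‖rescaleGrad G x₀ r i θ‖ ^ 2) + 2 * ‖rescale u x₀ r θ‖)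
      ∂sphereMeasure n = 1 / r ^ 2 * sphereEnergy u G x₀ r := by
  rw [sphereEnergy, ← integral_const_mul]
  congr 1
  ext1 θ
  simp only [rescale, rescaleGrad, norm_smul, mul_pow, ← Finset.mul_sum, norm_inv,
    Real.norm_of_nonneg hr.le, Real.norm_of_nonneg (by positivity : 0 ≤ 1 / r ^ 2)]
  field_simp

/-- The derivative contains the bulk energy with factor −(n+2)/r, the energy on the sphere of radius
r, and the flux of |u_r|². Solving the formula for M(c_r) for the sphere energy makes the flux
cancel and leaves only M(c_r) − W(r) and the defect. -/
theorem weissEnergy_ac (hn : 1 ≤ n) (h : ApproxData x₀ R u G U) (ha : 0 < a) (hab : a ≤ b)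
    (hb : b ≤ R) :
    AbsolutelyContinuousOnInterval (weissEnergy u x₀) a b ∧ ∀ᵐ r, r ∈ Ioo a b →
      HasDerivAt (weissEnergy u x₀) (r⁻¹ * (((n : ℝ) + 2) *
        (balancedEnergy (homogExt u x₀ r) - weissEnergy u x₀ r) + defectSq u G x₀ r)) r := by
  obtain ⟨hac, hd⟩ := ac_and_hasDerivAt_of_primitives (N := n + 2)
    (intervalIntegrable_ball hn h.pos (h.weak.integrable_energy measure_ball_lt_top))
    (fun a b ha hab hb => h.sphereSq_sub_eq hn ha hab hb)
    (fun r hr hrR => h.weissEnergy_eq hn hr hrR) ha hab hb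
  refine ⟨hac, ?_⟩
  filter_upwards [hd, (ae_restrict_iff' measurableSet_Ioo).1 (h.ae_homogExt hn)] with r hr1 hr2 hr
  have hr0 : 0 < r := ha.trans hr.1
  have hrR : r < R := hr.2.trans_le hb
  obtain ⟨mg, wc, -⟩ := hr2 ⟨hr0, hrR⟩
  refine (hr1 hr).congr_deriv ?_
  have hM := balancedEnergy_homog hn (stronglyMeasurable_rescale h.meas)
    (stronglyMeasurable_rescaleGrad h.meas_grad) (h.memLp_sphere_rescale hr0 hrR.le) mg wc
  rw [sphereEnergy_eq hr0, ← homogExt_eq] at hM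
  rw [mul_sub, hM, h.weissEnergy_eq hn hr0 hrR.le, radialFlux_eq]
  change _ = r⁻¹ * (_ - 2 * ((n : ℝ) + 2) * sphereSq u x₀ r - _ - defectSq u G x₀ r - _ + _)
  have h3 : r ^ (n + 2) = r ^ (n - 1) * r ^ 3 := by
    rw [← pow_add]
    congr 1
    omega
  have h4 : r ^ (n + 2 + 1) = r ^ (n - 1) * r ^ 4 := by
    rw [← pow_add]
    congr 1
    omega
  change _ / r ^ (n + 2 + 1) * (∫ t in (0 : ℝ)..r, t ^ (n - 1) * sphereEnergy u G x₀ t) +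
    1 / r ^ (n + 2) * (r ^ (n - 1) * sphereEnergy u G x₀ r) - _ = _
  simp only [radialDefect]
  rw [h4, h3]
  push_cast
  field_simp
  ring

end ApproxData

/-! ### Comparison of the minimiser with competitors on balls -/

theorem MemW12.congr {Ω : Set (Eucl n)} {v w : Eucl n → Eucl m} (h : MemW12 Ω v)
    (hvw : v =ᵐ[volume.restrict Ω] w) : MemW12 Ω w := by
  obtain ⟨G, hG⟩ := h
  exact ⟨G, hG.congr hvw fun i => EventuallyEq.rfl⟩

theorem energy_congr {Ω : Set (Eucl n)} (hΩ : IsOpen Ω) {v w : Eucl n → Eucl m} (h : MemW12 Ω v)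
    (hvw : v =ᵐ[volume.restrict Ω] w) : energy Ω v = energy Ω w := by
  obtain ⟨G, hG⟩ := h
  rw [energy_eq hΩ hG, energy_eq hΩ (hG.congr hvw fun i => EventuallyEq.rfl)]
  refine integral_congr_ae ?_
  filter_upwards [hvw] with x hx
  rw [hx]

theorem IsMinimiser.energy_le_add {D : Set (Eucl n)} {u : Eucl n → Eucl m} (hD : IsOpen D)
    (hu : IsMinimiser D u) {w : Eucl n → Eucl m} {Z : Fin n → Eucl n → Eucl m}
    (hw : IsWeakGradZero D w Z) : energy D u ≤ energy D (u + w) := by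
  obtain ⟨G, hG⟩ := hu.1
  refine hu.2 _ ⟨_, hG.add hw.toIsWeakGrad⟩ ?_
  rw [add_sub_cancel_left]
  exact hw.memW12Zero hD

theorem preimage_affineHomeo_inv_ball (x₀ : Eucl n) {r : ℝ} (hr : 0 < r) :
    affineHomeo (-(r⁻¹ • x₀)) r⁻¹ (inv_ne_zero hr.ne') ⁻¹' ball 0 1 = ball x₀ r := by
  ext x
  have : -(r⁻¹ • x₀) + r⁻¹ • x = r⁻¹ • (x - x₀) := by
    rw [smul_sub]
    abel
  rw [mem_preimage, affineHomeo_apply, this, mem_ball_zero_iff, norm_smul, mem_ball, dist_eq_norm,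
    norm_inv, Real.norm_of_nonneg hr.le, inv_mul_lt_iff₀ hr, mul_one]

/-- Comparison of a minimiser in a ball with an arbitrary function with the same boundary values. -/
theorem IsMinimiser.energy_ball_le {D : Set (Eucl n)} {u : Eucl n → Eucl m} (hD : IsOpen D)
    (hb : volume D < ⊤) (hu : IsMinimiser D u) {x₀ : Eucl n} {r : ℝ} (hr : 0 < r)
    (hrD : ball x₀ r ⊆ D) {v : Eucl n → Eucl m} (hv : MemW12 (ball 0 1) v)
    (hz : MemW12Zero (ball 0 1) (v - rescale u x₀ r)) :
    energy (ball x₀ r) u ≤ r ^ (n + 2) * energy (ball 0 1) v := by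
  obtain ⟨G, hG⟩ := hu.1
  obtain ⟨H, hH⟩ := hv
  set A := affineHomeo (-(r⁻¹ • x₀)) r⁻¹ (inv_ne_zero hr.ne') with hA
  have hGB := hG.mono hrD
  have hz1 := hz.isWeakGradZero isOpen_ball (hH.sub (hGB.rescale hr))
  have hz2 := (hz1.comp_affineHomeo (a := -(r⁻¹ • x₀)) (inv_ne_zero hr.ne')).smul (r ^ 2)
  rw [preimage_affineHomeo_inv_ball x₀ hr] at hz2
  have hz3 := hz2.indicator measurableSet_ball hrD
  have hAx : ∀ x, x₀ + r • A x = x := fun x => by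
    rw [hA, affineHomeo_apply, smul_add, smul_neg, smul_inv_smul₀ hr.ne', smul_inv_smul₀ hr.ne']
    abel
  have hle := hu.energy_le_add hD hz3
  have hsum := hG.add hz3.toIsWeakGrad
  rw [energy_eq hD hG, energy_eq hD hsum] at hle
  have i1 := hG.integrable_energy hb
  have i2 := hsum.integrable_energy hb
  rw [← integral_inter_add_sdiff (s := D) (t := ball x₀ r) measurableSet_ball i1,
    ← integral_inter_add_sdiff (s := D) (t := ball x₀ r) measurableSet_ball i2,
    inter_eq_self_of_subset_right hrD] at hle
  have e1 : ∀ {f g : Eucl n → ℝ}, (∀ x ∉ ball x₀ r, f x = g x) →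
      ∫ x in D \ ball x₀ r, f x = ∫ x in D \ ball x₀ r, g x := fun hfg =>
    setIntegral_congr_fun (hD.measurableSet.diff measurableSet_ball) fun x hx => hfg x hx.2
  have e2 : ∀ {f g : Eucl n → ℝ}, (∀ x ∈ ball x₀ r, f x = g x) →
      ∫ x in ball x₀ r, f x = ∫ x in ball x₀ r, g x := fun hfg =>
    setIntegral_congr_fun measurableSet_ball hfg
  have e3 : ∀ y ∉ ball x₀ r, (∑ i, ‖G i y‖ ^ 2) + 2 * ‖u y‖ = (∑ i, ‖(G i + (ball x₀ r).indicator
      (r ^ 2 • r⁻¹ • ((H i - rescaleGrad G x₀ r i) ∘ A))) y‖ ^ 2) +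
      2 * ‖(u + (ball x₀ r).indicator (r ^ 2 • ((v - rescale u x₀ r) ∘ A))) y‖ := fun y hy => by
    simp only [Pi.add_apply, indicator_of_notMem hy, add_zero]
  -- Inside the ball the competitor is r² v(A y), with gradient r H(A y). Both |∇·|² and |·|
  -- therefore scale like r², and the change of variables contributes rⁿ.
  have e4 : ∀ y ∈ ball x₀ r, (∑ i, ‖(G i + (ball x₀ r).indicator
      (r ^ 2 • r⁻¹ • ((H i - rescaleGrad G x₀ r i) ∘ A))) y‖ ^ 2) +
      2 * ‖(u + (ball x₀ r).indicator (r ^ 2 • ((v - rescale u x₀ r) ∘ A))) y‖ =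
      r ^ 2 * ((∑ i, ‖H i (A y)‖ ^ 2) + 2 * ‖v (A y)‖) := fun y hy => by
    have c1 : r * r⁻¹ = 1 := mul_inv_cancel₀ hr.ne'
    have c2 : r ^ 2 * r⁻¹ = r := by field_simp
    have c3 : r ^ 2 * (1 / r ^ 2) = 1 := by field_simp
    simp only [Pi.add_apply, indicator_of_mem hy, Pi.smul_apply, Function.comp_apply, Pi.sub_apply,
      rescaleGrad, rescale, hAx, smul_sub, smul_smul, c1, c2, c3, one_smul, add_sub_cancel,
      norm_smul, mul_pow, Real.norm_of_nonneg hr.le, Real.norm_of_nonneg (sq_nonneg r),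
      ← Finset.mul_sum]
    ring
  rw [e1 e3, e2 e4, add_le_add_iff_right, integral_const_mul] at hle
  have h5 := setIntegral_comp_affineHomeo (a := -(r⁻¹ • x₀)) (inv_ne_zero hr.ne') (ball 0 1)
    fun y => (∑ i, ‖H i y‖ ^ 2) + 2 * ‖v y‖
  rw [preimage_affineHomeo_inv_ball x₀ hr, inv_pow, inv_inv, abs_of_pos (by positivity),
    smul_eq_mul] at h5
  rw [energy_eq isOpen_ball hGB, energy_eq isOpen_ball hH]
  refine hle.trans (le_of_eq ?_)
  rw [h5, ← mul_assoc, ← pow_add, add_comm 2 n]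

/-- W(r) is the balanced energy of u_r: the bulk terms are compared by minimality, and the boundary
terms coincide because v and u_r agree pointwise on the sphere. -/
theorem IsMinimiser.weissEnergy_le (hn : 1 ≤ n) {D : Set (Eucl n)} {u : Eucl n → Eucl m}
    (hD : IsOpen D)
    (hb : volume D < ⊤) (hu : IsMinimiser D u) {x₀ : Eucl n} {r : ℝ} (hr : 0 < r)
    (hrD : ball x₀ r ⊆ D) {v : Eucl n → Eucl m} (hv : MemW12 (ball 0 1) v)
    (hz : MemW12Zero (ball 0 1) (v - rescale u x₀ r))
    (hs : ∀ x ∈ sphere (0 : Eucl n) 1, v x = rescale u x₀ r x) :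
    weissEnergy u x₀ r ≤ balancedEnergy v := by
  have h1 := hu.energy_ball_le hD hb hr hrD hv hz
  rw [weissEnergy, balancedEnergy, two_div_mul_sphereIntegral hn u x₀ hr, sphereIntegral_zero_one]
  refine sub_le_sub ?_ (le_of_eq ?_)
  · rw [one_div, inv_mul_le_iff₀ (by positivity)]
    exact h1
  · rw [sphereSq]
    congr 1
    refine integral_congr_ae (Eventually.of_forall fun θ => ?_)
    simp only [hs θ θ.2]

/-- For almost every r the cone c_r has the trace of u_r, so it is itself a competitor. If v has the
trace of c_r, then v − u_r = (v − c_r) − (u_r − c_r) lies in W₀^{1,2}. -/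
theorem ApproxData.ae_weissEnergy_le (hn : 1 ≤ n) {D : Set (Eucl n)} {u : Eucl n → Eucl m}
    {G : Fin n → Eucl n → Eucl m} {U : ℕ → Eucl n → Eucl m} {x₀ : Eucl n} {R : ℝ}
    (h : ApproxData x₀ R u G U) (hD : IsOpen D) (hb : volume D < ⊤) (hu : IsMinimiser D u)
    (hR : ball x₀ R ⊆ D) :
    ∀ᵐ r, r ∈ Ioo 0 R → weissEnergy u x₀ r ≤ balancedEnergy (homogExt u x₀ r) ∧
      ∀ v, MemW12 (ball 0 1) v → SameBoundaryValues v (homogExt u x₀ r) →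
        weissEnergy u x₀ r ≤ balancedEnergy v := by
  filter_upwards [(ae_restrict_iff' measurableSet_Ioo).1 (h.ae_homogExt hn)] with r hr hr0
  obtain ⟨-, wc, Z, hZ⟩ := hr hr0
  have hrD := (ball_subset_ball hr0.2.le).trans hR
  have hs : ∀ x ∈ sphere (0 : Eucl n) 1, homogExt u x₀ r x = rescale u x₀ r x := fun x hx => by
    simp [homogExt, mem_sphere_zero_iff_norm.1 hx]
  refine ⟨hu.weissEnergy_le hn hD hb hr0.1 hrD ⟨_, wc⟩ ?_ hs, fun v hv hvc => ?_⟩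
  · have := (hZ.smul (-1)).memW12Zero isOpen_ball
    simpa using this
  · refine hu.weissEnergy_le hn hD hb hr0.1 hrD hv ?_ fun x hx => (hvc.1 x hx).trans (hs x hx)
    obtain ⟨F, hF⟩ := hvc.2.1
    have := ((hvc.2.isWeakGradZero isOpen_ball hF).sub hZ).memW12Zero isOpen_ball
    simpa using this

/-! ### Monotonicity and decay of the Weiss energy -/

theorem integral_le_sub_of_ac {f g : ℝ → ℝ} {a b : ℝ} (hab : a ≤ b)
    (hf : AbsolutelyContinuousOnInterval f a b) (hg : IntervalIntegrable g volume a b)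
    (h : ∀ᵐ r, r ∈ Ioo a b → g r ≤ deriv f r) : ∫ r in a..b, g r ≤ f b - f a := by
  rw [← hf.integral_deriv_eq_sub, intervalIntegral.integral_of_le hab,
    intervalIntegral.integral_of_le hab, integral_Ioc_eq_integral_Ioo, integral_Ioc_eq_integral_Ioo]
  exact setIntegral_mono_on_ae ((intervalIntegrable_iff_integrableOn_Ioo_of_le hab).1 hg)
    ((intervalIntegrable_iff_integrableOn_Ioo_of_le hab).1 hf.intervalIntegrable_deriv)
    measurableSet_Ioo h

/-- Grönwall's inequality for an absolutely continuous function with `e' ≥ α e / r`. -/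
theorem le_mul_rpow_of_ac {e : ℝ → ℝ} {α a b : ℝ} (ha : 0 < a) (hab : a ≤ b)
    (he : AbsolutelyContinuousOnInterval e a b)
    (h : ∀ᵐ r, r ∈ Ioo a b → ∃ d, HasDerivAt e d r ∧ α * e r / r ≤ d) :
    e a ≤ e b * (a / b) ^ α := by
  have hb : 0 < b := ha.trans_le hab
  have c1 : AbsolutelyContinuousOnInterval (fun r : ℝ => r ^ (-α)) a b := by
    refine ContDiffOn.absolutelyContinuousOnInterval (contDiffOn_id.rpow_const_of_ne fun r hr => ?_)
    rw [uIcc_of_le hab] at hr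
    exact (ha.trans_le hr.1).ne'
  -- The product e(r) r^{−α} is absolutely continuous with nonnegative derivative almost everywhere,
  -- hence its value at a is at most that at b.
  have key := integral_le_sub_of_ac hab (he.mul c1)
    (intervalIntegrable_const (c := (0 : ℝ))) ?_
  · simp only [intervalIntegral.integral_zero, Pi.mul_apply, sub_nonneg] at key
    rw [Real.rpow_neg ha.le, Real.rpow_neg hb.le] at key
    rw [Real.div_rpow ha.le hb.le]
    have h1 : 0 < a ^ α := Real.rpow_pos_of_pos ha _
    have h2 : 0 < b ^ α := Real.rpow_pos_of_pos hb _
    rw [← div_eq_mul_inv, ← div_eq_mul_inv, div_le_div_iff₀ h1 h2] at key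
    rw [← mul_div_assoc, le_div_iff₀ h2]
    exact key
  · filter_upwards [h] with r hr hr0
    obtain ⟨d, hd, hle⟩ := hr hr0
    have hr1 : 0 < r := ha.trans hr0.1
    have hp := (Real.hasDerivAt_rpow_const (p := -α) (Or.inl hr1.ne'))
    rw [(hd.mul hp).deriv, Real.rpow_sub_one hr1.ne']
    have h3 : 0 < r ^ (-α) := Real.rpow_pos_of_pos hr1 _
    have : d * r ^ (-α) + e r * (-α * (r ^ (-α) / r)) = (d - α * e r / r) * r ^ (-α) := by ring
    rw [this]
    exact mul_nonneg (sub_nonneg.2 hle) h3.le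

namespace ApproxData

variable {x₀ : Eucl n} {R a b : ℝ} {u : Eucl n → Eucl m} {G : Fin n → Eucl n → Eucl m}
  {U : ℕ → Eucl n → Eucl m} {D : Set (Eucl n)}

/-- The monotonicity formula. -/
theorem integral_defectSq_le (hn : 1 ≤ n) (h : ApproxData x₀ R u G U) (hD : IsOpen D)
    (hbd : volume D < ⊤) (hu : IsMinimiser D u) (hR : ball x₀ R ⊆ D) (ha : 0 < a) (hab : a ≤ b)
    (hb : b ≤ R) :
    ∫ t in a..b, t⁻¹ * defectSq u G x₀ t ≤ weissEnergy u x₀ b - weissEnergy u x₀ a := by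
  obtain ⟨hac, hd⟩ := h.weissEnergy_ac hn ha hab hb
  refine integral_le_sub_of_ac hab hac (h.intervalIntegrable_defectSq_div hn ha hab hb) ?_
  filter_upwards [hd, h.ae_weissEnergy_le hn hD hbd hu hR] with r h1 h2 hr
  have hr0 : 0 < r := ha.trans hr.1
  rw [(h1 hr).deriv]
  have h3 := (h2 ⟨hr0, hr.2.trans_le hb⟩).1
  refine mul_le_mul_of_nonneg_left ?_ (by positivity)
  have : 0 ≤ ((n : ℝ) + 2) * (balancedEnergy (homogExt u x₀ r) - weissEnergy u x₀ r) :=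
    mul_nonneg (by positivity) (sub_nonneg.2 h3)
  linarith

theorem weissEnergy_monotoneOn (hn : 1 ≤ n) (h : ApproxData x₀ R u G U) (hD : IsOpen D)
    (hbd : volume D < ⊤) (hu : IsMinimiser D u) (hR : ball x₀ R ⊆ D) :
    MonotoneOn (weissEnergy u x₀) (Ioc 0 R) := fun a ha b hb hab => by
  have h1 := h.integral_defectSq_le hn hD hbd hu hR ha.1 hab hb.2
  have h2 : 0 ≤ ∫ t in a..b, t⁻¹ * defectSq u G x₀ t :=
    intervalIntegral.integral_nonneg hab fun t ht =>
      mul_nonneg (inv_nonneg.2 (ha.1.le.trans ht.1)) (defectSq_nonneg u G x₀ t)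
  linarith

/-- A monotone function tends at 0+ to its infimum, here taken in the extended reals. It is not ⊤
because every W(r) is real, and not ⊥ because κ > 0 would make the right side of the epiperimetric
inequality ⊥ while M(v) is real. One cone c suffices for this. -/
theorem exists_weissLimit (hn : 1 ≤ n) (h : ApproxData x₀ R u G U) (hD : IsOpen D)
    (hbd : volume D < ⊤) (hu : IsMinimiser D u) (hR : ball x₀ R ⊆ D) {κ : ℝ} (hκ : 0 < κ)
    {c : Eucl n → Eucl m} (hepi : EpiperimetricIneq κ (weissLimit u x₀) c) :
    ∃ w : ℝ, weissLimit u x₀ = w ∧ Tendsto (weissEnergy u x₀) (𝓝[>] 0) (𝓝 w) ∧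
      ∀ r ∈ Ioc 0 R, w ≤ weissEnergy u x₀ r := by
  have hm := h.weissEnergy_monotoneOn hn hD hbd hu hR
  have hm' : MonotoneOn (fun r : ℝ => ((weissEnergy u x₀ r : ℝ) : EReal)) (Ioo 0 R) :=
    fun a ha b hb hab => EReal.coe_le_coe_iff.2
      (hm (Ioo_subset_Ioc_self ha) (Ioo_subset_Ioc_self hb) hab)
  have ht := hm'.tendsto_nhdsWithin_Ioo_right ⟨R / 2, by linarith [h.pos], by linarith [h.pos]⟩
    (OrderBot.bddBelow _)
  set L := sInf ((fun r : ℝ => ((weissEnergy u x₀ r : ℝ) : EReal)) '' Ioo 0 R) with hL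
  have hlim : weissLimit u x₀ = L := ht.limsup_eq
  have hle : ∀ r ∈ Ioo 0 R, L ≤ ((weissEnergy u x₀ r : ℝ) : EReal) := fun r hr =>
    sInf_le ⟨r, hr, rfl⟩
  have htop : L ≠ ⊤ := fun htop => by
    have := hle (R / 2) ⟨by linarith [h.pos], by linarith [h.pos]⟩
    rw [htop, top_le_iff] at this
    exact EReal.coe_ne_top _ this
  have hbot : L ≠ ⊥ := fun hbot => by
    obtain ⟨v, -, -, hv⟩ := hepi
    rw [hlim, hbot, EReal.coe_mul_bot_of_pos hκ, EReal.add_bot, le_bot_iff] at hv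
    exact EReal.coe_ne_bot _ hv
  have hw : ((L.toReal : ℝ) : EReal) = L := EReal.coe_toReal htop hbot
  rw [← hw] at ht hlim
  have hle' : ∀ r ∈ Ioo 0 R, L.toReal ≤ weissEnergy u x₀ r := fun r hr => by
    have := hle r hr
    rwa [← hw, EReal.coe_le_coe_iff] at this
  refine ⟨L.toReal, hlim, EReal.tendsto_coe.1 ht, fun r hr => ?_⟩
  -- The infimum is over the open interval; passing through r/2 includes the endpoint r = R.
  have h2 : r / 2 ∈ Ioo 0 R := ⟨by linarith [hr.1], by linarith [hr.1, hr.2]⟩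
  exact (hle' _ h2).trans (hm (Ioo_subset_Ioc_self h2) hr (by linarith [hr.1]))

/-- The defect is dropped and only M(c_r) − W(r) is kept; minimality and the epiperimetric
inequality bound it below by a multiple of W(r) − w. -/
theorem weissEnergy_decay (hn : 1 ≤ n) (h : ApproxData x₀ R u G U) (hD : IsOpen D)
    (hbd : volume D < ⊤) (hu : IsMinimiser D u) (hR : ball x₀ R ⊆ D) {κ w : ℝ} (hκ1 : κ < 1)
    (hepi : ∀ r : ℝ, 0 < r → r < R → EpiperimetricIneq κ w (homogExt u x₀ r))
    (ha : 0 < a) (hab : a ≤ b) (hb : b ≤ R) :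
    weissEnergy u x₀ a - w ≤
      (weissEnergy u x₀ b - w) * (a / b) ^ (((n : ℝ) + 2) * κ / (1 - κ)) := by
  obtain ⟨hac, hd⟩ := h.weissEnergy_ac hn ha hab hb
  have hc : AbsolutelyContinuousOnInterval (fun _ : ℝ => w) a b :=
    contDiffOn_const.absolutelyContinuousOnInterval
  refine le_mul_rpow_of_ac ha hab (hac.sub hc) ?_
  filter_upwards [hd, h.ae_weissEnergy_le hn hD hbd hu hR] with r h1 h2 hr
  have hr0 : 0 < r := ha.trans hr.1
  have hrR : r < R := hr.2.trans_le hb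
  refine ⟨_, (h1 hr).sub (hasDerivAt_const r w), ?_⟩
  obtain ⟨v, hv, hvc, hle⟩ := hepi r hr0 hrR
  have h3 := (h2 ⟨hr0, hrR⟩).2 v hv hvc
  have h4 : balancedEnergy v ≤ (1 - κ) * balancedEnergy (homogExt u x₀ r) + κ * w := by
    exact_mod_cast hle
  have hκ : 0 < 1 - κ := sub_pos.2 hκ1
  -- Eliminating M(v) gives W(r) ≤ (1−κ) M(c_r) + κ w; division by 1 − κ > 0 produces the constant
  -- in the exponent.
  have h5 : κ / (1 - κ) * (weissEnergy u x₀ r - w) ≤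
      balancedEnergy (homogExt u x₀ r) - weissEnergy u x₀ r := by
    rw [div_mul_eq_mul_div, div_le_iff₀ hκ]
    linarith
  have h6 := mul_le_mul_of_nonneg_left h5 (by positivity : 0 ≤ (n : ℝ) + 2)
  have h7 := defectSq_nonneg u G x₀ r
  simp only [Pi.sub_apply, sub_zero]
  rw [div_eq_inv_mul]
  refine mul_le_mul_of_nonneg_left ?_ (by positivity)
  calc ((n : ℝ) + 2) * κ / (1 - κ) * (weissEnergy u x₀ r - w)
      = ((n : ℝ) + 2) * (κ / (1 - κ) * (weissEnergy u x₀ r - w)) := by ring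
    _ ≤ _ := by linarith

end ApproxData

/-! ### From energy decay to a Cauchy estimate on the sphere -/

/-- The quadratic polynomial c ↦ ∫ (g − c)² is nonnegative, so its discriminant is not positive. -/
theorem sq_integral_le {α : Type*} [MeasurableSpace α] {μ : Measure α} [IsFiniteMeasure μ]
    {g : α → ℝ} (hg : Integrable g μ) (hg2 : Integrable (fun x => g x ^ 2) μ) :
    (∫ x, g x ∂μ) ^ 2 ≤ μ.real univ * ∫ x, g x ^ 2 ∂μ := by
  have key : ∀ c : ℝ, 0 ≤ μ.real univ * (c * c) + (-2 * ∫ x, g x ∂μ) * c + ∫ x, g x ^ 2 ∂μ := by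
    intro c
    have h1 : 0 ≤ ∫ x, (g x ^ 2 - 2 * c * g x + c ^ 2) ∂μ :=
      integral_nonneg fun x => by
        have : g x ^ 2 - 2 * c * g x + c ^ 2 = (g x - c) ^ 2 := by ring
        simp only [this]
        positivity
    have i1 : Integrable (fun x => g x ^ 2 - 2 * c * g x) μ := hg2.sub (hg.const_mul _)
    rw [integral_add i1 (integrable_const _),
      integral_sub hg2 (hg.const_mul _), integral_const_mul, integral_const, smul_eq_mul] at h1
    linarith
  have := discrim_le_zero key
  rw [discrim] at this
  linarith

/-- Dyadic summation. -/
theorem le_of_dyadic {d : ℝ → ℝ → ℝ} {c β R : ℝ} (hβ : 0 < β) (hc : 0 ≤ c)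
    (htri : ∀ r s t, 0 < t → t ≤ s → s ≤ r → r ≤ R → d r t ≤ d r s + d s t)
    (H : ∀ r s, 0 < s → s ≤ r → r ≤ R → r ≤ 2 * s → d r s ≤ c * (r / R) ^ β) {r s : ℝ}
    (hs : 0 < s) (hsr : s ≤ r) (hr : r ≤ R) :
    d r s ≤ c / (1 - 2 ^ (-β)) * (r / R) ^ β := by
  have hq0 : (0 : ℝ) < 2 ^ (-β) := Real.rpow_pos_of_pos two_pos _
  have hq1 : (2 : ℝ) ^ (-β) < 1 := Real.rpow_lt_one_of_one_lt_of_neg one_lt_two (by linarith)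
  have hq : 0 < 1 - (2 : ℝ) ^ (-β) := sub_pos.2 hq1
  -- With q = 2^{−β}, the constant K = c/(1−q) is the sum of the geometric series, that is the fixed
  -- point K = c + qK of the induction below.
  have hcq : c / (1 - 2 ^ (-β)) * (1 - 2 ^ (-β)) = c := div_mul_cancel₀ c hq.ne'
  have hcq0 : 0 ≤ c / (1 - 2 ^ (-β)) := div_nonneg hc hq.le
  -- Induction on the number of halvings that bring r within a factor 2 of s; the smaller radius s
  -- stays fixed.
  have key : ∀ k : ℕ, ∀ r, s ≤ r → r ≤ R → r ≤ 2 ^ (k + 1) * s →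
      d r s ≤ c / (1 - 2 ^ (-β)) * (r / R) ^ β := by
    intro k
    induction k with
    | zero =>
      intro r hsr hr hk
      have hx : 0 ≤ (r / R) ^ β := Real.rpow_nonneg
        (div_nonneg (hs.le.trans hsr) ((hs.le.trans hsr).trans hr)) _
      refine (H r s hs hsr hr (by simpa using hk)).trans (mul_le_mul_of_nonneg_right ?_ hx)
      nlinarith
    | succ k ih =>
      intro r hsr hr hk
      have hr0 : 0 < r := hs.trans_le hsr
      have hR0 : 0 < R := hr0.trans_le hr
      have hx : 0 ≤ (r / R) ^ β := Real.rpow_nonneg (div_nonneg hr0.le hR0.le) _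
      rcases le_total r (2 * s) with h2 | h2
      · refine (H r s hs hsr hr h2).trans (mul_le_mul_of_nonneg_right ?_ hx)
        nlinarith
      · have h3 := ih (r / 2) (by linarith) (by linarith) (by rw [pow_succ] at hk; linarith)
        have h4 := H r (r / 2) (by linarith) (by linarith) hr (by linarith)
        have h5 : (r / 2 / R) ^ β = 2 ^ (-β) * (r / R) ^ β := by
          rw [div_right_comm, Real.div_rpow (div_nonneg hr0.le hR0.le) two_pos.le,
            Real.rpow_neg two_pos.le]
          ring
        rw [h5] at h3
        calc d r s ≤ _ := htri r (r / 2) s hs (by linarith) (by linarith) hr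
          _ ≤ c * (r / R) ^ β + c / (1 - 2 ^ (-β)) * (2 ^ (-β) * (r / R) ^ β) := add_le_add h4 h3
          _ = c / (1 - 2 ^ (-β)) * (1 - 2 ^ (-β)) * (r / R) ^ β +
              c / (1 - 2 ^ (-β)) * (2 ^ (-β) * (r / R) ^ β) := by rw [hcq]
          _ = _ := by ring
  obtain ⟨k, hk⟩ := pow_unbounded_of_one_lt (r / s) one_lt_two
  refine key k r hsr hr ?_
  rw [div_lt_iff₀ hs] at hk
  rw [pow_succ]
  nlinarith [pow_pos (two_pos (α := ℝ)) k]

/-- `∫_{∂B₁} |u_r - u_s|`. -/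
noncomputable def sphereDist (u : Eucl n → Eucl m) (x₀ : Eucl n) (r s : ℝ) : ℝ :=
  ∫ θ : sphere (0 : Eucl n) 1, ‖rescale u x₀ r θ - rescale u x₀ s θ‖ ∂sphereMeasure n

/-- The constant in the decay estimate. -/
noncomputable def decayConst (n : ℕ) (β : ℝ) : ℝ :=
  √((sphereMeasure n).real univ) / (1 - 2 ^ (-β))

theorem decayConst_nonneg (n : ℕ) {β : ℝ} (hβ : 0 < β) : 0 ≤ decayConst n β :=
  div_nonneg (Real.sqrt_nonneg _) (sub_nonneg.2
    (Real.rpow_lt_one_of_one_lt_of_neg one_lt_two (by linarith)).le)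

namespace ApproxData

variable {x₀ : Eucl n} {R a b r s : ℝ} {u : Eucl n → Eucl m} {G : Fin n → Eucl n → Eucl m}
  {U : ℕ → Eucl n → Eucl m} {D : Set (Eucl n)}

theorem memLp_rescale_sub (h : ApproxData x₀ R u G U) (hr : 0 < r) (hrR : r ≤ R) (hs : 0 < s)
    (hsR : s ≤ R) : MemLp (fun θ : sphere (0 : Eucl n) 1 => rescale u x₀ r θ - rescale u x₀ s θ) 2
      (sphereMeasure n) :=
  (h.memLp_sphere_rescale hr hrR).sub (h.memLp_sphere_rescale hs hsR)

theorem integrable_norm_rescale_sub (h : ApproxData x₀ R u G U) (hr : 0 < r) (hrR : r ≤ R)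
    (hs : 0 < s) (hsR : s ≤ R) :
    Integrable (fun θ : sphere (0 : Eucl n) 1 => ‖rescale u x₀ r θ - rescale u x₀ s θ‖)
      (sphereMeasure n) :=
  ((h.memLp_rescale_sub hr hrR hs hsR).integrable one_le_two).norm

/-- L¹ is bounded by L² on the sphere of finite measure, L² by the integrated defect, and the defect
by the energy drop. -/
theorem sphereDist_le_sqrt (hn : 1 ≤ n) (h : ApproxData x₀ R u G U) (hD : IsOpen D)
    (hbd : volume D < ⊤) (hu : IsMinimiser D u) (hR : ball x₀ R ⊆ D) (hs : 0 < s) (hsr : s ≤ r)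
    (hr : r ≤ R) (hrs : r ≤ 2 * s) :
    sphereDist u x₀ r s ≤
      √((sphereMeasure n).real univ) * √(weissEnergy u x₀ r - weissEnergy u x₀ s) := by
  have hr0 := hs.trans_le hsr
  have h1 := sq_integral_le (h.integrable_norm_rescale_sub hr0 hr hs (hsr.trans hr))
    (integrable_norm_sq_of_memLp (h.memLp_rescale_sub hr0 hr hs (hsr.trans hr)))
  have h2 := (h.integral_norm_rescale_sub_sq_le_defect hn hs hsr hr hrs).trans
    (h.integral_defectSq_le hn hD hbd hu hR hs hsr hr)
  rw [← Real.sqrt_mul measureReal_nonneg]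
  exact Real.le_sqrt_of_sq_le (h1.trans (mul_le_mul_of_nonneg_left h2 measureReal_nonneg))

/-- Since W(s) ≥ w, the drop W(r) − W(s) is at most (W(R) − w)(r/R)^{2β}. The square root halves the
exponent, and dyadic summation removes the restriction r ≤ 2s. -/
theorem sphereDist_le (hn : 1 ≤ n) (h : ApproxData x₀ R u G U) (hD : IsOpen D)
    (hbd : volume D < ⊤) (hu : IsMinimiser D u) (hR : ball x₀ R ⊆ D) {κ w : ℝ} (hκ0 : 0 < κ)
    (hκ1 : κ < 1) (hw : ∀ r ∈ Ioc 0 R, w ≤ weissEnergy u x₀ r)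
    (hepi : ∀ r : ℝ, 0 < r → r < R → EpiperimetricIneq κ w (homogExt u x₀ r))
    (hs : 0 < s) (hsr : s ≤ r) (hr : r ≤ R) :
    sphereDist u x₀ r s ≤ decayConst n (((n : ℝ) + 2) * κ / (2 * (1 - κ))) *
      √(weissEnergy u x₀ R - w) * (r / R) ^ (((n : ℝ) + 2) * κ / (2 * (1 - κ))) := by
  set β := ((n : ℝ) + 2) * κ / (2 * (1 - κ)) with hβ
  have hκ : 0 < 1 - κ := sub_pos.2 hκ1
  have hβ0 : 0 < β := by positivity
  have key := le_of_dyadic (d := sphereDist u x₀) (R := R) hβ0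
    (c := √((sphereMeasure n).real univ) * √(weissEnergy u x₀ R - w)) (by positivity)
    (fun r s t ht hts hsr hr => ?_) (fun r s hs hsr hr hrs => ?_) hs hsr hr
  · refine key.trans (le_of_eq ?_)
    rw [decayConst]
    ring
  · have hs0 := ht.trans_le hts
    have hr0 := hs0.trans_le hsr
    have hsR := hsr.trans hr
    have htR := hts.trans hsR
    rw [sphereDist, sphereDist, sphereDist, ← integral_add
      (h.integrable_norm_rescale_sub hr0 hr hs0 hsR) (h.integrable_norm_rescale_sub hs0 hsR ht htR)]
    exact integral_mono (h.integrable_norm_rescale_sub hr0 hr ht htR)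
      ((h.integrable_norm_rescale_sub hr0 hr hs0 hsR).add
        (h.integrable_norm_rescale_sub hs0 hsR ht htR)) fun θ => norm_sub_le_norm_sub_add_norm_sub _ _ _
  · have hr0 := hs.trans_le hsr
    refine (h.sphereDist_le_sqrt hn hD hbd hu hR hs hsr hr hrs).trans ?_
    rw [mul_assoc]
    refine mul_le_mul_of_nonneg_left ?_ (Real.sqrt_nonneg _)
    have h1 := h.weissEnergy_decay hn hD hbd hu hR hκ1 hepi hr0 hr le_rfl
    have h2 := hw s ⟨hs, hsr.trans hr⟩
    have hx : 0 ≤ r / R := div_nonneg hr0.le h.pos.le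
    have h3 : (r / R) ^ (((n : ℝ) + 2) * κ / (1 - κ)) = ((r / R) ^ β) ^ 2 := by
      rw [← Real.rpow_natCast, ← Real.rpow_mul hx, hβ]
      congr 1
      push_cast
      field_simp
    calc √(weissEnergy u x₀ r - weissEnergy u x₀ s)
        ≤ √((weissEnergy u x₀ R - w) * ((r / R) ^ β) ^ 2) :=
          Real.sqrt_le_sqrt (by rw [← h3]; linarith)
      _ = _ := by
          rw [Real.sqrt_mul' _ (sq_nonneg _), Real.sqrt_sq (Real.rpow_nonneg hx _)]

end ApproxData

/-! ### Blow-up limits: distance estimate and uniqueness -/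

/-- `u₀` is the weak limit in `L²_loc` of the rescalings with the radii `ρ k`. -/
def IsWeakLimit (u : Eucl n → Eucl m) (x₀ : Eucl n) (ρ : ℕ → ℝ) (u₀ : Eucl n → Eucl m) : Prop :=
  ∀ b : ℝ, 0 < b → MemLp u₀ 2 (volume.restrict (ball 0 b)) ∧
    ∀ ψ : Eucl n → Eucl m, MemLp ψ 2 (volume.restrict (ball 0 b)) →
      Tendsto (fun k => ∫ x in ball 0 b, inner ℝ (rescale u x₀ (ρ k) x) (ψ x)) atTop
        (𝓝 (∫ x in ball 0 b, inner ℝ (u₀ x) (ψ x)))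

theorem stronglyMeasurable_homogExt {u : Eucl n → Eucl m} (hu : StronglyMeasurable u) (x₀ : Eucl n)
    (r : ℝ) : StronglyMeasurable (homogExt u x₀ r) :=
  (continuous_norm.pow 2).stronglyMeasurable.smul
    ((stronglyMeasurable_rescale hu).comp_measurable (by fun_prop))

theorem homogExt_smul (u : Eucl n → Eucl m) (x₀ : Eucl n) (r : ℝ) {t : ℝ} (ht : 0 < t)
    (θ : sphere (0 : Eucl n) 1) :
    homogExt u x₀ r (t • (θ : Eucl n)) = t ^ 2 • rescale u x₀ r θ := by
  have h1 : ‖t • (θ : Eucl n)‖ = t := by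
    rw [norm_smul, norm_eq_of_mem_sphere, Real.norm_of_nonneg ht.le, mul_one]
  rw [homogExt, h1, inv_smul_smul₀ ht.ne']

theorem rescale_smul (u : Eucl n → Eucl m) (x₀ : Eucl n) {ρ t : ℝ} (ht : 0 < t)
    (θ : Eucl n) : rescale u x₀ ρ (t • θ) = t ^ 2 • rescale u x₀ (ρ * t) θ := by
  simp only [rescale, smul_smul]
  congr 1
  field_simp

namespace ApproxData

variable {x₀ : Eucl n} {R a b r s : ℝ} {u : Eucl n → Eucl m} {G : Fin n → Eucl n → Eucl m}
  {U : ℕ → Eucl n → Eucl m} {D : Set (Eucl n)}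

theorem memLp_homogExt_ball (h : ApproxData x₀ R u G U) (hr : 0 < r) (hrR : r ≤ R) (b : ℝ) :
    MemLp (homogExt u x₀ r) 2 (volume.restrict (ball 0 b)) := by
  have fin : IsFiniteMeasure ((volume : Measure (Eucl n)).restrict (ball 0 b)) :=
    ⟨by simpa using measure_ball_lt_top⟩
  obtain ⟨C, hC⟩ := (isCompact_closedBall x₀ R).exists_bound_of_continuousOn h.cont
  refine MemLp.of_bound (stronglyMeasurable_homogExt h.meas x₀ r).aestronglyMeasurable
    (b ^ 2 * (1 / r ^ 2 * C)) ?_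
  filter_upwards [ae_restrict_mem measurableSet_ball] with x hx
  rw [mem_ball_zero_iff] at hx
  have hmem : x₀ + r • (‖x‖⁻¹ • x) ∈ closedBall x₀ R := by
    rw [mem_closedBall, dist_eq_norm, add_sub_cancel_left, norm_smul, Real.norm_of_nonneg hr.le,
      norm_smul, norm_inv, norm_norm]
    calc r * (‖x‖⁻¹ * ‖x‖) ≤ r * 1 := mul_le_mul_of_nonneg_left inv_mul_le_one hr.le
      _ ≤ R := by linarith
  rw [homogExt, rescale, norm_smul, norm_smul, norm_pow, norm_norm,
    Real.norm_of_nonneg (by positivity : 0 ≤ 1 / r ^ 2)]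
  have hC' := hC _ hmem
  gcongr

theorem memLp_rescale_ball (h : ApproxData x₀ R u G U) (hr : 0 < r) (hrb : r * b ≤ R) :
    MemLp (rescale u x₀ r) 2 (volume.restrict (ball 0 b)) := by
  have fin : IsFiniteMeasure ((volume : Measure (Eucl n)).restrict (ball 0 b)) :=
    ⟨by simpa using measure_ball_lt_top⟩
  obtain ⟨C, hC⟩ := (isCompact_closedBall x₀ R).exists_bound_of_continuousOn h.cont
  refine MemLp.of_bound (stronglyMeasurable_rescale h.meas).aestronglyMeasurable
    (1 / r ^ 2 * C) ?_
  filter_upwards [ae_restrict_mem measurableSet_ball] with x hx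
  rw [mem_ball_zero_iff] at hx
  have hmem : x₀ + r • x ∈ closedBall x₀ R := by
    rw [mem_closedBall, dist_eq_norm, add_sub_cancel_left, norm_smul, Real.norm_of_nonneg hr.le]
    exact (mul_le_mul_of_nonneg_left hx.le hr.le).trans hrb
  rw [rescale, norm_smul, Real.norm_of_nonneg (by positivity : 0 ≤ 1 / r ^ 2)]
  exact mul_le_mul_of_nonneg_left (hC _ hmem) (by positivity)

/-- On the sphere of radius t one has c_r(tθ) = t² u_r(θ) and u_ρ(tθ) = t² u_{ρt}(θ), so the
difference is t² times the distance of two rescalings, both with radii at most r. The Jacobian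
t^{n−1} makes the weight t^{n+1}. -/
theorem integral_shell_homogExt_sub_rescale_le (hn : 1 ≤ n) (h : ApproxData x₀ R u G U)
    (hr : 0 < r) (hrR : r ≤ R) {ε : ℝ} (hε : ∀ s, 0 < s → s ≤ r → sphereDist u x₀ r s ≤ ε)
    (ha : 0 ≤ a) {ρ : ℝ} (hρ : 0 < ρ) (hρb : ρ * b ≤ r) :
    ∫ x in shell 0 a b, ‖homogExt u x₀ r x - rescale u x₀ ρ x‖ ≤
      ε * ∫ t in Ioo a b, t ^ (n + 1) := by
  have hsub : shell (0 : Eucl n) a b ⊆ ball 0 b := fun x hx => hx.2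
  have fin : IsFiniteMeasure ((volume : Measure (Eucl n)).restrict (ball 0 b)) :=
    ⟨by simpa using measure_ball_lt_top⟩
  have hi : IntegrableOn (fun x => ‖homogExt u x₀ r x - rescale u x₀ ρ x‖) (shell 0 a b) :=
    IntegrableOn.mono_set ((((h.memLp_homogExt_ball hr hrR b).sub
      (h.memLp_rescale_ball hρ (hρb.trans hrR))).integrable one_le_two).norm) hsub
  obtain ⟨h1, h2⟩ := integral_shell hn ha hi
  have h3 : IntegrableOn (fun t : ℝ => t ^ (n + 1)) (Ioo a b) :=
    ((continuous_pow (n + 1)).integrableOn_Icc).mono_set Ioo_subset_Icc_self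
  rw [h2, ← integral_const_mul]
  refine setIntegral_mono_on h1 (h3.const_mul ε) measurableSet_Ioo fun t ht => ?_
  have ht0 : 0 < t := ha.trans_lt ht.1
  have e : ∀ θ : sphere (0 : Eucl n) 1,
      ‖homogExt u x₀ r (0 + t • (θ : Eucl n)) - rescale u x₀ ρ (0 + t • (θ : Eucl n))‖ =
      t ^ 2 * ‖rescale u x₀ r θ - rescale u x₀ (ρ * t) θ‖ := fun θ => by
    rw [zero_add, homogExt_smul u x₀ r ht0, rescale_smul u x₀ ht0, ← smul_sub, norm_smul,
      Real.norm_of_nonneg (sq_nonneg t)]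
  simp only [e, integral_const_mul]
  have h4 := hε (ρ * t) (by positivity) ((mul_le_mul_of_nonneg_left ht.2.le hρ.le).trans hρb)
  have h5 : t ^ (n + 1) = t ^ (n - 1) * t ^ 2 := by
    rw [← pow_add]
    congr 1
    omega
  rw [h5]
  calc t ^ (n - 1) * (t ^ 2 * sphereDist u x₀ r (ρ * t)) ≤ t ^ (n - 1) * (t ^ 2 * ε) := by gcongr
    _ = _ := by ring

/-- Distance in `L¹` of the homogeneous extension to a blow-up limit. -/
theorem integral_shell_homogExt_sub_le (hn : 1 ≤ n) (h : ApproxData x₀ R u G U)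
    (hr : 0 < r) (hrR : r ≤ R) {ε : ℝ} (hε : ∀ s, 0 < s → s ≤ r → sphereDist u x₀ r s ≤ ε)
    (ha : 0 ≤ a) (hb : 0 < b) {ρ : ℕ → ℝ} (hρ : ∀ k, 0 < ρ k) (hρ0 : Tendsto ρ atTop (𝓝 0))
    {u₀ : Eucl n → Eucl m} (hu₀ : IsWeakLimit u x₀ ρ u₀) :
    IntegrableOn (fun x => ‖homogExt u x₀ r x - u₀ x‖) (shell 0 a b) ∧
    ∫ x in shell 0 a b, ‖homogExt u x₀ r x - u₀ x‖ ≤ ε * ∫ t in Ioo a b, t ^ (n + 1) := by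
  have hsub : shell (0 : Eucl n) a b ⊆ ball 0 b := fun x hx => hx.2
  have hms : MeasurableSet (shell (0 : Eucl n) a b) := (isOpen_shell 0 a b).measurableSet
  have fin : IsFiniteMeasure ((volume : Measure (Eucl n)).restrict (ball 0 b)) :=
    ⟨by simpa using measure_ball_lt_top⟩
  obtain ⟨m0, hw⟩ := hu₀ b hb
  have mc := h.memLp_homogExt_ball hr hrR b
  set f : Eucl n → Eucl m := homogExt u x₀ r - u₀ with hf
  have mf : MemLp f 2 (volume.restrict (ball 0 b)) := mc.sub m0
  refine ⟨IntegrableOn.mono_set ((mf.integrable one_le_two).norm) hsub, ?_⟩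
  -- Weak lower semicontinuity of the L¹ norm by duality: ψ is the direction of f on the shell (0
  -- where f vanishes). Pairing with ψ gives the L¹ norm for the limit, and at most the L¹ norm
  -- along the sequence.
  set ψ : Eucl n → Eucl m := (shell 0 a b).indicator fun x => ‖f x‖⁻¹ • f x with hψ
  have hψ1 : ∀ x, ‖ψ x‖ ≤ 1 := fun x => by
    by_cases hx : x ∈ shell 0 a b
    · rw [hψ, indicator_of_mem hx, norm_smul, norm_inv, norm_norm]
      exact inv_mul_le_one
    · rw [hψ, indicator_of_notMem hx, norm_zero]
      exact zero_le_one
  have mψ : MemLp ψ 2 (volume.restrict (ball 0 b)) := by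
    refine MemLp.of_bound (AEStronglyMeasurable.indicator ?_ hms) 1
      (Eventually.of_forall hψ1)
    exact (mf.1.norm.aemeasurable.inv).aestronglyMeasurable.smul mf.1
  have lim := (tendsto_const_nhds (x := ∫ x in ball 0 b, inner ℝ (homogExt u x₀ r x) (ψ x))).sub
    (hw ψ mψ)
  rw [← integral_sub (memLp_inner_integrable mc mψ) (memLp_inner_integrable m0 mψ)] at lim
  have e1 : ∫ x in ball 0 b, (inner ℝ (homogExt u x₀ r x) (ψ x) - inner ℝ (u₀ x) (ψ x)) =
      ∫ x in shell 0 a b, ‖homogExt u x₀ r x - u₀ x‖ := by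
    rw [← inter_eq_self_of_subset_right hsub, ← setIntegral_indicator hms]
    congr 1
    ext1 x
    rw [← inner_sub_left]
    change inner ℝ (f x) (ψ x) = (shell 0 a b).indicator (fun x => ‖f x‖) x
    by_cases hx : x ∈ shell 0 a b
    · rw [hψ, indicator_of_mem hx, indicator_of_mem hx, real_inner_smul_right,
        real_inner_self_eq_norm_sq]
      rcases eq_or_ne (‖f x‖) 0 with h0 | h0
      · simp [h0]
      · field_simp
    · rw [hψ, indicator_of_notMem hx, indicator_of_notMem hx, inner_zero_right]
  rw [e1] at lim
  refine le_of_tendsto lim ?_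
  have hev : ∀ᶠ k in atTop, ρ k * b ≤ r := by
    have := hρ0.mul_const b
    rw [zero_mul] at this
    exact this.eventually (Iic_mem_nhds hr)
  filter_upwards [hev] with k hk
  have mk := h.memLp_rescale_ball (b := b) (hρ k) (hk.trans hrR)
  refine le_trans ?_ (h.integral_shell_homogExt_sub_rescale_le hn hr hrR hε ha (hρ k) hk)
  rw [← integral_sub (memLp_inner_integrable mc mψ) (memLp_inner_integrable mk mψ)]
  have e2 : ∫ x in shell 0 a b, ‖homogExt u x₀ r x - rescale u x₀ (ρ k) x‖ =
      ∫ x in ball 0 b, (shell 0 a b).indicator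
        (fun x => ‖homogExt u x₀ r x - rescale u x₀ (ρ k) x‖) x := by
    rw [setIntegral_indicator hms, inter_eq_self_of_subset_right hsub]
  rw [e2]
  refine integral_mono ((memLp_inner_integrable mc mψ).sub (memLp_inner_integrable mk mψ))
    ((((mc.sub mk).integrable one_le_two).norm).indicator hms) fun x => ?_
  simp only
  rw [← inner_sub_left]
  by_cases hx : x ∈ shell 0 a b
  · rw [indicator_of_mem hx]
    refine (real_inner_le_norm _ _).trans ?_
    exact mul_le_of_le_one_right (norm_nonneg _) (hψ1 x)
  · rw [hψ, indicator_of_notMem hx, indicator_of_notMem hx, inner_zero_right]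

/-- Uniqueness of weak limits of the rescalings. -/
theorem ae_eq_of_isWeakLimit (hn : 1 ≤ n) (h : ApproxData x₀ R u G U) {ε : ℝ → ℝ}
    (hε0 : Tendsto ε (𝓝[>] 0) (𝓝 0))
    (hε : ∀ r s, 0 < s → s ≤ r → r ≤ R → sphereDist u x₀ r s ≤ ε r)
    {ρ ρ' : ℕ → ℝ} (hρ : ∀ k, 0 < ρ k) (hρ0 : Tendsto ρ atTop (𝓝 0))
    (hρ' : ∀ k, 0 < ρ' k) (hρ0' : Tendsto ρ' atTop (𝓝 0)) {u₀ u₁ : Eucl n → Eucl m}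
    (hu₀ : IsWeakLimit u x₀ ρ u₀) (hu₁ : IsWeakLimit u x₀ ρ' u₁) : u₁ =ᵐ[volume] u₀ := by
  have key : ∀ b : ℝ, 0 < b → ∀ᵐ x ∂volume.restrict (ball (0 : Eucl n) b), u₁ x = u₀ x := by
    intro b hb
    rw [← Measure.restrict_congr_set (shell_zero_ae_eq hn 0 b)]
    have hsub : shell (0 : Eucl n) 0 b ⊆ ball 0 b := fun x hx => hx.2
    have hi : IntegrableOn (fun x => ‖u₁ x - u₀ x‖) (shell 0 0 b) := by
      have fin : IsFiniteMeasure ((volume : Measure (Eucl n)).restrict (ball 0 b)) :=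
        ⟨by simpa using measure_ball_lt_top⟩
      exact IntegrableOn.mono_set
        ((((hu₁ b hb).1.sub (hu₀ b hb).1).integrable one_le_two).norm) hsub
    -- Both limits are close to the same cone c_r, whichever sequences produced them; afterwards r →
    -- 0.
    have hle : ∀ r ∈ Ioc 0 R, ∫ x in shell 0 0 b, ‖u₁ x - u₀ x‖ ≤
        2 * (ε r * ∫ t in Ioo 0 b, t ^ (n + 1)) := fun r hr => by
      obtain ⟨i0, l0⟩ := h.integral_shell_homogExt_sub_le hn hr.1 hr.2
        (fun s hs hsr => hε r s hs hsr hr.2) le_rfl hb hρ hρ0 hu₀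
      obtain ⟨i1, l1⟩ := h.integral_shell_homogExt_sub_le hn hr.1 hr.2
        (fun s hs hsr => hε r s hs hsr hr.2) le_rfl hb hρ' hρ0' hu₁
      have : ∫ x in shell 0 0 b, ‖u₁ x - u₀ x‖ ≤ ∫ x in shell 0 0 b,
          (‖homogExt u x₀ r x - u₁ x‖ + ‖homogExt u x₀ r x - u₀ x‖) :=
        integral_mono hi (i1.add i0) fun x => by
          have := norm_sub_le_norm_sub_add_norm_sub (u₁ x) (homogExt u x₀ r x) (u₀ x)
          rwa [norm_sub_rev (u₁ x) (homogExt u x₀ r x)] at this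
      rw [integral_add i1 i0] at this
      linarith
    have hlim : Tendsto (fun r => 2 * (ε r * ∫ t in Ioo 0 b, t ^ (n + 1))) (𝓝[>] 0) (𝓝 0) := by
      simpa using (hε0.mul_const (∫ t in Ioo 0 b, t ^ (n + 1))).const_mul 2
    have h0 : ∫ x in shell 0 0 b, ‖u₁ x - u₀ x‖ ≤ 0 :=
      ge_of_tendsto hlim (by
        filter_upwards [Ioc_mem_nhdsGT h.pos] with r hr using hle r hr)
    have h1 := (integral_eq_zero_iff_of_nonneg (fun x => norm_nonneg _) hi).1
      (le_antisymm h0 (integral_nonneg fun x => norm_nonneg _))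
    filter_upwards [h1] with x hx
    exact sub_eq_zero.1 (norm_eq_zero.1 hx)
  have h2 : ∀ᵐ x ∂(volume : Measure (Eucl n)), ∀ k : ℕ, x ∈ ball (0 : Eucl n) (k + 1) →
      u₁ x = u₀ x := ae_all_iff.2 fun k =>
    (ae_restrict_iff' measurableSet_ball).1 (key (k + 1) (by positivity))
  filter_upwards [h2] with x hx
  obtain ⟨k, hk⟩ := exists_nat_gt ‖x‖
  exact hx k (by rw [mem_ball_zero_iff]; linarith)

/-- Distance on the unit sphere of the rescaling to a continuous blow-up limit. -/
theorem integral_sphere_rescale_sub_le (hn : 1 ≤ n) (h : ApproxData x₀ R u G U)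
    (hr : 0 < r) (hrR : r ≤ R) {ε : ℝ} (hε : ∀ s, 0 < s → s ≤ r → sphereDist u x₀ r s ≤ ε)
    {ρ : ℕ → ℝ} (hρ : ∀ k, 0 < ρ k) (hρ0 : Tendsto ρ atTop (𝓝 0))
    {u₀ : Eucl n → Eucl m} (hu₀ : IsWeakLimit u x₀ ρ u₀) (hc : Continuous u₀) :
    ∫ θ : sphere (0 : Eucl n) 1, ‖rescale u x₀ r θ - u₀ θ‖ ∂sphereMeasure n ≤ ε := by
  have hp : Continuous fun θ : sphere (0 : Eucl n) 1 => rescale u x₀ r θ := by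
    have h1 : Continuous fun θ : sphere (0 : Eucl n) 1 => u (x₀ + r • (θ : Eucl n)) :=
      h.cont.comp_continuous (by fun_prop) fun θ => mem_closedBall_polar hr.le hrR θ
    exact h1.const_smul (1 / r ^ 2)
  set F : ℝ → ℝ := fun t => ∫ θ : sphere (0 : Eucl n) 1,
    ‖t ^ 2 • rescale u x₀ r θ - u₀ (t • (θ : Eucl n))‖ ∂sphereMeasure n with hF
  have hFc : Continuous F := by
    have h1 : Continuous (Function.uncurry fun (t : ℝ) (θ : sphere (0 : Eucl n) 1) =>
        ‖t ^ 2 • rescale u x₀ r θ - u₀ (t • (θ : Eucl n))‖) :=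
      (((continuous_fst.pow 2).smul (hp.comp continuous_snd)).sub
        (hc.comp (continuous_fst.smul (continuous_subtype_val.comp continuous_snd)))).norm
    have h2 := continuous_parametric_integral_of_continuous (μ := sphereMeasure n) h1 isCompact_univ
    rwa [Measure.restrict_univ] at h2
  -- The shell estimate says that H has nonnegative integral over (1, b) for every b > 1. The claim
  -- is H(1) ≥ 0.
  set H : ℝ → ℝ := fun t => ε * t ^ (n + 1) - t ^ (n - 1) * F t with hH
  have hHc : Continuous H := by fun_prop
  have hpos : ∀ b, 1 < b → 0 ≤ ∫ t in (1 : ℝ)..b, H t := fun b hb => by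
    obtain ⟨i1, l1⟩ := h.integral_shell_homogExt_sub_le hn hr hrR hε zero_le_one
      (zero_lt_one.trans hb) hρ hρ0 hu₀
    rw [(integral_shell hn zero_le_one i1).2] at l1
    have e : ∫ t in Ioo 1 b, t ^ (n - 1) * ∫ θ : sphere (0 : Eucl n) 1,
        ‖homogExt u x₀ r (0 + t • (θ : Eucl n)) - u₀ (0 + t • (θ : Eucl n))‖ ∂sphereMeasure n =
        ∫ t in Ioo 1 b, t ^ (n - 1) * F t := by
      refine setIntegral_congr_fun measurableSet_Ioo fun t ht => ?_
      simp only [hF, zero_add, homogExt_smul u x₀ r (zero_lt_one.trans ht.1)]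
    rw [e, ← integral_Ioc_eq_integral_Ioo, ← integral_Ioc_eq_integral_Ioo,
      ← intervalIntegral.integral_of_le hb.le, ← intervalIntegral.integral_of_le hb.le] at l1
    rw [hH, intervalIntegral.integral_sub (Continuous.intervalIntegrable (by fun_prop) _ _)
      (Continuous.intervalIntegrable (by fun_prop) _ _), intervalIntegral.integral_const_mul]
    linarith
  -- If H(1) < 0, continuity makes H negative on a short interval to the right of 1, and so is its
  -- integral there. This is where continuity of u₀ enters.
  have h1 : 0 ≤ H 1 := by
    by_contra! hneg
    obtain ⟨δ, hδ, hball⟩ := Metric.mem_nhds_iff.1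
      (hHc.continuousAt.eventually (Iio_mem_nhds hneg))
    have hb : (1 : ℝ) < 1 + δ / 2 := by linarith
    have := intervalIntegral.intervalIntegral_pos_of_pos_on (f := fun t => -H t)
      (hHc.neg.intervalIntegrable 1 (1 + δ / 2)) (fun t ht => neg_pos.2 (hball (by
        rw [mem_ball, Real.dist_eq, abs_of_pos (by linarith [ht.1])]
        linarith [ht.2]))) hb
    rw [intervalIntegral.integral_neg] at this
    linarith [hpos _ hb]
  simpa [hH, hF] using h1

end ApproxData

/-! ### Replacing u by its extension by zero outside D -/

section Localisation

variable {D : Set (Eucl n)} {u : Eucl n → Eucl m} {x₀ : Eucl n} {R r : ℝ}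

/-- Nothing is known about u outside D, whereas the slicing arguments want globally measurable
functions. Extending u by zero and choosing measurable versions of its gradient changes nothing on
the balls that matter. -/
theorem exists_approxData (hD : IsOpen D) (hu : ContinuousOn u D) (hw : MemW12 D u) (hR : 0 < R)
    (hRD : closedBall x₀ R ⊆ D) : ∃ G U, ApproxData x₀ R (D.indicator u) G U := by
  classical
  obtain ⟨F, hF⟩ := hw
  have hvm : StronglyMeasurable (D.indicator u) :=
    (piecewise_eq_indicator (f := u) (s := D) ▸ (hu.measurable_piecewise
      continuousOn_const hD.measurableSet)).stronglyMeasurable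
  choose G hGm hGae using fun i => (hF.memLp_grad i).1
  have hG : IsWeakGrad D (D.indicator u) G :=
    hF.congr (indicator_ae_eq_restrict hD.measurableSet).symm hGae
  have hc : ContinuousOn (D.indicator u) D := hu.congr fun x hx => indicator_of_mem hx u
  obtain ⟨U, h1, h2, h3⟩ := exists_smooth_approx hD hG hc (isCompact_closedBall x₀ R) hRD
  refine ⟨G, U, hR, hvm, hGm, hc.mono hRD, hG.mono (ball_subset_closedBall.trans hRD), h1, h2,
    fun i => ?_⟩
  exact tendsto_of_tendsto_of_tendsto_of_le_of_le tendsto_const_nhds (h3 i) (fun _ => zero_le)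
    fun k => eLpNorm_mono_measure _ (Measure.restrict_mono ball_subset_closedBall le_rfl)

theorem IsMinimiser.indicator (hD : IsOpen D) (hu : IsMinimiser D u) :
    IsMinimiser D (D.indicator u) := by
  have hae : u =ᵐ[volume.restrict D] D.indicator u :=
    (indicator_ae_eq_restrict hD.measurableSet).symm
  refine ⟨hu.1.congr hae, fun v hv hz => ?_⟩
  rw [← energy_congr hD hu.1 hae]
  refine hu.2 v hv ?_
  obtain ⟨F, hF⟩ := hz.1
  have h1 := hz.isWeakGradZero hD hF
  have hae' : v - D.indicator u =ᵐ[volume.restrict D] v - u := EventuallyEq.rfl.sub hae.symm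
  have h2 : IsWeakGradZero D (v - u) F := by
    refine ⟨hF.congr hae' fun i => EventuallyEq.rfl, fun ε hε => ?_⟩
    obtain ⟨φ, hφ, hle, hg⟩ := h1.approx ε hε
    exact ⟨φ, hφ, (eLpNorm_congr_ae (EventuallyEq.rfl.sub hae')).symm.le.trans hle, hg⟩
  exact h2.memW12Zero hD

theorem rescale_indicator (hr : 0 < r) (hrR : r ≤ R) (hRD : closedBall x₀ R ⊆ D) {x : Eucl n}
    (hx : ‖x‖ ≤ 1) : rescale (D.indicator u) x₀ r x = rescale u x₀ r x := by
  have hmem : x₀ + r • x ∈ closedBall x₀ R := by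
    rw [mem_closedBall, dist_eq_norm, add_sub_cancel_left, norm_smul, Real.norm_of_nonneg hr.le]
    exact (mul_le_of_le_one_right hr.le hx).trans hrR
  rw [rescale, rescale, indicator_of_mem (hRD hmem)]

theorem homogExt_indicator (hr : 0 < r) (hrR : r ≤ R) (hRD : closedBall x₀ R ⊆ D) :
    homogExt (D.indicator u) x₀ r = homogExt u x₀ r := by
  ext1 x
  rw [homogExt, homogExt, rescale_indicator hr hrR hRD]
  rw [norm_smul, norm_inv, norm_norm]
  exact inv_mul_le_one

theorem weissEnergy_indicator (hn : 1 ≤ n) (hD : IsOpen D) (hw : MemW12 D u) (hr : 0 < r)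
    (hrR : r ≤ R) (hRD : closedBall x₀ R ⊆ D) :
    weissEnergy (D.indicator u) x₀ r = weissEnergy u x₀ r := by
  have hsub : ball x₀ r ⊆ D := (ball_subset_closedBall.trans (closedBall_subset_closedBall hrR)).trans hRD
  obtain ⟨F, hF⟩ := hw
  have hae : u =ᵐ[volume.restrict (ball x₀ r)] D.indicator u :=
    ae_restrict_of_ae_restrict_of_subset hsub (indicator_ae_eq_restrict hD.measurableSet).symm
  rw [weissEnergy, weissEnergy, energy_congr isOpen_ball ⟨F, hF.mono hsub⟩ hae,
    two_div_mul_sphereIntegral hn u x₀ hr, two_div_mul_sphereIntegral hn _ x₀ hr, sphereSq, sphereSq]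
  simp only [rescale_indicator hr hrR hRD (norm_eq_of_mem_sphere _).le]

theorem weissLimit_indicator (hn : 1 ≤ n) (hD : IsOpen D) (hw : MemW12 D u) (hR : 0 < R)
    (hRD : closedBall x₀ R ⊆ D) : weissLimit (D.indicator u) x₀ = weissLimit u x₀ := by
  refine limsup_congr ?_
  filter_upwards [Ioc_mem_nhdsGT hR] with r hr
  rw [weissEnergy_indicator hn hD hw hr.1 hr.2 hRD]

/-- Only weak L² convergence of the functions is retained; gradients play no role in what follows.
On a fixed ball the rescalings eventually involve only points of D, where the extension agrees with
u. -/
theorem IsBlowUpLimit.exists_isWeakLimit (hR : 0 < R) (hRD : closedBall x₀ R ⊆ D)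
    {u₀ : Eucl n → Eucl m} (h : IsBlowUpLimit u x₀ u₀) :
    ∃ ρ : ℕ → ℝ, (∀ k, 0 < ρ k) ∧ Tendsto ρ atTop (𝓝 0) ∧
      IsWeakLimit (D.indicator u) x₀ ρ u₀ := by
  obtain ⟨ρ, hρ, hρ0, hw⟩ := h
  refine ⟨ρ, hρ, hρ0, fun b hb => ?_⟩
  obtain ⟨⟨F, hF⟩, -, hlim⟩ := hw b hb
  refine ⟨hF.memLp, fun ψ hψ => ((hlim ψ hψ).1).congr' ?_⟩
  have hev : ∀ᶠ k in atTop, ρ k * b ≤ R := by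
    have := hρ0.mul_const b
    rw [zero_mul] at this
    exact this.eventually (Iic_mem_nhds hR)
  filter_upwards [hev] with k hk
  refine setIntegral_congr_fun measurableSet_ball fun x hx => ?_
  have hmem : x₀ + ρ k • x ∈ closedBall x₀ R := by
    rw [mem_ball_zero_iff] at hx
    rw [mem_closedBall, dist_eq_norm, add_sub_cancel_left, norm_smul,
      Real.norm_of_nonneg (hρ k).le]
    exact (mul_le_mul_of_nonneg_left hx.le (hρ k).le).trans hk
  simp only [rescale, indicator_of_mem (hRD hmem)]

end Localisation

/-! ### Conclusion -/

theorem tendsto_decay {c β R : ℝ} (hβ : 0 < β) :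
    Tendsto (fun r : ℝ => c * (r / R) ^ β) (𝓝[>] 0) (𝓝 0) := by
  have h1 : Continuous fun r : ℝ => c * (r / R) ^ β :=
    continuous_const.mul ((Real.continuous_rpow_const hβ.le).comp (continuous_id.div_const R))
  have h2 := h1.tendsto 0
  simp only [zero_div, Real.zero_rpow hβ.ne', mul_zero] at h2
  exact h2.mono_left nhdsWithin_le_nhds

end SingularSystem

theorem mainTheorem5 (n : ℕ) (hn : 2 ≤ n) (κ : ℝ) (hκ0 : 0 < κ) (hκ1 : κ < 1) :
    ∃ C : ℝ, 0 < C ∧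
      ∀ (m : ℕ), 1 ≤ m →
      ∀ (D : Set (SingularSystem.Eucl n)), IsOpen D → Bornology.IsBounded D →
      ∀ (u : SingularSystem.Eucl n → SingularSystem.Eucl m),
        ContinuousOn u D → SingularSystem.IsMinimiser D u →
      ∀ (x₀ : SingularSystem.Eucl n), x₀ ∈ D ∩ frontier {x ∈ D | 0 < ‖u x‖} →
      ∀ (r₀ : ℝ), 0 < r₀ → r₀ < 1 → closedBall x₀ r₀ ⊆ D →
        (∀ r : ℝ, 0 < r → r ≤ r₀ →
          SingularSystem.EpiperimetricIneq κ (SingularSystem.weissLimit u x₀)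
            (SingularSystem.homogExt u x₀ r)) →
        ∃ w : ℝ, SingularSystem.weissLimit u x₀ = (w : EReal) ∧
          Tendsto (SingularSystem.weissEnergy u x₀) (𝓝[>] 0) (𝓝 w) ∧
          (∀ r ∈ Ioo 0 r₀,
            |SingularSystem.weissEnergy u x₀ r - w| ≤
              |SingularSystem.weissEnergy u x₀ r₀ - w|
                * (r / r₀) ^ (((n : ℝ) + 2) * κ / (1 - κ))) ∧
          (∀ u₀ : SingularSystem.Eucl n → SingularSystem.Eucl m,
            SingularSystem.IsBlowUpLimit u x₀ u₀ →
              (Continuous u₀ → ∀ r ∈ Ioo 0 (r₀ / 2),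
                SingularSystem.sphereIntegral 0 1
                    (fun x => ‖SingularSystem.rescale u x₀ r x - u₀ x‖) ≤
                  C * |SingularSystem.weissEnergy u x₀ r₀ - w| ^ ((1 : ℝ) / 2)
                    * (r / r₀) ^ (((n : ℝ) + 2) * κ / (2 * (1 - κ)))) ∧
              ∀ u₁ : SingularSystem.Eucl n → SingularSystem.Eucl m,
                SingularSystem.IsBlowUpLimit u x₀ u₁ → u₁ =ᵐ[volume] u₀) := by
  have hn1 : 1 ≤ n := by omega
  have hκ : 0 < 1 - κ := sub_pos.2 hκ1
  set β : ℝ := ((n : ℝ) + 2) * κ / (2 * (1 - κ)) with hβ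
  have hβ0 : 0 < β := by positivity
  -- The summand 1 only serves to make the constant positive.
  refine ⟨SingularSystem.decayConst n β + 1,
    by linarith [SingularSystem.decayConst_nonneg n hβ0], ?_⟩
  intro m _ D hD hDb u huc hu x₀ _ R hR _ hRD hepi
  have hbd : volume D < ⊤ := hDb.measure_lt_top
  have hRD' : ball x₀ R ⊆ D := ball_subset_closedBall.trans hRD
  obtain ⟨G, U, h⟩ := SingularSystem.exists_approxData hD huc hu.1 hR hRD
  set v := D.indicator u
  have hv : SingularSystem.IsMinimiser D v := hu.indicator hD
  have hW : ∀ r, 0 < r → r ≤ R →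
      SingularSystem.weissEnergy v x₀ r = SingularSystem.weissEnergy u x₀ r :=
    fun r hr hrR => SingularSystem.weissEnergy_indicator hn1 hD hu.1 hr hrR hRD
  rw [← SingularSystem.weissLimit_indicator hn1 hD hu.1 hR hRD] at hepi ⊢
  obtain ⟨w, hw, hlim, hle⟩ :=
    h.exists_weissLimit hn1 hD hbd hv hRD' hκ0 (hepi R hR le_rfl)
  have hepi' : ∀ r : ℝ, 0 < r → r < R →
      SingularSystem.EpiperimetricIneq κ w (SingularSystem.homogExt v x₀ r) := fun r hr hrR => by
    rw [SingularSystem.homogExt_indicator hr hrR.le hRD, ← hw]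
    exact hepi r hr hrR.le
  have hdist := fun r s (hs : 0 < s) (hsr : s ≤ r) (hr : r ≤ R) =>
    h.sphereDist_le hn1 hD hbd hv hRD' hκ0 hκ1 hle hepi' hs hsr hr
  -- Since w lies below all energies, the absolute values are plain differences.
  have heR : |SingularSystem.weissEnergy u x₀ R - w| = SingularSystem.weissEnergy v x₀ R - w := by
    rw [← hW R hR le_rfl, abs_of_nonneg (sub_nonneg.2 (hle R ⟨hR, le_rfl⟩))]
  refine ⟨w, hw, hlim.congr' ?_, fun r hr => ?_, fun u₀ hu₀ => ⟨fun hc r hr => ?_, fun u₁ hu₁ => ?_⟩⟩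
  · filter_upwards [Ioc_mem_nhdsGT hR] with r hr
    exact hW r hr.1 hr.2
  · rw [heR, ← hW r hr.1 hr.2.le, abs_of_nonneg (sub_nonneg.2 (hle r ⟨hr.1, hr.2.le⟩))]
    exact h.weissEnergy_decay hn1 hD hbd hv hRD' hκ1 hepi' hr.1 hr.2.le le_rfl
  · obtain ⟨ρ, hρ, hρ0, hwl⟩ := hu₀.exists_isWeakLimit hR hRD
    have hrR : r ≤ R := by linarith [hr.2]
    have key := h.integral_sphere_rescale_sub_le hn1 hr.1 hrR
      (fun s hs hsr => hdist r s hs hsr hrR) hρ hρ0 hwl hc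
    rw [SingularSystem.sphereIntegral_zero_one, heR, ← Real.sqrt_eq_rpow]
    have e : ∀ θ : sphere (0 : SingularSystem.Eucl n) 1,
        SingularSystem.rescale v x₀ r θ = SingularSystem.rescale u x₀ r θ := fun θ =>
      SingularSystem.rescale_indicator hr.1 hrR hRD (norm_eq_of_mem_sphere θ).le
    simp only [e] at key
    refine key.trans (mul_le_mul_of_nonneg_right (mul_le_mul_of_nonneg_right (by linarith)
      (Real.sqrt_nonneg _)) (Real.rpow_nonneg (div_nonneg hr.1.le hR.le) _))
  · obtain ⟨ρ, hρ, hρ0, hwl⟩ := hu₀.exists_isWeakLimit hR hRD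
    obtain ⟨ρ', hρ', hρ0', hwl'⟩ := hu₁.exists_isWeakLimit hR hRD
    -- The Cauchy estimate `hdist` is the modulus ε(r), which tends to 0 because β > 0.
    exact h.ae_eq_of_isWeakLimit hn1 (SingularSystem.tendsto_decay hβ0) hdist hρ hρ0 hρ' hρ0'
      hwl hwl'
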